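/- **Setting.** For a measurable space $\Omega$ and $0<r\le 1$, let $\mathcal S^r(\Omega)$ be the normed space of $r$-th powers of finite signed measures, i.e. the direct limit of the spaces $L^{1/r}(\Omega,\mu)$ over all finite measures $\mu$ ordered by absolute continuity, along the isometries $\phi\mapsto\phi\,(d\mu/d\nu)^r$ for $\mu\ll\nu$. The image of $\phi\in L^{1/r}(\Omega,\mu)$ is written $\phi\mu^r$, and $\mu^r:=1\cdot\mu^r$. Let $\mathcal M^r(\Omega)$ (resp. $\mathcal P^r(\Omega)$) be the subset of all $\mu^r$ with $\mu$ a finite measure (resp. a probability measure), with tangent spaces $$T_{\mu^r}\mathcal M^r(\Omega)=\{\phi\mu^r:\phi\in L^{1/r}(\mu)\},\qquad T_{\mu^r}\mathcal P^r(\Omega)=\Big\{\phi\mu^r:\phi\in L^{1/r}(\mu),\ \int\phi\,d\mu=0\Big\}.$$ A continuous vector field on $\mathcal M^r(\Omega)$ (resp. $\mathcal P^r(\Omega)$) is a continuous map $X$ from it to $\mathcal S^r(\Omega)$ with $X_{\mu^r}$ tangent at $\mu^r$ for all $\mu^r$. A covariant $n$-tensor on it is a collection of $n$-multilinear forms $\Psi_{\mu^r}$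 on the tangent spaces such that $\mu^r\mapsto\Psi_{\mu^r}(X^1_{\mu^r},\dots,X^n_{\mu^r})$ is continuous for all continuous vector fields $X^1,\dots,X^n$. A Markov kernel $K:\Omega\to\mathcal P(\Omega')$ acts on finite signed measures by $K_*\nu(A')=\int K(\omega;A')\,d\nu(\omega)$; it is *congruent* if for some measurable $\kappa:\Omega'\to\Omega$ one has $\kappa_*K(\omega)=\delta_\omega$ for all $\omega$. Put $\mu'=K_*\mu$. The formal derivative of $K_r:\mu^r\mapsto\mu'^r$ is $d_{\mu^r}K_r(\phi\mu^r)=\frac{d\{K_*(\phi\mu)\}}{d\mu'}\,\mu'^r$, and the pull-back of an $n$-tensor is $(K_r^*\Psi)_{\mu^r}(V_1,\dots,V_n)=\Psi_{\mu'^r}(dK_r V_1,\dots,dK_rV_n)$. For $m\le 1/r$ the canonical $m$-tensor is $(\tau^m_{\Omega;r})_{\mu^r}(\phi_1\mu^r,\dots,\phi_m\mu^r)=r^{-m}\int_\Omega\phi_1\cdots\phi_m\,d\mu$, and for a partition $\mathbf P=\{P_1,\dots,P_l\}$ of $\{1,\dots,n\}$ with all $|P_i|\le 1/r$ put $\tau^{\mathbf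 P}_{\Omega;r}(v_1,\dots,v_n)=\prod_i\tau^{|P_i|}_{\Omega;r}\big((v_j)_{j\in P_i}\big)$. **Theorem (classification of congruent families).** Let $0<r\le1$ and $n\ge1$, and let $(\Theta^n_{\Omega;r})$ be a family of covariant $n$-tensors on $\mathcal M^r(\Omega)$ (resp. on $\mathcal P^r(\Omega)$), one for each measurable space $\Omega$. The following are equivalent: 1. The family is congruent: $K_r^*\Theta^n_{\Omega';r}=\Theta^n_{\Omega;r}$ for every congruent Markov kernel $K:\Omega\to\mathcal P(\Omega')$. 2. $K_r^*\Theta^n_{\Omega;r}=\Theta^n_{I;r}$ for every congruent Markov kernel $K:I\to\mathcal P(\Omega)$ with $I$ a finite set (with the $\sigma$-algebra of all subsets). 3. On $\mathcal M^r$: there are uniquely determined continuous functions $a_{\mathbf P}:(0,\infty)\to\mathbb R$, one for each partition $\mathbf P$ of $\{1,\dots,n\}$ with all blocks of size $\le1/r$, such that for all $\Omega$ and $\mu$ $$(\Theta^n_{\Omega;r})_{\mu^r}=\sum_{\mathbf P}a_{\mathbf P}(\|\mu\|)\,(\tau^{\mathbf P}_{\Omega;r})_{\mu^r},\qquad \|\mu\|=\mu(\Omega)$$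 (for $\mu=0$ the tangent space is zero and both sides are read as $0$). Resp., on $\mathcal P^r$: there are uniquely determined constants $c_{\mathbf P}\in\mathbb R$, one for each partition with all blocks of size between $2$ and $1/r$, such that $\Theta^n_{\Omega;r}=\sum_{\mathbf P}c_{\mathbf P}\,\tau^{\mathbf P}_{\Omega;r}$ for all $\Omega$. **Consequence.** Let $k=1/r$, and let $(\Theta^n_{\Omega;r})$ be a congruent family on $\mathcal M^r$ (resp. $\mathcal P^r$). Then for the functions $a_{\mathbf P}$ (resp. constants $c_{\mathbf P}$) in 3 the following holds for every $k$-integrable parametrized measure model (resp. statistical model) $(M,\Omega,\mathbf p)$, i.e. for every manifold $M$ without boundary, of finite or infinite dimension, and every map $\mathbf p$ from $M$ to the finite measures (resp. probability measures) on $\Omega$ such that $\mathbf p:M\to\mathcal S(\Omega)=\mathcal S^1(\Omega)$ and $\mathbf p^{1/k}:M\to\mathcal S^{1/k}(\Omega)$ are continuously Fréchet differentiable: for all $\xi\in M$ the differential $d_\xi\mathbf p^{1/k}$ takes values in the tangent space at $\mathbf p(\xi)^{1/k}$, and $$(\mathbf p^{1/k})^*\Theta^n_{\Omega;1/k}=\sum_{\mathbf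 P}a_{\mathbf P}(\|\mathbf p\|)\,\tau^{\mathbf P}_{(M,\Omega,\mathbf p)}\qquad\Big(\text{resp. }\sum_{\mathbf P}c_{\mathbf P}\,\tau^{\mathbf P}_{(M,\Omega,\mathbf p)}\Big),$$ where $\tau^{\mathbf P}_{(M,\Omega,\mathbf p)}(V_1,\dots,V_n)=\prod_i\tau^{|P_i|}_{(M,\Omega,\mathbf p)}\big((V_j)_{j\in P_i}\big)$ and $\tau^m_{(M,\Omega,\mathbf p)}=(\mathbf p^{1/k})^*\tau^m_{\Omega;1/k}$, $m\le k$, are the canonical tensors of the model. That is, the invariant tensor field is algebraically generated by the canonical tensors $\tau^m_{(M,\Omega,\mathbf p)}$ with $m\le k$. -/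

import Mathlib

universe u v w

open MeasureTheory ProbabilityTheory Set
open scoped ENNReal Manifold Topology

noncomputable section

namespace CongruentTensors

/-! ### The spaces of powers of finite signed measures -/

/-- The exponents `r` with `0 < r ≤ 1`. -/
abbrev Exponent : Type := Set.Ioc (0 : ℝ) 1

/-- The integrability exponent `1 / r` attached to `r`. -/
def Exponent.inv (r : Exponent) : ℝ≥0∞ := ENNReal.ofReal (1 / (r : ℝ))

theorem Exponent.one_le_inv (r : Exponent) : 1 ≤ r.inv := by
  rw [Exponent.inv, ← ENNReal.ofReal_one]
  exact ENNReal.ofReal_le_ofReal ((one_le_div r.2.1).2 r.2.2)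

theorem Exponent.inv_ne_top (r : Exponent) : r.inv ≠ ⊤ := ENNReal.ofReal_ne_top

theorem Exponent.inv_ne_zero (r : Exponent) : r.inv ≠ 0 :=
  (zero_lt_one.trans_le r.one_le_inv).ne'

theorem Exponent.toReal_inv (r : Exponent) : r.inv.toReal = 1 / (r : ℝ) :=
  ENNReal.toReal_ofReal (one_div_nonneg.2 r.2.1.le)

instance (r : Exponent) : Fact (1 ≤ r.inv) := ⟨r.one_le_inv⟩

/-- Finite (nonnegative) measures on `Ω`, to be preordered by absolute continuity. -/
structure FinMeas (Ω : Type u) [MeasurableSpace Ω] : Type u where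
  /-- The underlying measure. -/
  toMeasure : Measure Ω
  /-- The total mass is finite. -/
  isFinite : IsFiniteMeasure toMeasure

section Powers

variable {Ω : Type u} [MeasurableSpace Ω]

instance (μ : FinMeas Ω) : IsFiniteMeasure μ.1 := μ.2

/-- The preorder `μ ≤ ν :↔ μ ≪ ν`. -/
instance : Preorder (FinMeas Ω) where
  le μ ν := μ.1 ≪ ν.1
  le_refl _ := Measure.AbsolutelyContinuous.rfl
  le_trans _ _ _ h₁ h₂ := Measure.AbsolutelyContinuous.trans h₁ h₂

theorem FinMeas.le_def {μ ν : FinMeas Ω} : μ ≤ ν ↔ μ.1 ≪ ν.1 := Iff.rfl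

instance : Nonempty (FinMeas Ω) := ⟨⟨0, inferInstance⟩⟩

instance : IsDirectedOrder (FinMeas Ω) where
  directed μ ν := ⟨⟨μ.1 + ν.1, inferInstance⟩,
    (Measure.le_add_right le_rfl).absolutelyContinuous,
    (Measure.le_add_left le_rfl).absolutelyContinuous⟩

/-- The total mass `‖μ‖ = μ(Ω)`. -/
def FinMeas.mass (μ : FinMeas Ω) : ℝ := μ.1.real Set.univ

theorem eLpNorm_rescale (r : Exponent) {μ ν : FinMeas Ω} (h : μ ≤ ν) {φ : Ω → ℝ}
    (hφ : StronglyMeasurable φ) :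
    eLpNorm (fun x => φ x * ((μ.1.rnDeriv ν.1 x).toReal) ^ (r : ℝ)) r.inv ν.1
      = eLpNorm φ r.inv μ.1 := by
  have hr : (0 : ℝ) < r := r.2.1
  rw [eLpNorm_eq_lintegral_rpow_enorm_toReal r.inv_ne_zero r.inv_ne_top,
    eLpNorm_eq_lintegral_rpow_enorm_toReal r.inv_ne_zero r.inv_ne_top, r.toReal_inv]
  congr 1
  rw [← lintegral_rnDeriv_mul h (hφ.measurable.enorm.pow_const _).aemeasurable]
  refine lintegral_congr_ae ?_
  filter_upwards [Measure.rnDeriv_lt_top μ.1 ν.1] with x hx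
  rw [enorm_mul, ENNReal.mul_rpow_of_nonneg _ _ (by positivity), mul_comm]
  congr 1
  rw [Real.enorm_eq_ofReal (by positivity), ENNReal.ofReal_rpow_of_nonneg (by positivity)
    (by positivity), ← Real.rpow_mul (by positivity), mul_one_div_cancel hr.ne', Real.rpow_one,
    ENNReal.ofReal_toReal hx.ne]

theorem memLp_rescale (r : Exponent) {μ ν : FinMeas Ω} (h : μ ≤ ν) (φ : Lp ℝ r.inv μ.1) :
    MemLp (fun x => φ x * ((μ.1.rnDeriv ν.1 x).toReal) ^ (r : ℝ)) r.inv ν.1 := by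
  refine ⟨?_, ?_⟩
  · exact ((Lp.stronglyMeasurable φ).measurable.mul
      ((Measure.measurable_rnDeriv _ _).ennreal_toReal.pow_const _)).aestronglyMeasurable
  · rw [eLpNorm_rescale r h (Lp.stronglyMeasurable φ)]
    exact Lp.eLpNorm_lt_top φ

theorem ae_imp_rescale (r : Exponent) {μ : FinMeas Ω} (ν : FinMeas Ω) {f g : Ω → ℝ}
    (hfg : f =ᵐ[μ.1] g) :
    (fun x => f x * ((μ.1.rnDeriv ν.1 x).toReal) ^ (r : ℝ))
      =ᵐ[ν.1] fun x => g x * ((μ.1.rnDeriv ν.1 x).toReal) ^ (r : ℝ) := by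
  filter_upwards [Measure.ae_rnDeriv_ne_zero_imp_of_ae ν.1 hfg] with x hx
  by_cases h0 : μ.1.rnDeriv ν.1 x = 0
  · simp [h0, Real.zero_rpow r.2.1.ne']
  · rw [hx h0]

/-- For `μ ≪ ν`, the isometric map `L^{1/r}(μ) → L^{1/r}(ν)`, `φ ↦ φ (dμ/dν)^r`, which expresses
`φ μ^r` in terms of `ν^r`. -/
def rescale (r : Exponent) {μ ν : FinMeas Ω} (h : μ ≤ ν) :
    Lp ℝ r.inv μ.1 →ₗ[ℝ] Lp ℝ r.inv ν.1 where
  toFun φ := (memLp_rescale r h φ).toLp _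
  map_add' φ ψ := by
    rw [← MemLp.toLp_add, MemLp.toLp_eq_toLp_iff]
    refine (ae_imp_rescale r ν (Lp.coeFn_add φ ψ)).trans (ae_of_all _ fun x => ?_)
    simp [add_mul]
  map_smul' c φ := by
    rw [RingHom.id_apply, ← MemLp.toLp_const_smul, MemLp.toLp_eq_toLp_iff]
    refine (ae_imp_rescale r ν (Lp.coeFn_smul c φ)).trans (ae_of_all _ fun x => ?_)
    simp [mul_assoc]

theorem coeFn_rescale (r : Exponent) {μ ν : FinMeas Ω} (h : μ ≤ ν) (φ : Lp ℝ r.inv μ.1) :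
    rescale r h φ =ᵐ[ν.1] fun x => φ x * ((μ.1.rnDeriv ν.1 x).toReal) ^ (r : ℝ) :=
  MemLp.coeFn_toLp (memLp_rescale r h φ)

theorem norm_rescale (r : Exponent) {μ ν : FinMeas Ω} (h : μ ≤ ν) (φ : Lp ℝ r.inv μ.1) :
    ‖rescale r h φ‖ = ‖φ‖ := by
  rw [Lp.norm_def, Lp.norm_def, eLpNorm_congr_ae (coeFn_rescale r h φ),
    eLpNorm_rescale r h (Lp.stronglyMeasurable φ)]

instance (r : Exponent) : DirectedSystem (fun μ : FinMeas Ω => Lp ℝ r.inv μ.1)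
    (fun _ _ h => rescale r h) where
  map_self μ φ := by
    refine Lp.ext ((coeFn_rescale r le_rfl φ).trans ?_)
    filter_upwards [Measure.rnDeriv_self μ.1] with x hx
    simp [hx]
  map_map κ ν μ h₁ h₂ φ := by
    refine Lp.ext ((coeFn_rescale r _ _).trans ?_)
    refine (ae_imp_rescale r κ (coeFn_rescale r h₁ φ)).trans ?_
    refine Filter.EventuallyEq.trans ?_ (coeFn_rescale r _ φ).symm
    filter_upwards [Measure.rnDeriv_mul_rnDeriv (κ := κ.1) h₁] with x hx
    rw [← hx, Pi.mul_apply, ENNReal.toReal_mul, Real.mul_rpow (by positivity) (by positivity),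
      mul_assoc]

open Classical in
/-- The space `S^r(Ω)` of `r`-th powers of finite signed measures: the direct limit of the spaces
`L^{1/r}(Ω, μ)` over all finite measures `μ`, where for `μ ≪ ν` the element `φ ∈ L^{1/r}(Ω, μ)` is
identified with `φ (dμ/dν)^r ∈ L^{1/r}(Ω, ν)`. For `r = 1` this is the space of finite signed
measures, with the norm of total variation. -/
def RootMeas (r : Exponent) (Ω : Type u) [MeasurableSpace Ω] : Type u :=
  Module.DirectLimit (fun μ : FinMeas Ω => Lp ℝ r.inv μ.1) (fun _ _ h => rescale r h)

/-- The vector space structure of `S^r(Ω)`. -/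
instance (r : Exponent) : AddCommGroup (RootMeas r Ω) := by
  classical
  exact inferInstanceAs (AddCommGroup
    (Module.DirectLimit (fun μ : FinMeas Ω => Lp ℝ r.inv μ.1) (fun _ _ h => rescale r h)))

instance (r : Exponent) : Module ℝ (RootMeas r Ω) := by
  classical
  exact inferInstanceAs (Module ℝ
    (Module.DirectLimit (fun μ : FinMeas Ω => Lp ℝ r.inv μ.1) (fun _ _ h => rescale r h)))

open Classical in
/-- The inclusion `L^{1/r}(Ω, μ) → S^r(Ω)`, `φ ↦ φ μ^r`, whose image is the space `S^r(Ω; μ)` of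
elements dominated by `μ`. -/
def densityPow (r : Exponent) (μ : FinMeas Ω) : Lp ℝ r.inv μ.1 →ₗ[ℝ] RootMeas r Ω :=
  Module.DirectLimit.of ℝ (FinMeas Ω) (fun μ : FinMeas Ω => Lp ℝ r.inv μ.1)
    (fun _ _ h => rescale r h) μ

theorem densityPow_rescale (r : Exponent) {μ ν : FinMeas Ω} (h : μ ≤ ν) (φ : Lp ℝ r.inv μ.1) :
    densityPow r ν (rescale r h φ) = densityPow r μ φ := by
  classical
  exact Module.DirectLimit.of_f

theorem exists_densityPow (r : Exponent) (x : RootMeas r Ω) :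
    ∃ (μ : FinMeas Ω) (φ : Lp ℝ r.inv μ.1), densityPow r μ φ = x := by
  classical
  exact Module.DirectLimit.exists_of x

theorem exists_densityPow₂ (r : Exponent) (x y : RootMeas r Ω) :
    ∃ (μ : FinMeas Ω) (φ ψ : Lp ℝ r.inv μ.1), densityPow r μ φ = x ∧ densityPow r μ ψ = y := by
  classical
  exact Module.DirectLimit.exists_of₂ x y

theorem norm_eq_of_densityPow_eq (r : Exponent) {μ ν : FinMeas Ω} {φ : Lp ℝ r.inv μ.1}
    {ψ : Lp ℝ r.inv ν.1} (h : densityPow r μ φ = densityPow r ν ψ) : ‖φ‖ = ‖ψ‖ := by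
  classical
  obtain ⟨κ, h₁, h₂⟩ := exists_ge_ge μ ν
  have h' : densityPow r κ (rescale r h₁ φ) = densityPow r κ (rescale r h₂ ψ) := by
    rw [densityPow_rescale, densityPow_rescale, h]
  obtain ⟨ρ, h₃, h₄⟩ := Module.DirectLimit.exists_eq_of_of_eq h'
  rw [← norm_rescale r h₁, ← norm_rescale r h₃, h₄, norm_rescale, norm_rescale]

/-- The norm `‖φ μ^r‖ = ‖φ‖_{L^{1/r}(μ)}` of `S^r(Ω)`. -/
instance (r : Exponent) : Norm (RootMeas r Ω) where
  norm x := ‖(exists_densityPow r x).choose_spec.choose‖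

theorem norm_densityPow (r : Exponent) (μ : FinMeas Ω) (φ : Lp ℝ r.inv μ.1) :
    ‖densityPow r μ φ‖ = ‖φ‖ :=
  norm_eq_of_densityPow_eq r (exists_densityPow r (densityPow r μ φ)).choose_spec.choose_spec

theorem normCore (r : Exponent) : NormedSpace.Core ℝ (RootMeas r Ω) where
  norm_nonneg _ := norm_nonneg (_ : Lp ℝ r.inv _)
  norm_smul c x := by
    obtain ⟨μ, φ, rfl⟩ := exists_densityPow r x
    rw [← map_smul, norm_densityPow, norm_densityPow, norm_smul]
  norm_triangle x y := by
    obtain ⟨μ, φ, ψ, rfl, rfl⟩ := exists_densityPow₂ r x y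
    rw [← map_add, norm_densityPow, norm_densityPow, norm_densityPow]
    exact norm_add_le φ ψ
  norm_eq_zero_iff x := by
    obtain ⟨μ, φ, rfl⟩ := exists_densityPow r x
    rw [norm_densityPow, norm_eq_zero]
    refine ⟨fun h => by rw [h, map_zero], fun h => ?_⟩
    rw [← norm_eq_zero, ← norm_densityPow, h, ← map_zero (densityPow r μ), norm_densityPow,
      norm_zero]

instance (r : Exponent) : NormedAddCommGroup (RootMeas r Ω) := NormedAddCommGroup.ofCore (normCore r)

instance (r : Exponent) : NormedSpace ℝ (RootMeas r Ω) := NormedSpace.ofCore (normCore r)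

/-- The `r`-th power `μ^r ∈ S^r(Ω)` of a finite measure `μ`. -/
def rootPow (r : Exponent) (μ : FinMeas Ω) : RootMeas r Ω :=
  densityPow r μ (Lp.const r.inv μ.1 (1 : ℝ))

end Powers

/-! ### Markov kernels and the formal derivative -/

section Markov

variable {Ω Ω' : Type u} [MeasurableSpace Ω] [MeasurableSpace Ω']

/-- The image `K_* μ` of a finite measure under a Markov kernel,
`K_* μ(A') = ∫ K(ω; A') dμ(ω)`. -/
def FinMeas.push (K : Kernel Ω Ω') [IsMarkovKernel K] (μ : FinMeas Ω) : FinMeas Ω' :=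
  ⟨K ∘ₘ μ.1, inferInstance⟩

/-- The Markov morphism `K_* : S(Ω) → S(Ω')` on finite signed measures,
`K_* ν(A') = ∫ K(ω; A') dν(ω)`, computed through the Jordan decomposition `ν = ν⁺ - ν⁻`. -/
def markovMorphism (K : Kernel Ω Ω') [IsMarkovKernel K] (ν : SignedMeasure Ω) :
    SignedMeasure Ω' :=
  (K ∘ₘ ν.toJordanDecomposition.posPart).toSignedMeasure
    - (K ∘ₘ ν.toJordanDecomposition.negPart).toSignedMeasure

/-- A Markov kernel `K : Ω → P(Ω')` is congruent if `κ_* K(ω) = δ_ω` for all `ω`, for some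
statistic (measurable map) `κ : Ω' → Ω`. -/
def IsCongruentKernel (K : Kernel Ω Ω') : Prop :=
  ∃ κ : Ω' → Ω, Measurable κ ∧ ∀ ω, (K ω).map κ = Measure.dirac ω

theorem integrable_of_Lp (r : Exponent) (μ : FinMeas Ω) (φ : Lp ℝ r.inv μ.1) :
    Integrable φ μ.1 :=
  (Lp.memLp φ).integrable r.one_le_inv

theorem markovMorphism_sub (K : Kernel Ω Ω') [IsMarkovKernel K] (α β : Measure Ω)
    [IsFiniteMeasure α] [IsFiniteMeasure β] :
    markovMorphism K (α.toSignedMeasure - β.toSignedMeasure)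
      = (K ∘ₘ α).toSignedMeasure - (K ∘ₘ β).toSignedMeasure := by
  set ν := α.toSignedMeasure - β.toSignedMeasure with hν
  set p := ν.toJordanDecomposition.posPart with hp
  set q := ν.toJordanDecomposition.negPart with hq
  have h1 : p.toSignedMeasure - q.toSignedMeasure = α.toSignedMeasure - β.toSignedMeasure :=
    ν.toSignedMeasure_toJordanDecomposition
  have h2 : p + β = α + q := by
    rw [← Measure.toSignedMeasure_eq_toSignedMeasure_iff, Measure.toSignedMeasure_add,
      Measure.toSignedMeasure_add]
    rwa [sub_eq_sub_iff_add_eq_add] at h1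
  have h3 : K ∘ₘ p + K ∘ₘ β = K ∘ₘ α + K ∘ₘ q := by
    rw [← Measure.comp_add, h2, Measure.comp_add]
  have h4 : (K ∘ₘ p).toSignedMeasure + (K ∘ₘ β).toSignedMeasure
      = (K ∘ₘ α).toSignedMeasure + (K ∘ₘ q).toSignedMeasure := by
    rw [← Measure.toSignedMeasure_add, ← Measure.toSignedMeasure_add,
      Measure.toSignedMeasure_eq_toSignedMeasure_iff, h3]
  rw [markovMorphism, sub_eq_sub_iff_add_eq_add]
  exact h4

theorem lintegral_push_withDensity (K : Kernel Ω Ω') [IsMarkovKernel K] (μ : Measure Ω)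
    [IsFiniteMeasure μ] {f : Ω → ℝ≥0∞} (hf : Measurable f) {A : Set Ω'} (hA : MeasurableSet A) :
    (K ∘ₘ μ.withDensity f) A = ∫⁻ z in Prod.snd ⁻¹' A, f z.1 ∂(μ ⊗ₘ K) := by
  rw [Measure.bind_apply hA K.aemeasurable,
    lintegral_withDensity_eq_lintegral_mul μ hf (K.measurable_coe hA),
    ← Set.univ_prod, Measure.setLIntegral_compProd (f := fun z : Ω × Ω' => f z.1) (hf.comp measurable_fst)
      MeasurableSet.univ hA]
  simp

theorem integrable_fst_compProd (K : Kernel Ω Ω') [IsMarkovKernel K] (μ : FinMeas Ω)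
    {φ : Ω → ℝ} (hφ : Integrable φ μ.1) :
    Integrable (fun z : Ω × Ω' => φ z.1) (μ.1 ⊗ₘ K) := by
  have h : Integrable φ ((μ.1 ⊗ₘ K).map Prod.fst) := by
    rwa [← Measure.fst, Measure.fst_compProd]
  exact h.comp_measurable measurable_fst

theorem markovMorphism_withDensity_apply (K : Kernel Ω Ω') [IsMarkovKernel K] (μ : FinMeas Ω)
    {φ : Ω → ℝ} (hm : Measurable φ) (hφ : Integrable φ μ.1) {A : Set Ω'}
    (hA : MeasurableSet A) :
    markovMorphism K (μ.1.withDensityᵥ φ) A = ∫ z in Prod.snd ⁻¹' A, φ z.1 ∂(μ.1 ⊗ₘ K) := by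
  have := isFiniteMeasure_withDensity_ofReal hφ.hasFiniteIntegral
  have := isFiniteMeasure_withDensity_ofReal hφ.neg.hasFiniteIntegral
  have e := lintegral_push_withDensity K μ.1 hm.neg.ennreal_ofReal hA
  simp only [Pi.neg_apply] at e
  rw [withDensityᵥ_eq_withDensity_pos_part_sub_withDensity_neg_part hφ]
  refine (congrArg (fun s : SignedMeasure Ω' => s A) (markovMorphism_sub K _ _)).trans ?_
  rw [integral_eq_lintegral_pos_part_sub_lintegral_neg_part
      (integrable_fst_compProd K μ hφ).integrableOn,
    ← lintegral_push_withDensity K μ.1 hm.ennreal_ofReal hA,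
    ← e]
  simp [Measure.toSignedMeasure_apply, hA, Measure.real]

theorem markovMorphism_absolutelyContinuous (K : Kernel Ω Ω') [IsMarkovKernel K]
    (μ : FinMeas Ω) {φ : Ω → ℝ} (hm : Measurable φ) (hφ : Integrable φ μ.1) :
    markovMorphism K (μ.1.withDensityᵥ φ) ≪ᵥ (K ∘ₘ μ.1).toENNRealVectorMeasure := by
  refine VectorMeasure.AbsolutelyContinuous.mk fun A hA h0 => ?_
  rw [Measure.toENNRealVectorMeasure_apply_measurable hA, ← Measure.snd_compProd,
    Measure.snd_apply hA] at h0
  rw [markovMorphism_withDensity_apply K μ hm hφ hA, Measure.restrict_eq_zero.2 h0,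
    integral_zero_measure]

/-- The density `d{K_*(φ μ)}/d{K_* μ}`. -/
def pushDensity (K : Kernel Ω Ω') [IsMarkovKernel K] (μ : FinMeas Ω) (φ : Ω → ℝ) : Ω' → ℝ :=
  (markovMorphism K (μ.1.withDensityᵥ φ)).rnDeriv (μ.push K).1

theorem withDensity_pushDensity (K : Kernel Ω Ω') [IsMarkovKernel K] (μ : FinMeas Ω)
    {φ : Ω → ℝ} (hm : Measurable φ) (hφ : Integrable φ μ.1) :
    (μ.push K).1.withDensityᵥ (pushDensity K μ φ) = markovMorphism K (μ.1.withDensityᵥ φ) :=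
  SignedMeasure.withDensityᵥ_rnDeriv_eq _ (μ.push K).1
    (markovMorphism_absolutelyContinuous K μ hm hφ)

theorem integrable_pushDensity (K : Kernel Ω Ω') [IsMarkovKernel K] (μ : FinMeas Ω)
    (φ : Ω → ℝ) : Integrable (pushDensity K μ φ) (μ.push K).1 :=
  SignedMeasure.integrable_rnDeriv _ _

theorem setIntegral_pushDensity (K : Kernel Ω Ω') [IsMarkovKernel K] (μ : FinMeas Ω)
    {φ : Ω → ℝ} (hm : Measurable φ) (hφ : Integrable φ μ.1) {A : Set Ω'}
    (hA : MeasurableSet A) :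
    ∫ x in A, pushDensity K μ φ x ∂(μ.push K).1
      = ∫ z in Prod.snd ⁻¹' A, φ z.1 ∂(μ.1 ⊗ₘ K) := by
  rw [← markovMorphism_withDensity_apply K μ hm hφ hA, ← withDensity_pushDensity K μ hm hφ,
    withDensityᵥ_apply (integrable_pushDensity K μ φ) hA]

theorem map_snd_compProd (K : Kernel Ω Ω') [IsMarkovKernel K] (μ : FinMeas Ω) :
    (μ.1 ⊗ₘ K).map Prod.snd = (μ.push K).1 := by
  rw [← Measure.snd, Measure.snd_compProd]; rfl

theorem pushDensity_ae_eq_condExp (K : Kernel Ω Ω') [IsMarkovKernel K] (μ : FinMeas Ω)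
    {φ : Ω → ℝ} (hm : Measurable φ) (hφ : Integrable φ μ.1) :
    (fun z : Ω × Ω' => pushDensity K μ φ z.2)
      =ᵐ[μ.1 ⊗ₘ K] (μ.1 ⊗ₘ K)[fun z => φ z.1 | MeasurableSpace.comap Prod.snd inferInstance] := by
  have hmeas : Measurable (pushDensity K μ φ) := SignedMeasure.measurable_rnDeriv _ _
  refine ae_eq_condExp_of_forall_setIntegral_eq measurable_snd.comap_le
    (integrable_fst_compProd K μ hφ) (fun s _ _ => Integrable.integrableOn ?_) ?_ ?_
  · have h := integrable_pushDensity K μ φ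
    rw [← map_snd_compProd] at h
    exact h.comp_measurable measurable_snd
  · rintro _ ⟨A, hA, rfl⟩ _
    rw [← setIntegral_pushDensity K μ hm hφ hA, ← map_snd_compProd,
      setIntegral_map hA hmeas.aestronglyMeasurable measurable_snd.aemeasurable]
  · exact (hmeas.comp (comap_measurable Prod.snd)).aestronglyMeasurable

theorem memLp_pushDensity (r : Exponent) (K : Kernel Ω Ω') [IsMarkovKernel K] (μ : FinMeas Ω)
    (φ : Lp ℝ r.inv μ.1) : MemLp (pushDensity K μ φ) r.inv (μ.push K).1 := by
  have hm : Measurable φ := (Lp.stronglyMeasurable φ).measurable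
  have hmeas : Measurable (pushDensity K μ φ) := SignedMeasure.measurable_rnDeriv _ _
  have h1 : MemLp φ r.inv ((μ.1 ⊗ₘ K).map Prod.fst) := by
    rw [← Measure.fst, Measure.fst_compProd]
    exact Lp.memLp φ
  have h2 : MemLp (fun z : Ω × Ω' => φ z.1) r.inv (μ.1 ⊗ₘ K) :=
    h1.comp_of_map measurable_fst.aemeasurable
  have h3 := (h2.condExp (m := MeasurableSpace.comap Prod.snd inferInstance) r.one_le_inv).ae_eq
    (pushDensity_ae_eq_condExp K μ hm (integrable_of_Lp r μ φ)).symm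
  rw [← map_snd_compProd]
  exact (memLp_map_measure_iff hmeas.aestronglyMeasurable measurable_snd.aemeasurable).2 h3

theorem pushDensity_ae_unique (K : Kernel Ω Ω') [IsMarkovKernel K] (μ : FinMeas Ω)
    {φ : Ω → ℝ} (hm : Measurable φ) (hφ : Integrable φ μ.1) {g : Ω' → ℝ}
    (hg : Integrable g (μ.push K).1)
    (h : ∀ A, MeasurableSet A →
      ∫ x in A, g x ∂(μ.push K).1 = ∫ z in Prod.snd ⁻¹' A, φ z.1 ∂(μ.1 ⊗ₘ K)) :
    pushDensity K μ φ =ᵐ[(μ.push K).1] g := by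
  refine Integrable.ae_eq_of_forall_setIntegral_eq _ _ (integrable_pushDensity K μ φ) hg
    fun A hA _ => ?_
  rw [h A hA, setIntegral_pushDensity K μ hm hφ hA]

theorem ae_fst_compProd (K : Kernel Ω Ω') [IsMarkovKernel K] (μ : FinMeas Ω) {p : Ω → Prop}
    (h : ∀ᵐ x ∂μ.1, p x) : ∀ᵐ z ∂(μ.1 ⊗ₘ K), p z.1 := by
  have h' : ∀ᵐ x ∂((μ.1 ⊗ₘ K).map Prod.fst), p x := by
    rwa [← Measure.fst, Measure.fst_compProd]
  exact ae_of_ae_map measurable_fst.aemeasurable h'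

/-- The formal derivative `d_{μ^r} K_r : S^r(Ω; μ) → S^r(Ω'; μ')`, `μ' = K_* μ`, of
`K_r : μ^r ↦ (K_* μ)^r`. It maps `φ μ^r` to `(d{K_*(φ μ)}/dμ') μ'^r`. -/
def formalDeriv (r : Exponent) (K : Kernel Ω Ω') [IsMarkovKernel K] (μ : FinMeas Ω) :
    Lp ℝ r.inv μ.1 →ₗ[ℝ] Lp ℝ r.inv (μ.push K).1 where
  toFun φ := (memLp_pushDensity r K μ φ).toLp _
  map_add' φ ψ := by
    rw [← MemLp.toLp_add, MemLp.toLp_eq_toLp_iff]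
    refine pushDensity_ae_unique K μ (Lp.stronglyMeasurable _).measurable
      (integrable_of_Lp r μ _)
      ((integrable_pushDensity K μ _).add (integrable_pushDensity K μ _)) fun A hA => ?_
    have hφ := integrable_of_Lp r μ φ
    have hψ := integrable_of_Lp r μ ψ
    simp only [Pi.add_apply]
    rw [integral_add (integrable_pushDensity K μ _).integrableOn
        (integrable_pushDensity K μ _).integrableOn,
      setIntegral_pushDensity K μ (Lp.stronglyMeasurable _).measurable hφ hA,
      setIntegral_pushDensity K μ (Lp.stronglyMeasurable _).measurable hψ hA,
      ← integral_add (integrable_fst_compProd K μ hφ).integrableOn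
        (integrable_fst_compProd K μ hψ).integrableOn]
    refine integral_congr_ae (ae_restrict_of_ae ?_)
    filter_upwards [ae_fst_compProd K μ (Lp.coeFn_add φ ψ)] with z hz
    rw [hz, Pi.add_apply]
  map_smul' c φ := by
    rw [RingHom.id_apply, ← MemLp.toLp_const_smul, MemLp.toLp_eq_toLp_iff]
    refine pushDensity_ae_unique K μ (Lp.stronglyMeasurable _).measurable
      (integrable_of_Lp r μ _) ((integrable_pushDensity K μ _).smul c) fun A hA => ?_
    simp only [Pi.smul_apply]
    rw [integral_smul, setIntegral_pushDensity K μ (Lp.stronglyMeasurable _).measurable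
      (integrable_of_Lp r μ φ) hA, ← integral_smul]
    refine integral_congr_ae (ae_restrict_of_ae ?_)
    filter_upwards [ae_fst_compProd K μ (Lp.coeFn_smul c φ)] with z hz
    rw [hz, Pi.smul_apply]

theorem coeFn_formalDeriv (r : Exponent) (K : Kernel Ω Ω') [IsMarkovKernel K] (μ : FinMeas Ω)
    (φ : Lp ℝ r.inv μ.1) : formalDeriv r K μ φ =ᵐ[(μ.push K).1] pushDensity K μ φ :=
  MemLp.coeFn_toLp (memLp_pushDensity r K μ φ)

theorem integral_formalDeriv (r : Exponent) (K : Kernel Ω Ω') [IsMarkovKernel K]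
    (μ : FinMeas Ω) (φ : Lp ℝ r.inv μ.1) :
    ∫ x, formalDeriv r K μ φ x ∂(μ.push K).1 = ∫ x, φ x ∂μ.1 := by
  have h := setIntegral_pushDensity K μ (Lp.stronglyMeasurable φ).measurable
    (integrable_of_Lp r μ φ) MeasurableSet.univ
  rw [Set.preimage_univ, Measure.restrict_univ, Measure.restrict_univ] at h
  rw [integral_congr_ae (coeFn_formalDeriv r K μ φ), h]
  have h2 : ∫ x, φ x ∂((μ.1 ⊗ₘ K).map Prod.fst) = ∫ z, φ z.1 ∂(μ.1 ⊗ₘ K) :=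
    integral_map measurable_fst.aemeasurable (Lp.stronglyMeasurable φ).aestronglyMeasurable
  have h3 : ∫ x, φ x ∂((μ.1 ⊗ₘ K).map Prod.fst) = ∫ x, φ x ∂μ.1 :=
    congrArg (fun m : Measure Ω => ∫ x, φ x ∂m) (Measure.fst_compProd μ.1 K)
  rw [← h2, h3]

end Markov

/-! ### Tensor fields and congruent families -/

/-- The two settings treated in parallel: all finite measures, or probability measures. -/
inductive Setting : Type where
  /-- The setting of `M^r(Ω)`. -/
  | measures
  /-- The setting of `P^r(Ω)`. -/
  | probabilities

/-- The measures that are admitted in a setting. -/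
def Setting.Admits {Ω : Type u} [MeasurableSpace Ω] : Setting → FinMeas Ω → Prop
  | .measures, _ => True
  | .probabilities, μ => μ.1 Set.univ = 1

/-- The measures `μ` that parametrize the points `μ^r` of `M^r(Ω)` or `P^r(Ω)`. The topology, which
depends on `r`, is `powTopology`. -/
structure Point (s : Setting) (Ω : Type u) [MeasurableSpace Ω] : Type u where
  /-- The underlying finite measure. -/
  base : FinMeas Ω
  /-- It is a probability measure in the setting of probability measures. -/
  admits : s.Admits base

/-- The topology of `M^r(Ω)` resp. `P^r(Ω)` as a subset of the normed space `S^r(Ω)`. -/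
abbrev powTopology (s : Setting) (r : Exponent) (Ω : Type u) [MeasurableSpace Ω] :
    TopologicalSpace (Point s Ω) :=
  TopologicalSpace.induced (fun μ => rootPow r μ.base) inferInstance

/-- The tangent space at `μ^r`, with `φ μ^r` written as `φ`: all of `L^{1/r}(μ)` for `M^r(Ω)`, and
the `φ ∈ L^{1/r}(μ)` with `∫ φ dμ = 0` for `P^r(Ω)`. -/
def tangent {Ω : Type u} [MeasurableSpace Ω] (s : Setting) (r : Exponent) (μ : FinMeas Ω) :
    Submodule ℝ (Lp ℝ r.inv μ.1) :=
  match s with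
  | .measures => ⊤
  | .probabilities =>
    { carrier := {φ | ∫ x, φ x ∂μ.1 = 0}
      zero_mem' := by
        rw [Set.mem_ofPred_eq, integral_congr_ae (Lp.coeFn_zero ℝ r.inv μ.1)]
        simp
      add_mem' := by
        intro φ ψ hφ hψ
        rw [Set.mem_ofPred_eq] at hφ hψ ⊢
        rw [integral_congr_ae (Lp.coeFn_add φ ψ), integral_add' (integrable_of_Lp r μ φ)
          (integrable_of_Lp r μ ψ), hφ, hψ, add_zero]
      smul_mem' := by
        intro c φ hφ
        rw [Set.mem_ofPred_eq] at hφ ⊢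
        rw [integral_congr_ae (Lp.coeFn_smul c φ)]
        simp only [Pi.smul_apply]
        rw [integral_smul, hφ, smul_zero] }

/-- A continuous vector field on `M^r(Ω)` resp. `P^r(Ω)`: a continuous map `X` to `S^r(Ω)` whose
value at `μ^r` is tangent at `μ^r`. -/
structure VectorField (s : Setting) (r : Exponent) (Ω : Type u) [MeasurableSpace Ω] where
  /-- The value at `μ^r`. -/
  val : ∀ μ : Point s Ω, tangent s r μ.base
  /-- Continuity as a map to `S^r(Ω)`. -/
  continuous_val : Continuous[powTopology s r Ω, inferInstance]
    fun μ => densityPow r μ.base (val μ : Lp ℝ r.inv μ.base.1)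

/-- A covariant `n`-tensor field on `M^r(Ω)` resp. `P^r(Ω)`: an `n`-multilinear form on each tangent
space, such that evaluation on continuous vector fields gives continuous functions. -/
structure TensorField (s : Setting) (r : Exponent) (n : ℕ) (Ω : Type u) [MeasurableSpace Ω] where
  /-- The multilinear form at `μ^r`. -/
  form : ∀ μ : Point s Ω, MultilinearMap ℝ (fun _ : Fin n => tangent s r μ.base) ℝ
  /-- Continuity on continuous vector fields. -/
  continuous_form : ∀ X : Fin n → VectorField s r Ω,
    Continuous[powTopology s r Ω, inferInstance] fun μ => form μ fun i => (X i).val μ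

/-- A family of covariant `n`-tensor fields, one for every measurable space. -/
abbrev TensorFamily (s : Setting) (r : Exponent) (n : ℕ) : Type (u + 1) :=
  (Ω : Type u) → [MeasurableSpace Ω] → TensorField s r n Ω

section Pullback

variable {Ω Ω' : Type u} [MeasurableSpace Ω] [MeasurableSpace Ω']

/-- The map `K_r : μ^r ↦ (K_* μ)^r` on points. -/
abbrev Point.push {s : Setting} (K : Kernel Ω Ω') [IsMarkovKernel K] (μ : Point s Ω) :
    Point s Ω' where
  base := μ.base.push K
  admits := by
    cases s with
    | measures => trivial
    | probabilities =>
      exact (Measure.comp_apply_univ (μ := μ.base.1) (κ := K)).trans μ.admits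

/-- The formal derivative of `K_r` between tangent spaces. -/
def tangentMap (s : Setting) (r : Exponent) (K : Kernel Ω Ω') [IsMarkovKernel K]
    (μ : Point s Ω) : tangent s r μ.base →ₗ[ℝ] tangent s r (μ.push K).base :=
  (formalDeriv r K μ.base).restrict fun φ hφ => by
    cases s with
    | measures => exact Submodule.mem_top
    | probabilities =>
      exact (integral_formalDeriv r K μ.base φ).trans hφ

/-- The pull-back `K_r^* Ψ` of the field of multilinear forms `Ψ` under a Markov kernel. -/
def pullback {s : Setting} {r : Exponent} {n : ℕ} (K : Kernel Ω Ω') [IsMarkovKernel K]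
    (Ψ : TensorField s r n Ω') (μ : Point s Ω) :
    MultilinearMap ℝ (fun _ : Fin n => tangent s r μ.base) ℝ :=
  (Ψ.form (μ.push K)).compLinearMap fun _ => tangentMap s r K μ

end Pullback

/-- A congruent family: invariance under all congruent Markov kernels. -/
def IsCongruentFamily {s : Setting} {r : Exponent} {n : ℕ} (Θ : TensorFamily.{u} s r n) : Prop :=
  ∀ (Ω Ω' : Type u) [MeasurableSpace Ω] [MeasurableSpace Ω'] (K : Kernel Ω Ω')
    [IsMarkovKernel K], IsCongruentKernel K →
    ∀ μ : Point s Ω, pullback K (Θ Ω') μ = (Θ Ω).form μ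

/-- Invariance under the congruent Markov kernels `K : I → P(Ω)` with `I` a finite set, which
carries the σ-algebra of all subsets. -/
def IsFinitelyCongruentFamily {s : Setting} {r : Exponent} {n : ℕ}
    (Θ : TensorFamily.{u} s r n) : Prop :=
  ∀ (I Ω : Type u) [Finite I] [MeasurableSpace I] [DiscreteMeasurableSpace I]
    [MeasurableSpace Ω] (K : Kernel I Ω) [IsMarkovKernel K], IsCongruentKernel K →
    ∀ μ : Point s I, pullback K (Θ Ω) μ = (Θ I).form μ

/-! ### Canonical tensors -/

section Canonical

variable {Ω : Type u} [MeasurableSpace Ω]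

/-- The canonical tensor `τ^m_{Ω;r}` at `μ^r`, with its `m` arguments `φ_i μ^r` indexed by a finite
set `ι` of `m ≤ 1/r` elements. Since the product of the `φ_i μ^r` and of `(μ^r)^{1/r - m}` is the
signed measure `(∏ φ_i) μ`, its value is `r^{-m} ∫ ∏ φ_i dμ`. -/
def canonicalTensor (r : Exponent) (μ : FinMeas Ω) {ι : Type} [Fintype ι]
    (φ : ι → Lp ℝ r.inv μ.1) : ℝ :=
  1 / (r : ℝ) ^ Fintype.card ι * ∫ x, ∏ i, φ i x ∂μ.1

/-- The tensor `τ^P_{Ω;r}` of a partition `P` of the set of arguments: the product over the blocks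
of `P` of canonical tensors applied to the arguments in the block. -/
def partitionTensor (r : Exponent) (μ : FinMeas Ω) {n : ℕ}
    (P : Finpartition (Finset.univ : Finset (Fin n))) (φ : Fin n → Lp ℝ r.inv μ.1) : ℝ :=
  ∏ B ∈ P.parts, canonicalTensor r μ fun j : B => φ j

/-- Partitions of an `n`-element set all of whose blocks have at least `b` and at most `1/r`
elements. -/
abbrev BlockPartition (r : Exponent) (n b : ℕ) : Type :=
  {P : Finpartition (Finset.univ : Finset (Fin n)) //
    ∀ B ∈ P.parts, b ≤ B.card ∧ (B.card : ℝ) ≤ 1 / (r : ℝ)}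

instance (r : Exponent) (n b : ℕ) : Fintype (BlockPartition r n b) := Fintype.ofFinite _

/-- The value at a mass `m` of a coefficient function on `(0, ∞)`. (The measure of mass `0` has the
zero tangent space, so that the value given to `m = 0` plays no role.) -/
def coeffAt (a : C(Set.Ioi (0 : ℝ), ℝ)) (m : ℝ) : ℝ :=
  if h : 0 < m then a ⟨m, h⟩ else 0

/-- The tensor `∑_P a_P(‖μ‖) τ^P_{Ω;r}` at `μ^r`, over partitions with blocks of size `≤ 1/r`. -/
def generatedOnMeasures {r : Exponent} {n : ℕ}
    (a : BlockPartition r n 1 → C(Set.Ioi (0 : ℝ), ℝ)) (μ : FinMeas Ω)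
    (φ : Fin n → Lp ℝ r.inv μ.1) : ℝ :=
  ∑ P, coeffAt (a P) μ.mass * partitionTensor r μ P.1 φ

/-- The tensor `∑_P c_P τ^P_{Ω;r}` at `μ^r`, over partitions with blocks of size between `2` and
`1/r`. -/
def generatedOnProbabilities {r : Exponent} {n : ℕ} (c : BlockPartition r n 2 → ℝ)
    (μ : FinMeas Ω) (φ : Fin n → Lp ℝ r.inv μ.1) : ℝ :=
  ∑ P, c P * partitionTensor r μ P.1 φ

/-- The family has the form `∑_P a_P(‖μ‖) τ^P_{Ω;r}` on all spaces `M^r(Ω)`. -/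
def HasMeasureForm {r : Exponent} {n : ℕ} (Θ : TensorFamily.{u} .measures r n)
    (a : BlockPartition r n 1 → C(Set.Ioi (0 : ℝ), ℝ)) : Prop :=
  ∀ (Ω : Type u) [MeasurableSpace Ω] (μ : Point .measures Ω)
    (φ : Fin n → tangent .measures r μ.base),
    (Θ Ω).form μ φ = generatedOnMeasures a μ.base fun i => (φ i : Lp ℝ r.inv μ.base.1)

/-- The family has the form `∑_P c_P τ^P_{Ω;r}` on all spaces `P^r(Ω)`. -/
def HasProbabilityForm {r : Exponent} {n : ℕ} (Θ : TensorFamily.{u} .probabilities r n)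
    (c : BlockPartition r n 2 → ℝ) : Prop :=
  ∀ (Ω : Type u) [MeasurableSpace Ω] (μ : Point .probabilities Ω)
    (φ : Fin n → tangent .probabilities r μ.base),
    (Θ Ω).form μ φ = generatedOnProbabilities c μ.base fun i => (φ i : Lp ℝ r.inv μ.base.1)

end Canonical

/-! ### Parametrized measure models -/

section Models

variable {Ω : Type u} [MeasurableSpace Ω]
  {E : Type w} [NormedAddCommGroup E] [NormedSpace ℝ E]
  {M : Type v} [TopologicalSpace M] [ChartedSpace E M]

/-- The exponent `1`. -/
def Exponent.one : Exponent := ⟨1, one_pos, le_rfl⟩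

/-- The map `p : M → M(Ω)` (or `p : M → P(Ω)`) is a parametrized measure model (a statistical model)
that is `k`-integrable for `k = 1/r`: both `p`, as a map to the space `S(Ω) = S^1(Ω)` of finite
signed measures, and `p^{1/k}`, as a map to `S^{1/k}(Ω)`, are continuously Fréchet
differentiable. -/
def IsIntegrableModel {s : Setting} (r : Exponent) (p : M → Point s Ω) : Prop :=
  ContMDiff 𝓘(ℝ, E) 𝓘(ℝ, RootMeas Exponent.one Ω) 1
      (fun ξ => rootPow Exponent.one (p ξ).base) ∧
    ContMDiff 𝓘(ℝ, E) 𝓘(ℝ, RootMeas r Ω) 1 (fun ξ => rootPow r (p ξ).base)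

/-- `D` is the differential `d_ξ p^r : T_ξ M → T_{p(ξ)^r}` of `p^r` at `ξ`, as a map to the tangent
space at `p(ξ)^r`. (It is unique, since `φ ↦ φ μ^r` is injective.) -/
def IsRootDifferential {s : Setting} (r : Exponent) (p : M → Point s Ω) (ξ : M)
    (D : TangentSpace 𝓘(ℝ, E) ξ →ₗ[ℝ] tangent s r (p ξ).base) : Prop :=
  ∀ v : TangentSpace 𝓘(ℝ, E) ξ, densityPow r (p ξ).base (D v : Lp ℝ r.inv (p ξ).base.1)
    = mfderiv 𝓘(ℝ, E) 𝓘(ℝ, RootMeas r Ω) (fun ζ => rootPow r (p ζ).base) ξ v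

/-- The pull-back `(p^r)^* Ψ` at `ξ` of a tensor field `Ψ`, where `D` is the differential of `p^r`
at `ξ`. -/
def modelPullback {s : Setting} {r : Exponent} {n : ℕ} (Ψ : TensorField s r n Ω)
    (p : M → Point s Ω) (ξ : M)
    (D : TangentSpace 𝓘(ℝ, E) ξ →ₗ[ℝ] tangent s r (p ξ).base) :
    MultilinearMap ℝ (fun _ : Fin n => TangentSpace 𝓘(ℝ, E) ξ) ℝ :=
  (Ψ.form (p ξ)).compLinearMap fun _ => D

/-- The canonical tensor `τ^m_{(M,Ω,p)} = (p^r)^* τ^m_{Ω;r}` of the model at `ξ`, with its `m`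
arguments indexed by a finite set `ι`. -/
def modelCanonicalTensor {s : Setting} {r : Exponent} (p : M → Point s Ω) (ξ : M)
    (D : TangentSpace 𝓘(ℝ, E) ξ →ₗ[ℝ] tangent s r (p ξ).base) {ι : Type} [Fintype ι]
    (V : ι → TangentSpace 𝓘(ℝ, E) ξ) : ℝ :=
  canonicalTensor r (p ξ).base fun i => (D (V i) : Lp ℝ r.inv (p ξ).base.1)

/-- The tensor `τ^P_{(M,Ω,p)}` of the model for a partition `P` of the set of arguments. -/
def modelPartitionTensor {s : Setting} {r : Exponent} (p : M → Point s Ω) (ξ : M)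
    (D : TangentSpace 𝓘(ℝ, E) ξ →ₗ[ℝ] tangent s r (p ξ).base) {n : ℕ}
    (P : Finpartition (Finset.univ : Finset (Fin n)))
    (V : Fin n → TangentSpace 𝓘(ℝ, E) ξ) : ℝ :=
  ∏ B ∈ P.parts, modelCanonicalTensor p ξ D fun j : B => V j

end Models

end CongruentTensors

end

open CongruentTensors

/-!
Let `ν` be the uniform measure of mass `m` on a finite set `I`. Congruence under permutations makes
`Θ_I` at `ν^r` a symmetric multilinear form on `ℝ^I`, hence a combination of the products of block
sums `∏_{B ∈ P} ∑_{x ∈ I} ∏_{i ∈ B} f_i x`, that is, of the `τ^P`. Refining `I` shows that the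
coefficients depend on `m` only; a measure with rational weights is the image of a uniform one
under a finite-to-one map, weak continuity along fixed supports gives all weights, and simple
functions on an arbitrary `Ω` factor through finite sets. On measures with a point of mass `ε → 0`,
the function `ε^{-r} 1_x` has bounded norm in `L^{1/r}` while its moments of order larger than `1/r`
blow up, so that the blocks of such size cannot occur.

To pass from simple functions to all of `L^{1/r}`, continuity of `Θ` is tested on vector fields that
are simple at the points of a sequence of measures `g_k μ ≠ μ` converging to `μ`. The differential
of a model is tangent because `p^r` is nonnegative, and minimal on the null sets of `p(ξ)`.
-/

noncomputable section

namespace CongruentTensors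

/-! ### Congruent kernels -/

section Retraction

variable {Ω Ω' : Type*} [MeasurableSpace Ω] [MeasurableSpace Ω'] {K : Kernel Ω Ω'} {κ : Ω' → Ω}

/-- A statistic `κ` that recovers `ω` from a sample of `K ω`. A kernel is congruent when it has such
a retraction. -/
def IsRetraction (κ : Ω' → Ω) (K : Kernel Ω Ω') : Prop :=
  Measurable κ ∧ ∀ ω, (K ω).map κ = Measure.dirac ω

theorem IsRetraction.map_comp (hκ : IsRetraction κ K) (μ : Measure Ω) :
    (K ∘ₘ μ).map κ = μ := by
  have hid : K.map κ = Kernel.id := by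
    ext ω : 1
    rw [Kernel.map_apply _ hκ.1, hκ.2, Kernel.id_apply]
  rw [Measure.map_comp μ K hκ.1, hid, Measure.id_comp]

end Retraction

section PushDensity

variable {Ω Ω' : Type u} [MeasurableSpace Ω] [MeasurableSpace Ω'] {K : Kernel Ω Ω'} {κ : Ω' → Ω}
  [IsMarkovKernel K]

theorem IsRetraction.measurePreserving (hκ : IsRetraction κ K) (μ : FinMeas Ω) :
    MeasurePreserving κ (μ.push K).1 μ.1 :=
  ⟨hκ.1, hκ.map_comp μ.1⟩

theorem IsRetraction.integral_comp (hκ : IsRetraction κ K) (μ : FinMeas Ω) {f : Ω → ℝ}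
    (hf : AEStronglyMeasurable f μ.1) : ∫ x, f (κ x) ∂(μ.push K).1 = ∫ x, f x ∂μ.1 := by
  rw [← (hκ.measurePreserving μ).map_eq] at hf ⊢
  exact (integral_map hκ.1.aemeasurable hf).symm

/-- Under `μ ⊗ K` the second coordinate `y` determines the first as `κ y`, so conditioning `φ` on
`y` gives `φ (κ y)`. -/
theorem IsRetraction.pushDensity_ae_eq (hκ : IsRetraction κ K) (μ : FinMeas Ω) {φ : Ω → ℝ}
    (hm : Measurable φ) (hφ : Integrable φ μ.1) :
    pushDensity K μ φ =ᵐ[(μ.push K).1] φ ∘ κ := by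
  have hfst : ∀ᵐ z ∂(μ.1 ⊗ₘ K), φ (κ z.2) = φ z.1 := by
    refine (Measure.ae_compProd_iff (measurableSet_eq_fun ((hm.comp hκ.1).comp measurable_snd)
      (hm.comp measurable_fst))).2 (ae_of_all _ fun ω => ?_)
    have hω : ∀ᵐ x ∂((K ω).map κ), φ x = φ ω := by
      rw [hκ.2, ae_dirac_iff (measurableSet_eq_fun hm measurable_const)]
    exact ae_of_ae_map hκ.1.aemeasurable hω
  refine pushDensity_ae_unique K μ hm hφ
    ((hκ.measurePreserving μ).integrable_comp_of_integrable hφ) fun A hA => ?_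
  rw [← map_snd_compProd, setIntegral_map hA (hm.comp hκ.1).aestronglyMeasurable
    measurable_snd.aemeasurable]
  exact integral_congr_ae (ae_restrict_of_ae hfst)

theorem IsRetraction.formalDeriv_ae_eq (r : Exponent) (hκ : IsRetraction κ K) (μ : FinMeas Ω)
    (φ : Lp ℝ r.inv μ.1) : formalDeriv r K μ φ =ᵐ[(μ.push K).1] φ ∘ κ :=
  (coeFn_formalDeriv r K μ φ).trans
    (hκ.pushDensity_ae_eq μ (Lp.stronglyMeasurable φ).measurable (integrable_of_Lp r μ φ))

end PushDensity

theorem mass_push {Ω Ω' : Type u} [MeasurableSpace Ω] [MeasurableSpace Ω'] (K : Kernel Ω Ω')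
    [IsMarkovKernel K] (μ : FinMeas Ω) : (μ.push K).mass = μ.mass :=
  congrArg ENNReal.toReal (Measure.comp_apply_univ (μ := μ.1) (κ := K))

section FiberKernel

variable {Ω I : Type*} [MeasurableSpace Ω]

open Classical in
/-- The conditional distribution of `ν` given the value of a statistic `κ`; on the fibres of
measure `0`, where conditioning is meaningless, it is the Dirac measure at a point of the fibre. -/
def fiberMeasure {κ : Ω → I} (hs : κ.Surjective) (ν : Measure Ω) (i : I) : Measure Ω :=
  if ν (κ ⁻¹' {i}) = 0 then Measure.dirac (Function.surjInv hs i) else ν[|κ ⁻¹' {i}]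

variable {κ : Ω → I} (hs : κ.Surjective) (ν : Measure Ω)

theorem measure_smul_fiberMeasure (i : I) :
    ν (κ ⁻¹' {i}) • fiberMeasure hs ν i = ν (κ ⁻¹' {i}) • ν[|κ ⁻¹' {i}] := by
  by_cases h0 : ν (κ ⁻¹' {i}) = 0
  · rw [h0, zero_smul, zero_smul]
  · rw [fiberMeasure, if_neg h0]

variable [IsFiniteMeasure ν]

instance isProbabilityMeasure_fiberMeasure (i : I) :
    IsProbabilityMeasure (fiberMeasure hs ν i) := by
  unfold fiberMeasure
  split_ifs with h0
  · infer_instance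
  · exact cond_isProbabilityMeasure h0

variable [MeasurableSpace I]

theorem map_fiberMeasure [MeasurableSingletonClass I] (hκ : Measurable κ) (i : I) :
    (fiberMeasure hs ν i).map κ = Measure.dirac i := by
  have hconst : κ =ᵐ[fiberMeasure hs ν i] fun _ => i := by
    have hfib : MeasurableSet (κ ⁻¹' {i}) := hκ (measurableSet_singleton i)
    unfold fiberMeasure
    split_ifs with h0
    · exact (ae_dirac_iff hfib).2 (Function.surjInv_eq hs i)
    · exact ae_cond_mem hfib
  rw [Measure.map_congr hconst, Measure.map_const, measure_univ, one_smul]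

theorem exists_isRetraction_comp_map_eq [Finite I] [DiscreteMeasurableSpace I]
    (hκ : Measurable κ) (hs : κ.Surjective) :
    ∃ K : Kernel I Ω, IsMarkovKernel K ∧ IsRetraction κ K ∧ K ∘ₘ (ν.map κ) = ν := by
  cases nonempty_fintype I
  refine ⟨⟨fiberMeasure hs ν, .of_discrete⟩, ⟨isProbabilityMeasure_fiberMeasure hs ν⟩,
    ⟨hκ, map_fiberMeasure hs ν hκ⟩, ?_⟩
  conv_rhs => rw [← sum_meas_smul_cond_fiber hκ ν]
  ext A hA
  rw [Measure.bind_apply hA (Kernel.aemeasurable _), lintegral_fintype, Measure.finsetSum_apply]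
  refine Finset.sum_congr rfl fun i _ => ?_
  rw [← measure_smul_fiberMeasure hs, Measure.map_apply hκ (measurableSet_singleton i), mul_comm]
  rfl

end FiberKernel

/-! ### Multilinear forms invariant under permutations of the coordinates -/

section LowerSums

variable {α A : Type*} [PartialOrder α] [Fintype α] [DecidableLE α] [AddCommGroup A]

theorem eq_zero_of_sum_le_eq_zero (d : α → A)
    (h : ∀ Q, d Q ≠ 0 → ∑ R with R ≤ Q, d R = 0) : d = 0 := by
  funext Q
  induction Q using WellFoundedLT.induction with
  | ind Q ih =>
    by_contra hQ
    refine hQ ((Finset.sum_eq_single_of_mem Q (by simp) fun R hR hne => ?_).symm.trans (h Q hQ))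
    exact ih R (lt_of_le_of_ne (Finset.mem_filter.1 hR).2 hne)

theorem sum_le_eq_add_sum_lt [DecidableLT α] (c : α → A) (Q : α) :
    ∑ R with R ≤ Q, c R = c Q + ∑ R with R < Q, c R := by
  classical
  have hsplit : ({R | R ≤ Q} : Finset α) = insert Q ({R | R < Q} : Finset α) := by
    ext R
    simp [le_iff_eq_or_lt]
  rw [hsplit, Finset.sum_insert (by simp)]

theorem exists_forall_sum_le_eq (β : α → A) : ∃ c : α → A, ∀ Q, ∑ R with R ≤ Q, c R = β Q := by
  classical
  let c : α → A := WellFoundedLT.fix fun Q ih => β Q - ∑ R : {R // R < Q}, ih R R.2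
  have hc : ∀ Q, c Q = β Q - ∑ R with R < Q, c R := fun Q => by
    rw [Finset.sum_subtype _ (fun _ => Finset.mem_filter_univ _)]
    exact WellFoundedLT.fix_eq _ Q
  exact ⟨c, fun Q => by rw [sum_le_eq_add_sum_lt, hc Q, sub_add_cancel]⟩

theorem continuous_of_forall_continuous_sum_le [TopologicalSpace A] [IsTopologicalAddGroup A]
    {X : Type*} [TopologicalSpace X] {d : α → X → A}
    (h : ∀ Q, Continuous fun x => ∑ R with R ≤ Q, d R x) (Q : α) : Continuous (d Q) := by
  classical
  induction Q using WellFoundedLT.induction with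
  | ind Q ih =>
    refine ((h Q).sub (continuous_finsetSum {R | R < Q} fun R hR =>
      ih R (Finset.mem_filter.1 hR).2)).congr fun x => ?_
    rw [Pi.sub_apply, sum_le_eq_add_sum_lt (fun R => d R x), add_sub_cancel_right]

end LowerSums

section KernelPartition

variable {ι I : Type*}

theorem exists_perm_comp_eq_of_ker_eq [Finite I] {j j' : ι → I}
    (h : Setoid.ker j = Setoid.ker j') : ∃ σ : Equiv.Perm I, σ ∘ j = j' := by
  classical
  cases nonempty_fintype I
  let e : range j ≃ range j' := (Setoid.quotientKerEquivRange j).symm.trans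
    ((Quotient.congrRight fun x y => by rw [h]).trans (Setoid.quotientKerEquivRange j'))
  have he : ∀ x, e ⟨j x, mem_range_self x⟩ = ⟨j' x, mem_range_self x⟩ := fun x => by
    have hx : (Setoid.quotientKerEquivRange j).symm ⟨j x, mem_range_self x⟩ =
        Quotient.mk (Setoid.ker j) x := (Equiv.symm_apply_eq _).2 rfl
    simp only [e, Equiv.trans_apply, hx]
    rfl
  refine ⟨e.extendSubtype, funext fun x => ?_⟩
  rw [Function.comp_apply, e.extendSubtype_apply_of_mem _ (mem_range_self x)]
  exact congrArg Subtype.val (he x)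

variable [Fintype ι] [DecidableEq ι]

/-- Partitions of a finite set of arguments. -/
abbrev ArgPartition (ι : Type*) [Fintype ι] [DecidableEq ι] : Type _ :=
  Finpartition (Finset.univ : Finset ι)

open Classical in
/-- The partition of the domain of `j` into the fibres of `j`. It records which basis vectors
coincide in the tuple `(e_{j x})_x`. -/
def kerPartition (j : ι → I) : ArgPartition ι :=
  Finpartition.ofSetoid (Setoid.ker j)

theorem mem_part_kerPartition {j : ι → I} {x y : ι} :
    y ∈ (kerPartition j).part x ↔ j x = j y := by
  classical
  exact Finpartition.mem_part_ofSetoid_iff_rel.trans Setoid.ker_def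

theorem le_kerPartition_iff {R : ArgPartition ι} {j : ι → I} :
    R ≤ kerPartition j ↔ ∀ B ∈ R.parts, ∀ x ∈ B, ∀ y ∈ B, j x = j y := by
  refine ⟨fun h B hB x hx y hy => ?_, fun h B hB => ?_⟩
  · obtain ⟨C, hC, hBC⟩ := h hB
    rw [← mem_part_kerPartition, (kerPartition j).part_eq_of_mem hC (hBC hx)]
    exact hBC hy
  · obtain ⟨x, hx⟩ := R.nonempty_of_mem_parts hB
    exact ⟨_, (kerPartition j).part_mem.2 (Finset.mem_univ x), fun y hy =>
      mem_part_kerPartition.2 (h B hB x hx y hy)⟩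

theorem kerPartition_eq_iff {Q : ArgPartition ι} {j : ι → I} :
    kerPartition j = Q ↔ ∀ x y, j x = j y ↔ Q.part x = Q.part y := by
  have hQ : ∀ x y, y ∈ Q.part x ↔ Q.part x = Q.part y := fun x y => by
    rw [Q.mem_part_iff_part_eq_part (Finset.mem_univ y) (Finset.mem_univ x), eq_comm]
  refine ⟨?_, fun h => le_antisymm (fun B hB => ?_)
    (le_kerPartition_iff.2 fun B hB x hx y hy => ?_)⟩
  · rintro rfl x y
    rw [← mem_part_kerPartition, hQ]
  · obtain ⟨x, hx⟩ := (kerPartition j).nonempty_of_mem_parts hB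
    refine ⟨_, Q.part_mem.2 (Finset.mem_univ x), fun y hy => ?_⟩
    rw [← (kerPartition j).part_eq_of_mem hB hx, mem_part_kerPartition, h, ← hQ] at hy
    exact hy
  · rw [h, Q.part_eq_of_mem hB hx, Q.part_eq_of_mem hB hy]

theorem exists_perm_comp_eq_of_kerPartition_eq [Finite I] {j j' : ι → I}
    (h : kerPartition j = kerPartition j') : ∃ σ : Equiv.Perm I, σ ∘ j = j' := by
  refine exists_perm_comp_eq_of_ker_eq (Setoid.ext fun x y => ?_)
  rw [Setoid.ker_def, Setoid.ker_def, ← mem_part_kerPartition, h, mem_part_kerPartition]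

theorem exists_kerPartition_eq [Fintype I] (Q : ArgPartition ι)
    (hQ : Q.parts.card ≤ Fintype.card I) : ∃ j : ι → I, kerPartition j = Q := by
  rw [← Fintype.card_coe] at hQ
  obtain ⟨e⟩ := Function.Embedding.nonempty_of_card_le hQ
  exact ⟨fun x => e ⟨Q.part x, Q.part_mem.2 (Finset.mem_univ x)⟩, kerPartition_eq_iff.2
    fun x y => e.injective.eq_iff.trans Subtype.mk_eq_mk⟩

theorem exists_kerPartition_eq_and_apply_eq_iff_mem [Fintype I] {Q : ArgPartition ι}
    (hQ : Q.parts.card ≤ Fintype.card I) {p : Finset ι} (hp : p ∈ Q.parts) (x₀ : I) :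
    ∃ j : ι → I, kerPartition j = Q ∧ ∀ i, j i = x₀ ↔ i ∈ p := by
  classical
  obtain ⟨j, rfl⟩ := exists_kerPartition_eq Q hQ
  obtain ⟨i₀, hi₀⟩ := (kerPartition j).nonempty_of_mem_parts hp
  let σ := Equiv.swap (j i₀) x₀
  refine ⟨σ ∘ j, kerPartition_eq_iff.2 fun x y => ?_, fun i => ?_⟩
  · exact σ.injective.eq_iff.trans (kerPartition_eq_iff.1 rfl x y)
  · have hσ : (σ ∘ j) i = x₀ ↔ j i₀ = j i := by
      rw [Function.comp_apply, ← σ.eq_symm_apply, Equiv.symm_swap, Equiv.swap_apply_right, eq_comm]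
    rw [hσ, ← mem_part_kerPartition, (kerPartition j).part_eq_of_mem hp hi₀]

theorem part_subset_of_le {Q R : ArgPartition ι} (hRQ : R ≤ Q) {p : Finset ι} (hp : p ∈ Q.parts)
    {i : ι} (hi : i ∈ p) : R.part i ⊆ p := by
  obtain ⟨C, hC, hRC⟩ := hRQ (R.part_mem.2 (Finset.mem_univ i))
  exact Q.eq_of_mem_parts hC hp (hRC (R.mem_part_self.2 (Finset.mem_univ i))) hi ▸ hRC

open Finset in
theorem card_filter_subset_pos {Q R : ArgPartition ι} (hRQ : R ≤ Q) {p : Finset ι}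
    (hp : p ∈ Q.parts) : 0 < #{B ∈ R.parts | B ⊆ p} := by
  obtain ⟨i, hi⟩ := Q.nonempty_of_mem_parts hp
  exact card_pos.2 ⟨R.part i,
    mem_filter.2 ⟨R.part_mem.2 (mem_univ i), part_subset_of_le hRQ hp hi⟩⟩

open Finset in
theorem card_filter_subset_eq_one_iff {Q R : ArgPartition ι} (hRQ : R ≤ Q) {p : Finset ι}
    (hp : p ∈ Q.parts) : #{B ∈ R.parts | B ⊆ p} = 1 ↔ p ∈ R.parts := by
  refine ⟨fun h => ?_, fun h => card_eq_one.2 ⟨p, ?_⟩⟩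
  · obtain ⟨B, hB⟩ := card_eq_one.1 h
    have hBp := mem_filter.1 (hB ▸ mem_singleton_self B)
    suffices p ⊆ B from this.antisymm hBp.2 ▸ hBp.1
    intro i hi
    have hmem : R.part i ∈ ({B} : Finset (Finset ι)) :=
      hB ▸ mem_filter.2 ⟨R.part_mem.2 (mem_univ i), part_subset_of_le hRQ hp hi⟩
    exact mem_singleton.1 hmem ▸ R.mem_part_self.2 (mem_univ i)
  · refine Finset.eq_singleton_iff_unique_mem.2 ⟨mem_filter.2 ⟨h, subset_rfl⟩, fun B hB => ?_⟩
    obtain ⟨hB, hBp⟩ := mem_filter.1 hB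
    obtain ⟨i, hi⟩ := R.nonempty_of_mem_parts hB
    exact R.eq_of_mem_parts hB h hi (hBp hi)

end KernelPartition

section BlockSum

variable {ι I 𝕜 : Type*}

theorem sum_mul_prod_single [CommSemiring 𝕜] [Fintype I] [DecidableEq I] {B : Finset ι} {i : ι}
    (hi : i ∈ B) (j : ι → I) (g : I → 𝕜) [Decidable (∀ k ∈ B, ∀ l ∈ B, j k = j l)] :
    ∑ x, g x * ∏ k ∈ B, (Pi.single (j k) (1 : 𝕜) : I → 𝕜) x =
      if ∀ k ∈ B, ∀ l ∈ B, j k = j l then g (j i) else 0 := by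
  classical
  split_ifs with h
  · rw [Finset.sum_eq_single_of_mem (j i) (Finset.mem_univ _) fun x _ hx => by
        rw [Finset.prod_eq_zero hi (Pi.single_eq_of_ne hx _), mul_zero],
      Finset.prod_eq_one fun k hk => by rw [h i hi k hk, Pi.single_eq_same], mul_one]
  · push Not at h
    obtain ⟨k, hk, l, hl, hkl⟩ := h
    refine Finset.sum_eq_zero fun x _ => ?_
    by_cases hx : x = j k
    · rw [Finset.prod_eq_zero hl (Pi.single_eq_of_ne (hx.trans_ne hkl) _), mul_zero]
    · rw [Finset.prod_eq_zero hk (Pi.single_eq_of_ne hx _), mul_zero]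

variable [Fintype ι] [hι : DecidableEq ι]

theorem prod_sum_prod_update [CommSemiring 𝕜] [Fintype I] (R : ArgPartition ι) (f : ι → I → 𝕜)
    (i : ι) (a : I → 𝕜) :
    ∏ B ∈ R.parts, ∑ x, ∏ k ∈ B, Function.update f i a k x =
      (∑ x, a x * ∏ k ∈ (R.part i).erase i, f k x) *
        ∏ B ∈ R.parts.erase (R.part i), ∑ x, ∏ k ∈ B, f k x := by
  rw [← Finset.mul_prod_erase R.parts _ (R.part_mem.2 (Finset.mem_univ i))]
  congr 1
  · refine Finset.sum_congr rfl fun x _ => ?_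
    rw [← Finset.mul_prod_erase _ _ (R.mem_part_self.2 (Finset.mem_univ i)), Function.update_self]
    exact congrArg _ (Finset.prod_congr rfl fun k hk => by
      rw [Function.update_of_ne (Finset.ne_of_mem_erase hk)])
  · refine Finset.prod_congr rfl fun B hB => Finset.sum_congr rfl fun x _ =>
      Finset.prod_congr rfl fun k hk => ?_
    have hki : k ≠ i := by
      rintro rfl
      exact Finset.ne_of_mem_erase hB (R.part_eq_of_mem (Finset.mem_of_mem_erase hB) hk).symm
    rw [Function.update_of_ne hki]

/-- The multilinear form `f ↦ ∏_{B ∈ R} ∑_x ∏_{k ∈ B} f_k(x)`, which is `τ^R` for the counting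
measure up to a factor. -/
def blockSum [CommSemiring 𝕜] [Fintype I] (R : ArgPartition ι) :
    MultilinearMap 𝕜 (fun _ : ι => I → 𝕜) 𝕜 where
  toFun f := ∏ B ∈ R.parts, ∑ x, ∏ k ∈ B, f k x
  map_update_add' {dec} f i a b := by
    obtain rfl := Subsingleton.elim hι dec
    simp only [prod_sum_prod_update, Pi.add_apply, add_mul, Finset.sum_add_distrib]
  map_update_smul' {dec} f i c a := by
    obtain rfl := Subsingleton.elim hι dec
    simp only [prod_sum_prod_update, Pi.smul_apply, smul_eq_mul, mul_assoc, ← Finset.mul_sum]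

theorem blockSum_apply [CommSemiring 𝕜] [Fintype I] (R : ArgPartition ι) (f : ι → I → 𝕜) :
    blockSum R f = ∏ B ∈ R.parts, ∑ x, ∏ k ∈ B, f k x := rfl

open Classical in
theorem blockSum_single [CommSemiring 𝕜] [Fintype I] (R : ArgPartition ι) (j : ι → I) :
    blockSum R (fun k => Pi.single (j k) (1 : 𝕜)) = if R ≤ kerPartition j then 1 else 0 := by
  have h : ∀ B ∈ R.parts, ∑ x, ∏ k ∈ B, (Pi.single (j k) (1 : 𝕜) : I → 𝕜) x =
      if ∀ k ∈ B, ∀ l ∈ B, j k = j l then 1 else 0 := fun B hB => by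
    obtain ⟨i, hi⟩ := R.nonempty_of_mem_parts hB
    simpa only [one_mul] using sum_mul_prod_single hi j (fun _ => (1 : 𝕜))
  rw [blockSum_apply, Finset.prod_congr rfl h, Finset.prod_ite_zero, Finset.prod_const_one]
  simp only [le_kerPartition_iff]
  congr

variable [CommRing 𝕜] [Fintype I]

open Classical in
theorem sum_mul_blockSum_single (c : ArgPartition ι → 𝕜) (j : ι → I) :
    ∑ R, c R * blockSum R (fun k => Pi.single (j k) (1 : 𝕜)) =
      ∑ R with R ≤ kerPartition j, c R := by
  simp only [blockSum_single, mul_ite, mul_one, mul_zero, Finset.sum_filter]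

/-- The value of an invariant form on `(e_{j k})_k` depends only on the partition `kerPartition j`,
and `blockSum R` is the indicator of `R ≤ kerPartition j`; hence Möbius inversion. -/
theorem exists_eq_sum_blockSum (Ψ : MultilinearMap 𝕜 (fun _ : ι => I → 𝕜) 𝕜)
    (h : ∀ (σ : Equiv.Perm I) (f : ι → I → 𝕜), Ψ (fun k => f k ∘ σ) = Ψ f) :
    ∃ c : ArgPartition ι → 𝕜, Ψ = ∑ R, c R • blockSum R := by
  classical
  let b : (ι → I) → 𝕜 := fun j => Ψ fun k => Pi.single (j k) 1
  have hb : b.FactorsThrough kerPartition := fun j j' hjj' => by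
    obtain ⟨σ, rfl⟩ := exists_perm_comp_eq_of_kerPartition_eq hjj'
    simp only [b]
    rw [← h σ fun k => Pi.single ((σ ∘ j) k) 1]
    congr 1
    ext k x
    simp only [Pi.single_apply, Function.comp_apply, EmbeddingLike.apply_eq_iff_eq]
  obtain ⟨c, hc⟩ := exists_forall_sum_le_eq (Function.extend kerPartition b 0)
  refine ⟨c, Module.Basis.ext_multilinear (fun _ => Pi.basisFun 𝕜 I) fun j => ?_⟩
  simp only [Pi.basisFun_apply, sum_apply, smul_apply, smul_eq_mul]
  rw [sum_mul_blockSum_single, hc, hb.extend_apply]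

theorem eq_zero_of_sum_blockSum_eq_zero (hI : Fintype.card ι ≤ Fintype.card I)
    (c : ArgPartition ι → 𝕜) (h : ∀ f : ι → I → 𝕜, ∑ R, c R * blockSum R f = 0) : c = 0 := by
  classical
  refine eq_zero_of_sum_le_eq_zero c fun Q _ => ?_
  obtain ⟨j, rfl⟩ := exists_kerPartition_eq (I := I) Q (Q.card_parts_le_card.trans hI)
  rw [← sum_mul_blockSum_single, h]

end BlockSum

/-! ### Simple functions -/

section SimpleFunctions

variable {Ω : Type u} [MeasurableSpace Ω]

/-- The class of a simple function in `L^{1/r}(μ)`. -/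
def simpleLp (r : Exponent) (μ : FinMeas Ω) : SimpleFunc Ω ℝ →ₗ[ℝ] Lp ℝ r.inv μ.1 where
  toFun f := (f.memLp_of_isFiniteMeasure r.inv μ.1).toLp f
  map_add' f g := by
    rw [← MemLp.toLp_add, MemLp.toLp_eq_toLp_iff, SimpleFunc.coe_add]
  map_smul' c f := by
    rw [RingHom.id_apply, ← MemLp.toLp_const_smul, MemLp.toLp_eq_toLp_iff, SimpleFunc.coe_smul]

theorem coeFn_simpleLp (r : Exponent) (μ : FinMeas Ω) (f : SimpleFunc Ω ℝ) :
    simpleLp r μ f =ᵐ[μ.1] f :=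
  MemLp.coeFn_toLp (f.memLp_of_isFiniteMeasure r.inv μ.1)

theorem simpleLp_one (r : Exponent) (μ : FinMeas Ω) :
    simpleLp r μ 1 = Lp.const r.inv μ.1 (1 : ℝ) :=
  Lp.ext ((coeFn_simpleLp r μ 1).trans (Lp.coeFn_const ..).symm)

theorem memLp_simple_mul (r : Exponent) (μ : FinMeas Ω) (f : SimpleFunc Ω ℝ)
    (φ : Lp ℝ r.inv μ.1) : MemLp (fun x => f x * φ x) r.inv μ.1 :=
  (Lp.memLp φ).mul (f.memLp_top μ.1)

/-- Multiplication by a simple function on `L^{1/r}(μ)`. -/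
def simpleMul (r : Exponent) (f : SimpleFunc Ω ℝ) (μ : FinMeas Ω) :
    Lp ℝ r.inv μ.1 →ₗ[ℝ] Lp ℝ r.inv μ.1 where
  toFun φ := (memLp_simple_mul r μ f φ).toLp _
  map_add' φ ψ := by
    rw [← MemLp.toLp_add, MemLp.toLp_eq_toLp_iff]
    filter_upwards [Lp.coeFn_add φ ψ] with x hx
    simp only [hx, Pi.add_apply, mul_add]
  map_smul' c φ := by
    rw [RingHom.id_apply, ← MemLp.toLp_const_smul, MemLp.toLp_eq_toLp_iff]
    filter_upwards [Lp.coeFn_smul c φ] with x hx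
    simp only [hx, Pi.smul_apply, smul_eq_mul, mul_left_comm]

theorem coeFn_simpleMul (r : Exponent) (f : SimpleFunc Ω ℝ) (μ : FinMeas Ω)
    (φ : Lp ℝ r.inv μ.1) : simpleMul r f μ φ =ᵐ[μ.1] fun x => f x * φ x :=
  MemLp.coeFn_toLp (memLp_simple_mul r μ f φ)

theorem simpleMul_const_one (r : Exponent) (f : SimpleFunc Ω ℝ) (μ : FinMeas Ω) :
    simpleMul r f μ (Lp.const r.inv μ.1 (1 : ℝ)) = simpleLp r μ f := by
  refine Lp.ext ((coeFn_simpleMul r f μ _).trans ?_)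
  filter_upwards [Lp.coeFn_const (p := r.inv) (μ := μ.1) (1 : ℝ), coeFn_simpleLp r μ f]
    with x hx hx'
  rw [hx, hx', Function.const_apply, mul_one]

/-- Multiplication by a simple function on `S^r(Ω)`, before its continuity is known. -/
def simpleActₗ (r : Exponent) (f : SimpleFunc Ω ℝ) : RootMeas r Ω →ₗ[ℝ] RootMeas r Ω := by
  classical
  exact Module.DirectLimit.lift ℝ (FinMeas Ω) (fun μ : FinMeas Ω => Lp ℝ r.inv μ.1)
    (fun _ _ h => rescale r h) (fun μ => densityPow r μ ∘ₗ simpleMul r f μ) fun μ ν h φ => by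
      rw [LinearMap.comp_apply, LinearMap.comp_apply, ← densityPow_rescale r h]
      congr 1
      refine Lp.ext ((coeFn_simpleMul r f ν _).trans ?_)
      refine Filter.EventuallyEq.trans ?_ (coeFn_rescale r h _).symm
      filter_upwards [coeFn_rescale r h φ, ae_imp_rescale r ν (coeFn_simpleMul r f μ φ)]
        with x hx hx'
      rw [hx, hx', mul_assoc]

theorem simpleActₗ_densityPow (r : Exponent) (f : SimpleFunc Ω ℝ) (μ : FinMeas Ω)
    (φ : Lp ℝ r.inv μ.1) :
    simpleActₗ r f (densityPow r μ φ) = densityPow r μ (simpleMul r f μ φ) := by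
  classical
  exact Module.DirectLimit.lift_of _ _ _

/-- Multiplication by a simple function on `S^r(Ω)`. -/
def simpleAct (r : Exponent) (f : SimpleFunc Ω ℝ) : RootMeas r Ω →L[ℝ] RootMeas r Ω :=
  (simpleActₗ r f).mkContinuous f.exists_forall_norm_le.choose fun x => by
    obtain ⟨μ, φ, rfl⟩ := exists_densityPow r x
    rw [simpleActₗ_densityPow, norm_densityPow, norm_densityPow]
    refine Lp.norm_le_mul_norm_of_ae_le_mul ?_
    filter_upwards [coeFn_simpleMul r f μ φ] with x hx
    rw [hx, norm_mul]
    exact mul_le_mul_of_nonneg_right (f.exists_forall_norm_le.choose_spec x) (norm_nonneg _)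

theorem simpleAct_densityPow (r : Exponent) (f : SimpleFunc Ω ℝ) (μ : FinMeas Ω)
    (φ : Lp ℝ r.inv μ.1) :
    simpleAct r f (densityPow r μ φ) = densityPow r μ (simpleMul r f μ φ) :=
  simpleActₗ_densityPow r f μ φ

theorem simpleAct_rootPow (r : Exponent) (f : SimpleFunc Ω ℝ) (μ : FinMeas Ω) :
    simpleAct r f (rootPow r μ) = densityPow r μ (simpleLp r μ f) := by
  rw [rootPow, simpleAct_densityPow, simpleMul_const_one]

end SimpleFunctions

section RootPow

variable {Ω : Type u} [MeasurableSpace Ω]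

theorem densityPow_injective (r : Exponent) (μ : FinMeas Ω) :
    Function.Injective (densityPow r μ) := by
  rw [injective_iff_map_eq_zero]
  intro φ h
  rw [← norm_eq_zero, ← norm_densityPow, h, norm_zero]

theorem densityPow_eq_of_ae_eq (r : Exponent) {μ ν : FinMeas Ω} (h : μ ≤ ν) {φ : Lp ℝ r.inv μ.1}
    {ψ : Lp ℝ r.inv ν.1}
    (hψ : ψ =ᵐ[ν.1] fun x => φ x * ((μ.1.rnDeriv ν.1 x).toReal) ^ (r : ℝ)) :
    densityPow r μ φ = densityPow r ν ψ := by
  rw [← densityPow_rescale r h]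
  congr 1
  exact Lp.ext ((coeFn_rescale r h φ).trans hψ.symm)

theorem rootPow_eq_of_ae_eq (r : Exponent) {μ ν : FinMeas Ω} (h : μ ≤ ν)
    {ψ : Lp ℝ r.inv ν.1} (hψ : ψ =ᵐ[ν.1] fun x => ((μ.1.rnDeriv ν.1 x).toReal) ^ (r : ℝ)) :
    rootPow r μ = densityPow r ν ψ := by
  refine densityPow_eq_of_ae_eq r h (hψ.trans ?_)
  refine Filter.EventuallyEq.trans ?_ (ae_imp_rescale r ν (Lp.coeFn_const ..)).symm
  exact ae_of_all _ fun x => by simp only [Function.const_apply, one_mul]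

theorem norm_simpleLp_restrict_one (r : Exponent) (μ : FinMeas Ω) {A : Set Ω}
    (hA : MeasurableSet A) :
    ‖simpleLp r μ (SimpleFunc.restrict 1 A)‖ = μ.1.real A ^ (r : ℝ) := by
  have h : simpleLp r μ (SimpleFunc.restrict 1 A) =
      indicatorConstLp r.inv hA (measure_ne_top μ.1 A) (1 : ℝ) := by
    refine Lp.ext ((coeFn_simpleLp r μ _).trans ?_)
    rw [SimpleFunc.coe_restrict _ hA]
    exact indicatorConstLp_coeFn.symm
  rw [h, norm_indicatorConstLp r.inv_ne_zero r.inv_ne_top, r.toReal_inv, norm_one, one_mul,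
    one_div_one_div]

variable {r : Exponent} {ι : Type*} {l : Filter ι} {ν : ι → FinMeas Ω} {ν₀ : FinMeas Ω}

theorem tendsto_measureReal_of_tendsto_rootPow
    (h : Filter.Tendsto (fun i => rootPow r (ν i)) l (𝓝 (rootPow r ν₀)))
    {A : Set Ω} (hA : MeasurableSet A) :
    Filter.Tendsto (fun i => (ν i).1.real A) l (𝓝 (ν₀.1.real A)) := by
  have hnorm : ∀ ν : FinMeas Ω,
      ‖simpleAct r (SimpleFunc.restrict 1 A) (rootPow r ν)‖ ^ (1 / (r : ℝ)) = ν.1.real A :=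
    fun ν => by
      rw [simpleAct_rootPow, norm_densityPow, norm_simpleLp_restrict_one r ν hA,
        ← Real.rpow_mul measureReal_nonneg, mul_one_div_cancel r.2.1.ne', Real.rpow_one]
  simpa only [Function.comp_apply, hnorm] using
    (((simpleAct r (SimpleFunc.restrict 1 A)).continuous.tendsto _).comp h).norm.rpow_const
      (p := 1 / (r : ℝ)) (Or.inr (one_div_nonneg.2 r.2.1.le))

theorem tendsto_integral_simpleFunc_of_tendsto_rootPow
    (h : Filter.Tendsto (fun i => rootPow r (ν i)) l (𝓝 (rootPow r ν₀))) (f : SimpleFunc Ω ℝ) :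
    Filter.Tendsto (fun i => ∫ x, f x ∂(ν i).1) l (𝓝 (∫ x, f x ∂ν₀.1)) := by
  simp only [SimpleFunc.integral_eq_sum f (f.integrable_of_isFiniteMeasure)]
  exact tendsto_finsetSum _ fun y _ =>
    (tendsto_measureReal_of_tendsto_rootPow h (f.measurableSet_fiber y)).smul_const y

theorem tendsto_measureReal_rpow_neg_mul_rpow
    (h : Filter.Tendsto (fun i => rootPow r (ν i)) l (𝓝 (rootPow r ν₀)))
    {A : Set Ω} (hA : MeasurableSet A) (h0 : ν₀.1.real A = 0) {a b : ℝ} (hab : a < b) :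
    Filter.Tendsto (fun i => (ν i).1.real A ^ (-a) * (ν i).1.real A ^ b) l (𝓝 0) := by
  have hlim := (tendsto_measureReal_of_tendsto_rootPow h hA).rpow_const (p := -a + b)
    (Or.inr (by linarith))
  rw [h0, Real.zero_rpow (by linarith)] at hlim
  exact hlim.congr fun i => Real.rpow_add' measureReal_nonneg (by linarith)

end RootPow

/-! ### Vector fields from simple functions -/

section Projection

variable {Ω : Type u} [MeasurableSpace Ω] {s : Setting} {r : Exponent}

/-- The linear form whose kernel is the tangent space: `0` for `M^r(Ω)` and `φ ↦ ∫ φ dμ` for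
`P^r(Ω)`. -/
def tangentForm (s : Setting) (r : Exponent) (μ : FinMeas Ω) : Lp ℝ r.inv μ.1 →ₗ[ℝ] ℝ :=
  match s with
  | .measures => 0
  | .probabilities =>
    { toFun := fun φ => ∫ x, φ x ∂μ.1
      map_add' := fun φ ψ => by
        rw [integral_congr_ae (Lp.coeFn_add φ ψ)]
        exact integral_add (integrable_of_Lp r μ φ) (integrable_of_Lp r μ ψ)
      map_smul' := fun c φ => by
        rw [integral_congr_ae (Lp.coeFn_smul c φ)]
        exact integral_const_mul c _ }

theorem mem_tangent_iff {μ : FinMeas Ω} {φ : Lp ℝ r.inv μ.1} :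
    φ ∈ tangent s r μ ↔ tangentForm s r μ φ = 0 := by
  cases s with
  | measures => exact ⟨fun _ => rfl, fun _ => Submodule.mem_top⟩
  | probabilities => exact Iff.rfl

theorem tangentForm_const_one (μ : Point .probabilities Ω) :
    tangentForm .probabilities r μ.base (Lp.const r.inv μ.base.1 (1 : ℝ)) = 1 := by
  have hμ : IsProbabilityMeasure μ.base.1 := ⟨μ.admits⟩
  refine (integral_congr_ae (Lp.coeFn_const ..)).trans ?_
  simp only [Function.const_apply, integral_const, probReal_univ, one_smul]

theorem tangentForm_sub_smul_const_one (μ : Point s Ω) (φ : Lp ℝ r.inv μ.base.1) :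
    tangentForm s r μ.base (φ - tangentForm s r μ.base φ • Lp.const r.inv μ.base.1 (1 : ℝ)) =
      0 := by
  cases s with
  | measures => rfl
  | probabilities =>
    rw [map_sub, map_smul, tangentForm_const_one, smul_eq_mul, mul_one, sub_self]

/-- The projection of `L^{1/r}(μ)` to the tangent space along the constants (for `P^r(Ω)`). -/
def tangentProj (s : Setting) (r : Exponent) (μ : Point s Ω) :
    Lp ℝ r.inv μ.base.1 →ₗ[ℝ] tangent s r μ.base where
  toFun φ := ⟨φ - tangentForm s r μ.base φ • Lp.const r.inv μ.base.1 (1 : ℝ),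
    mem_tangent_iff.2 (tangentForm_sub_smul_const_one μ φ)⟩
  map_add' φ ψ := by
    ext1
    simp only [map_add, Submodule.coe_add]
    module
  map_smul' c φ := by
    ext1
    simp only [map_smul, Submodule.coe_smul, RingHom.id_apply, smul_eq_mul]
    module

theorem coe_tangentProj (μ : Point s Ω) (φ : Lp ℝ r.inv μ.base.1) :
    (tangentProj s r μ φ : Lp ℝ r.inv μ.base.1) =
      φ - tangentForm s r μ.base φ • Lp.const r.inv μ.base.1 (1 : ℝ) := rfl

theorem tangentProj_coe (μ : Point s Ω) (φ : tangent s r μ.base) : tangentProj s r μ φ = φ := by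
  ext1
  rw [coe_tangentProj, mem_tangent_iff.1 φ.2, zero_smul, sub_zero]

theorem tendsto_tangentForm_simpleLp {ι : Type*} {l : Filter ι} {ν : ι → FinMeas Ω}
    {ν₀ : FinMeas Ω} (h : Filter.Tendsto (fun i => rootPow r (ν i)) l (𝓝 (rootPow r ν₀)))
    (f : SimpleFunc Ω ℝ) :
    Filter.Tendsto (fun i => tangentForm s r (ν i) (simpleLp r (ν i) f)) l
      (𝓝 (tangentForm s r ν₀ (simpleLp r ν₀ f))) := by
  cases s with
  | measures => exact tendsto_const_nhds
  | probabilities =>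
    have hform : ∀ ν : FinMeas Ω, tangentForm .probabilities r ν (simpleLp r ν f) =
        ∫ x, f x ∂ν.1 := fun ν => integral_congr_ae (coeFn_simpleLp r ν f)
    simp only [hform]
    exact tendsto_integral_simpleFunc_of_tendsto_rootPow h f

theorem exists_tangentForm_simpleLp_restrict_one (s : Setting) (r : Exponent) {A : Set Ω}
    (hA : MeasurableSet A) : ∃ c : ℝ, ∀ ν : FinMeas Ω,
      tangentForm s r ν (simpleLp r ν (SimpleFunc.restrict 1 A)) = c * ν.1.real A := by
  cases s with
  | measures => exact ⟨0, fun ν => (zero_mul _).symm⟩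
  | probabilities =>
    refine ⟨1, fun ν => (integral_congr_ae (coeFn_simpleLp r ν _)).trans ?_⟩
    rw [SimpleFunc.coe_restrict _ hA, SimpleFunc.coe_one, integral_indicator_one hA, one_mul]

theorem continuous_powTopology_iff {Y : Type*} [TopologicalSpace Y] {F : Point s Ω → Y} :
    Continuous[powTopology s r Ω, inferInstance] F ↔
      ∀ (l : Filter (Point s Ω)) (μ : Point s Ω),
        Filter.Tendsto (fun ν => rootPow r ν.base) l (𝓝 (rootPow r μ.base)) →
          Filter.Tendsto F l (𝓝 (F μ)) := by
  let := powTopology s r Ω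
  have hnhds : ∀ μ : Point s Ω,
      𝓝 μ = Filter.comap (fun ν => rootPow r ν.base) (𝓝 (rootPow r μ.base)) := nhds_induced _
  rw [continuous_iff_continuousAt]
  refine ⟨fun h l μ hl => (h μ).mono_left ?_, fun h μ => h (𝓝 μ) μ ?_⟩
  · rw [hnhds]
    exact hl.le_comap
  · rw [hnhds]
    exact Filter.tendsto_comap

theorem tendsto_of_continuous_powTopology {Y : Type*} [TopologicalSpace Y] {F : Point s Ω → Y}
    (hF : Continuous[powTopology s r Ω, inferInstance] F) {ι : Type*} {l : Filter ι}
    {ν : ι → Point s Ω} {ν₀ : Point s Ω}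
    (h : Filter.Tendsto (fun i => rootPow r (ν i).base) l (𝓝 (rootPow r ν₀.base))) :
    Filter.Tendsto (fun i => F (ν i)) l (𝓝 (F ν₀)) :=
  continuous_powTopology_iff.1 hF (l.map ν) ν₀ h

/-- The vector field given by a simple function, projected to the tangent spaces. -/
def simpleField (s : Setting) (r : Exponent) (f : SimpleFunc Ω ℝ) : VectorField s r Ω where
  val μ := tangentProj s r μ (simpleLp r μ.base f)
  continuous_val := continuous_powTopology_iff.2 fun l μ h => by
    simp only [coe_tangentProj, map_sub, map_smul, ← simpleAct_rootPow]
    exact (((simpleAct r f).continuous.tendsto _).comp h).sub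
      ((tendsto_tangentForm_simpleLp h f).smul h)

theorem tendsto_measureReal_rpow_neg_smul_tangentProj {A : Set Ω} (hA : MeasurableSet A) {a : ℝ}
    (har : a < r) {l : Filter (Point s Ω)} {μ : Point s Ω} (h0 : μ.base.1.real A = 0)
    (h : Filter.Tendsto (fun ν => rootPow r ν.base) l (𝓝 (rootPow r μ.base))) :
    Filter.Tendsto (fun ν : Point s Ω => ν.base.1.real A ^ (-a) •
      densityPow r ν.base (tangentProj s r ν (simpleLp r ν.base (SimpleFunc.restrict 1 A))))
      l (𝓝 0) := by
  obtain ⟨c, hc⟩ := exists_tangentForm_simpleLp_restrict_one s r hA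
  simp only [coe_tangentProj, map_sub, map_smul, smul_sub, hc, smul_smul]
  rw [← sub_zero (0 : RootMeas r Ω)]
  refine Filter.Tendsto.sub ?_ ?_
  · rw [tendsto_zero_iff_norm_tendsto_zero]
    refine (tendsto_measureReal_rpow_neg_mul_rpow h hA h0 har).congr fun ν => ?_
    rw [norm_smul, norm_densityPow, norm_simpleLp_restrict_one r _ hA, Real.norm_of_nonneg
      (Real.rpow_nonneg measureReal_nonneg _)]
  · have hlim := ((tendsto_measureReal_rpow_neg_mul_rpow h hA h0
      (har.trans_le r.2.2)).const_mul c).smul h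
    simp only [mul_zero, zero_smul, Real.rpow_one, mul_left_comm c] at hlim
    exact hlim

/-- The vector field `ν ↦ ν(A)^{-a} 1_A`, `0 < a < r`, projected to the tangent spaces. It is
continuous because `‖ν(A)^{-a} 1_A ν^r‖ = ν(A)^{r - a}`. -/
def spikeField (s : Setting) (r : Exponent) {A : Set Ω} (hA : MeasurableSet A) {a : ℝ}
    (ha : 0 < a) (har : a < r) : VectorField s r Ω where
  val μ := (μ.base.1.real A ^ (-a)) • tangentProj s r μ
    (simpleLp r μ.base (SimpleFunc.restrict 1 A))
  continuous_val := continuous_powTopology_iff.2 fun l μ h => by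
    simp only [Submodule.coe_smul, map_smul]
    by_cases h0 : μ.base.1.real A = 0
    · rw [h0, Real.zero_rpow (neg_ne_zero.2 ha.ne'), zero_smul]
      exact tendsto_measureReal_rpow_neg_smul_tangentProj hA har h0 h
    · exact ((tendsto_measureReal_of_tendsto_rootPow h hA).rpow_const (Or.inl h0)).smul
        (tendsto_of_continuous_powTopology
          (simpleField s r (SimpleFunc.restrict 1 A)).continuous_val h)

end Projection

/-! ### Values of tensor fields on simple functions -/

section Evaluation

variable {Ω Ω' : Type u} [MeasurableSpace Ω] [MeasurableSpace Ω'] {s : Setting} {r : Exponent}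
  {n : ℕ}

/-- The multilinear form `Ψ` at `ν^r`, evaluated on the projections to the tangent space of simple
functions; it allows to compare the forms at different points of `M^r(Ω)` resp. `P^r(Ω)`. -/
def evalSimple (Ψ : TensorField s r n Ω) (ν : Point s Ω) :
    MultilinearMap ℝ (fun _ : Fin n => SimpleFunc Ω ℝ) ℝ :=
  (Ψ.form ν).compLinearMap fun _ => tangentProj s r ν ∘ₗ simpleLp r ν.base

theorem evalSimple_apply (Ψ : TensorField s r n Ω) (ν : Point s Ω) (f : Fin n → SimpleFunc Ω ℝ) :
    evalSimple Ψ ν f = Ψ.form ν fun i => tangentProj s r ν (simpleLp r ν.base (f i)) := rfl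

/-- The product of moments `∏_{B ∈ R} ∫ ∏_{i ∈ B} f_i dμ`, which is `τ^R` up to a power of `r`. -/
def momentProd {ι : Type*} [Fintype ι] [DecidableEq ι] (μ : Measure Ω) (R : ArgPartition ι)
    (f : ι → Ω → ℝ) : ℝ :=
  ∏ B ∈ R.parts, ∫ x, ∏ i ∈ B, f i x ∂μ

theorem partitionTensor_eq_momentProd (r : Exponent) (μ : FinMeas Ω) (R : ArgPartition (Fin n))
    {φ : Fin n → Lp ℝ r.inv μ.1} {f : Fin n → Ω → ℝ} (h : ∀ i, φ i =ᵐ[μ.1] f i) :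
    partitionTensor r μ R φ = 1 / (r : ℝ) ^ n * momentProd μ.1 R f := by
  have hblock : ∀ B ∈ R.parts, canonicalTensor r μ (fun j : B => φ j) =
      (1 / (r : ℝ)) ^ B.card * ∫ x, ∏ i ∈ B, f i x ∂μ.1 := fun B _ => by
    rw [canonicalTensor, Fintype.card_coe, one_div_pow]
    congr 1
    refine integral_congr_ae ?_
    filter_upwards [ae_all_iff.2 h] with x hx
    rw [← Finset.prod_coe_sort B]
    exact Finset.prod_congr rfl fun i _ => hx i
  rw [partitionTensor, Finset.prod_congr rfl hblock, Finset.prod_mul_distrib,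
    Finset.prod_pow_eq_pow_sum, R.sum_card_parts, Finset.card_univ, Fintype.card_fin, one_div_pow,
    momentProd]

/-- The image of a point of `M^r(Ω)` resp. `P^r(Ω)` under a measurable map. -/
def Point.map {κ : Ω → Ω'} (hκ : Measurable κ) (ν : Point s Ω) : Point s Ω' where
  base := ⟨ν.base.1.map κ, inferInstance⟩
  admits := by
    cases s with
    | measures => trivial
    | probabilities => exact (Measure.map_apply hκ MeasurableSet.univ).trans ν.admits

theorem momentProd_map {ι : Type*} [Fintype ι] [DecidableEq ι] {κ : Ω → Ω'} (hκ : Measurable κ)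
    (ν : Measure Ω) (R : ArgPartition ι) (f : ι → SimpleFunc Ω' ℝ) :
    momentProd (ν.map κ) R (fun i => f i) = momentProd ν R fun i => (f i).comp κ hκ :=
  Finset.prod_congr rfl fun B _ => integral_map hκ.aemeasurable
    (Finset.measurable_prod B fun i _ => (f i).measurable).aestronglyMeasurable

theorem tangentForm_formalDeriv (K : Kernel Ω Ω') [IsMarkovKernel K] (μ : FinMeas Ω)
    (φ : Lp ℝ r.inv μ.1) :
    tangentForm s r (μ.push K) (formalDeriv r K μ φ) = tangentForm s r μ φ := by
  cases s with
  | measures => rfl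
  | probabilities => exact integral_formalDeriv r K μ φ

variable {K : Kernel Ω Ω'} [IsMarkovKernel K] {κ : Ω' → Ω}

theorem IsRetraction.formalDeriv_simpleLp (hκ : IsRetraction κ K) (μ : FinMeas Ω)
    (f : SimpleFunc Ω ℝ) :
    formalDeriv r K μ (simpleLp r μ f) = simpleLp r (μ.push K) (f.comp κ hκ.1) := by
  refine Lp.ext ((hκ.formalDeriv_ae_eq r μ _).trans ?_)
  refine Filter.EventuallyEq.trans ?_ (coeFn_simpleLp r _ _).symm
  exact (hκ.measurePreserving μ).quasiMeasurePreserving.ae (coeFn_simpleLp r μ f)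

theorem IsRetraction.tangentMap_tangentProj (hκ : IsRetraction κ K) (μ : Point s Ω)
    (f : SimpleFunc Ω ℝ) :
    tangentMap s r K μ (tangentProj s r μ (simpleLp r μ.base f)) =
      tangentProj s r (μ.push K) (simpleLp r (μ.push K).base (f.comp κ hκ.1)) := by
  ext1
  change formalDeriv r K μ.base (tangentProj s r μ (simpleLp r μ.base f)) = _
  rw [coe_tangentProj, coe_tangentProj, map_sub, map_smul, ← simpleLp_one, ← simpleLp_one,
    hκ.formalDeriv_simpleLp, hκ.formalDeriv_simpleLp, ← hκ.formalDeriv_simpleLp μ.base f,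
    tangentForm_formalDeriv]
  rfl

theorem evalSimple_map {Θ : TensorFamily.{u} s r n} (hΘ : IsFinitelyCongruentFamily Θ)
    {I : Type u} [Finite I] [MeasurableSpace I] [DiscreteMeasurableSpace I] {κ : Ω → I}
    (hκ : Measurable κ) (hs : Function.Surjective κ) (ν : Point s Ω)
    (f : Fin n → SimpleFunc I ℝ) :
    evalSimple (Θ I) (ν.map hκ) f = evalSimple (Θ Ω) ν fun i => (f i).comp κ hκ := by
  obtain ⟨K, _, hretr, hK⟩ := exists_isRetraction_comp_map_eq ν.base.1 hκ hs
  have hν : (ν.map hκ).push K = ν := by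
    obtain ⟨⟨ν, _⟩, _⟩ := ν
    simp only [Point.push, Point.map, FinMeas.push] at hK ⊢
    simp only [hK]
  suffices key : ∀ ν' : Point s Ω, (ν.map hκ).push K = ν' →
      evalSimple (Θ I) (ν.map hκ) f = evalSimple (Θ Ω) ν' fun i => (f i).comp κ hκ from key ν hν
  rintro ν' rfl
  rw [evalSimple_apply, evalSimple_apply, ← hΘ I Ω K ⟨κ, hretr⟩, pullback,
    MultilinearMap.compLinearMap_apply]
  simp only [hretr.tangentMap_tangentProj]

end Evaluation

/-! ### Finite sample spaces -/

section Masses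

/-- The total masses of the nonzero measures of a setting. -/
def Setting.masses : Setting → Set ℝ
  | .measures => Set.Ioi 0
  | .probabilities => {1}

theorem Setting.pos_of_mem_masses {s : Setting} {m : ℝ} (hm : m ∈ s.masses) : 0 < m := by
  cases s with
  | measures => exact hm
  | probabilities =>
    rw [mem_singleton_iff.1 hm]
    exact one_pos

variable {s : Setting} {Ω Ω' : Type u} [MeasurableSpace Ω] [MeasurableSpace Ω']

theorem Point.mass_mem_masses (ν : Point s Ω) (h : 0 < ν.base.mass) : ν.base.mass ∈ s.masses := by
  cases s with
  | measures => exact h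
  | probabilities =>
    have hν : IsProbabilityMeasure ν.base.1 := ⟨ν.admits⟩
    exact probReal_univ

theorem Point.mass_map {κ : Ω → Ω'} (hκ : Measurable κ) (ν : Point s Ω) :
    (ν.map hκ).base.mass = ν.base.mass :=
  congrArg ENNReal.toReal (Measure.map_apply hκ MeasurableSet.univ)

end Masses

section FiniteSpaces

variable {s : Setting} {r : Exponent} {n : ℕ} {I : Type u} [MeasurableSpace I]

theorem Point.ext_singleton [Finite I] {ν ν' : Point s I}
    (h : ∀ x, ν.base.1.real {x} = ν'.base.1.real {x}) : ν = ν' := by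
  obtain ⟨⟨ν, _⟩, _⟩ := ν
  obtain ⟨⟨ν', _⟩, _⟩ := ν'
  obtain rfl : ν = ν' := Measure.ext_of_singleton fun x =>
    (ENNReal.toReal_eq_toReal_iff' (measure_ne_top _ _) (measure_ne_top _ _)).1 (h x)
  rfl

/-- A function on a finite discrete space, as a simple function. -/
def simpleOfFinite [Finite I] [MeasurableSingletonClass I] : (I → ℝ) →ₗ[ℝ] SimpleFunc I ℝ where
  toFun f := SimpleFunc.ofFinite f
  map_add' f g := by ext; rfl
  map_smul' c f := by ext; rfl

theorem coe_simpleOfFinite [Finite I] [MeasurableSingletonClass I] (f : I → ℝ) :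
    ⇑(simpleOfFinite f) = f := rfl

theorem simpleOfFinite_coe [Finite I] [MeasurableSingletonClass I] (f : SimpleFunc I ℝ) :
    simpleOfFinite ⇑f = f := by ext; rfl

variable [Fintype I] [MeasurableSingletonClass I]

theorem FinMeas.mass_eq_sum (μ : FinMeas I) : μ.mass = ∑ x, μ.1.real {x} := by
  rw [FinMeas.mass, ← Finset.coe_univ, sum_measureReal_singleton]

theorem integral_eq_sum_measureReal_mul (μ : Measure I) [IsFiniteMeasure μ] (f : I → ℝ) :
    ∫ x, f x ∂μ = ∑ x, μ.real {x} * f x := by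
  rw [integral_fintype Integrable.of_finite]
  rfl

theorem Point.exists_measureReal_singleton_eq (w : I → ℝ) (hw : ∀ x, 0 ≤ w x)
    (hs : ∑ x, w x ∈ s.masses) : ∃ ν : Point s I, ∀ x, ν.base.1.real {x} = w x := by
  let μ : Measure I := Measure.sum fun x => ENNReal.ofReal (w x) • Measure.dirac x
  have hμ : ∀ x, μ {x} = ENNReal.ofReal (w x) := fun x => by
    rw [Measure.sum_smul_dirac_singleton]
  have huniv : μ univ = ENNReal.ofReal (∑ x, w x) := by
    rw [← Finset.coe_univ, ← sum_measure_singleton, ENNReal.ofReal_sum_of_nonneg fun x _ => hw x]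
    exact Finset.sum_congr rfl fun x _ => hμ x
  refine ⟨⟨⟨μ, ⟨huniv ▸ ENNReal.ofReal_lt_top⟩⟩, ?_⟩, fun x => ?_⟩
  · cases s with
    | measures => trivial
    | probabilities => exact huniv.trans (by rw [mem_singleton_iff.1 hs, ENNReal.ofReal_one])
  · rw [Measure.real, hμ, ENNReal.toReal_ofReal (hw x)]

theorem map_measureReal_singleton {J : Type u} [MeasurableSpace J] [MeasurableSingletonClass J]
    [DecidableEq J] {κ : I → J} (hκ : Measurable κ) (ν : Point s I) (y : J) :
    (ν.map hκ).base.1.real {y} = ∑ x with κ x = y, ν.base.1.real {x} := by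
  rw [sum_measureReal_singleton, Finset.coe_filter_univ]
  exact congrArg ENNReal.toReal (Measure.map_apply hκ (measurableSet_singleton y))

theorem momentProd_uniform {ι : Type*} [Fintype ι] [DecidableEq ι] {μ : Measure I}
    [IsFiniteMeasure μ] {w : ℝ} (h : ∀ x, μ.real {x} = w) (R : ArgPartition ι) (f : ι → I → ℝ) :
    momentProd μ R f = w ^ R.parts.card * blockSum R f := by
  rw [momentProd, blockSum_apply, ← Finset.prod_const, ← Finset.prod_mul_distrib]
  refine Finset.prod_congr rfl fun B _ => ?_
  simp only [integral_eq_sum_measureReal_mul, Finset.mul_sum, h]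

theorem eq_zero_of_sum_momentProd_eq_zero {ι : Type*} [Fintype ι] [DecidableEq ι] {μ : Measure I}
    [IsFiniteMeasure μ] {w : ℝ} (hw : w ≠ 0) (hμ : ∀ x, μ.real {x} = w)
    (hI : Fintype.card ι ≤ Fintype.card I) (c : ArgPartition ι → ℝ)
    (h : ∀ f : ι → I → ℝ, ∑ R, c R * momentProd μ R f = 0) : c = 0 := by
  have hzero := eq_zero_of_sum_blockSum_eq_zero hI (fun R => c R * w ^ R.parts.card) fun f => by
    simp only [mul_assoc, ← momentProd_uniform hμ, h]
  exact funext fun R => (mul_eq_zero.1 (congrFun hzero R)).resolve_right (pow_ne_zero _ hw)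

end FiniteSpaces

section UniformMeasures

variable {s : Setting} {r : Exponent} {n : ℕ} {Θ : TensorFamily.{u} s r n} {I : Type u} [Finite I]
  [MeasurableSpace I] [DiscreteMeasurableSpace I]

theorem evalSimple_comp_perm (hΘ : IsFinitelyCongruentFamily Θ) {ν : Point s I} {w : ℝ}
    (hν : ∀ x, ν.base.1.real {x} = w) (σ : Equiv.Perm I) (f : Fin n → I → ℝ) :
    evalSimple (Θ I) ν (fun k => simpleOfFinite (f k ∘ σ)) =
      evalSimple (Θ I) ν fun k => simpleOfFinite (f k) := by
  classical
  cases nonempty_fintype I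
  have hσ : Measurable σ := Measurable.of_discrete
  have hmap : ν.map hσ = ν := Point.ext_singleton fun x => by
    have hfib : ({y | σ y = x} : Finset I) = {σ.symm x} := by
      ext y
      simp [Equiv.eq_symm_apply]
    rw [map_measureReal_singleton, hfib, Finset.sum_singleton, hν, hν]
  have h := evalSimple_map hΘ hσ σ.surjective ν fun k => simpleOfFinite (f k)
  rw [hmap] at h
  exact h.symm

theorem exists_evalSimple_eq_of_uniform (hΘ : IsFinitelyCongruentFamily Θ) {ν : Point s I} {w : ℝ}
    (hw : w ≠ 0) (hν : ∀ x, ν.base.1.real {x} = w) :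
    ∃ c : ArgPartition (Fin n) → ℝ, ∀ f : Fin n → SimpleFunc I ℝ,
      evalSimple (Θ I) ν f = ∑ R, c R * momentProd ν.base.1 R fun i => f i := by
  classical
  cases nonempty_fintype I
  obtain ⟨c, hc⟩ := exists_eq_sum_blockSum
    ((evalSimple (Θ I) ν).compLinearMap fun _ => simpleOfFinite) (evalSimple_comp_perm hΘ hν)
  refine ⟨fun R => c R / w ^ R.parts.card, fun f => ?_⟩
  have hcf := congrArg (fun Ψ => Ψ fun i => ⇑(f i)) hc
  simp only [MultilinearMap.compLinearMap_apply, simpleOfFinite_coe, sum_apply,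
    smul_apply, smul_eq_mul] at hcf
  rw [hcf]
  refine Finset.sum_congr rfl fun R _ => ?_
  rw [momentProd_uniform hν, ← mul_assoc, div_mul_cancel₀ _ (pow_ne_zero _ hw)]

end UniformMeasures

/-! ### The coefficients of a congruent family -/

section CoefficientsAt

variable {s : Setting} {r : Exponent} {n : ℕ} {Ω : Type u} [MeasurableSpace Ω]

/-- On simple functions, `Ψ` at `ν^r` is the linear combination with coefficients `c` of products of
moments. These are the coefficients with respect to `τ^R`, up to the factor `r^n`. -/
def HasCoeffAt (Ψ : TensorField s r n Ω) (c : ArgPartition (Fin n) → ℝ) (ν : Point s Ω) : Prop :=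
  ∀ f : Fin n → SimpleFunc Ω ℝ, evalSimple Ψ ν f = ∑ R, c R * momentProd ν.base.1 R fun i => f i

theorem HasCoeffAt.map {Θ : TensorFamily.{u} s r n} {c : ArgPartition (Fin n) → ℝ} {ν : Point s Ω}
    (h : HasCoeffAt (Θ Ω) c ν) (hΘ : IsFinitelyCongruentFamily Θ) {I : Type u} [Finite I]
    [MeasurableSpace I] [DiscreteMeasurableSpace I] {κ : Ω → I} (hκ : Measurable κ)
    (hs : Function.Surjective κ) : HasCoeffAt (Θ I) c (ν.map hκ) := fun f => by
  rw [evalSimple_map hΘ hκ hs, h]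
  simp only [Point.map, momentProd_map hκ]

theorem HasCoeffAt.eq_of_uniform {I : Type u} [Fintype I] [MeasurableSpace I]
    [MeasurableSingletonClass I] {Ψ : TensorField s r n I} {c d : ArgPartition (Fin n) → ℝ}
    {ν : Point s I} (hc : HasCoeffAt Ψ c ν) (hd : HasCoeffAt Ψ d ν) {w : ℝ} (hw : w ≠ 0)
    (hν : ∀ x, ν.base.1.real {x} = w) (hI : n ≤ Fintype.card I) : c = d := by
  refine sub_eq_zero.1 (eq_zero_of_sum_momentProd_eq_zero hw hν
    ((Fintype.card_fin n).trans_le hI) (c - d) fun f => ?_)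
  simp only [Pi.sub_apply, sub_mul, Finset.sum_sub_distrib]
  exact sub_eq_zero.2 ((hc fun i => simpleOfFinite (f i)).symm.trans (hd _))

end CoefficientsAt

section UniformCoefficients

variable {s : Setting} {r : Exponent} {n : ℕ} {Θ : TensorFamily.{u} s r n} {m : ℝ}

/-- The family has coefficients `c` at all measures of mass `m` on finite spaces whose points have
equal weights. -/
def HasUniformCoeff (Θ : TensorFamily.{u} s r n) (m : ℝ) (c : ArgPartition (Fin n) → ℝ) : Prop :=
  ∀ (I : Type u) [Fintype I] [MeasurableSpace I] [DiscreteMeasurableSpace I] [Nonempty I]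
    (ν : Point s I), (∀ x, ν.base.1.real {x} = m / Fintype.card I) → HasCoeffAt (Θ I) c ν

theorem Point.exists_uniform (hm : m ∈ s.masses) (I : Type u) [Fintype I] [Nonempty I]
    [MeasurableSpace I] [MeasurableSingletonClass I] :
    ∃ ν : Point s I, ∀ x, ν.base.1.real {x} = m / Fintype.card I := by
  have hm0 := Setting.pos_of_mem_masses hm
  refine Point.exists_measureReal_singleton_eq _ (fun _ => by positivity) ?_
  rwa [Finset.sum_const, Finset.card_univ, nsmul_eq_mul, mul_div_cancel₀ _ (by simp)]

theorem map_measureReal_singleton_of_uniform {I J : Type u} [Fintype I] [MeasurableSpace I]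
    [MeasurableSingletonClass I] [MeasurableSpace J] [MeasurableSingletonClass J] [DecidableEq J]
    {κ : I → J} (hκ : Measurable κ) {ν : Point s I} {w : ℝ} (hν : ∀ x, ν.base.1.real {x} = w)
    (y : J) : (ν.map hκ).base.1.real {y} = Finset.card {x | κ x = y} * w := by
  simp only [map_measureReal_singleton, hν, Finset.sum_const, nsmul_eq_mul]

section Product

variable {I J : Type u} [Fintype I] [Fintype J] [MeasurableSpace I] [MeasurableSpace J]
  [MeasurableSingletonClass I] [MeasurableSingletonClass J] {ρ : Point s (I × J)}
  (hρ : ∀ p, ρ.base.1.real {p} = m / Fintype.card (I × J))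
include hρ

theorem map_fst_measureReal_singleton_of_uniform [Nonempty J] (x : I) :
    (ρ.map measurable_fst).base.1.real {x} = m / Fintype.card I := by
  classical
  have hfib : ({p | p.1 = x} : Finset (I × J)) = {x} ×ˢ Finset.univ := by
    ext ⟨y, z⟩
    simp [eq_comm]
  rw [map_measureReal_singleton_of_uniform measurable_fst hρ, hfib, Finset.card_product,
    Finset.card_singleton, Finset.card_univ, one_mul, Fintype.card_prod, Nat.cast_mul]
  field_simp

theorem map_snd_measureReal_singleton_of_uniform [Nonempty I] (y : J) :
    (ρ.map measurable_snd).base.1.real {y} = m / Fintype.card J := by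
  classical
  have hfib : ({p | p.2 = y} : Finset (I × J)) = Finset.univ ×ˢ {y} := by
    ext ⟨x, z⟩
    simp [eq_comm]
  rw [map_measureReal_singleton_of_uniform measurable_snd hρ, hfib, Finset.card_product,
    Finset.card_singleton, Finset.card_univ, mul_one, Fintype.card_prod, Nat.cast_mul]
  field_simp

end Product

/-- The uniform measure on a product space projects to the uniform measures on both factors, so
the coefficients on these agree. -/
theorem exists_hasUniformCoeff (hΘ : IsFinitelyCongruentFamily Θ) (hm : m ∈ s.masses) :
    ∃ c, HasUniformCoeff Θ m c := by
  have hm0 := Setting.pos_of_mem_masses hm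
  let J := ULift.{u} (Fin (n + 1))
  let _ : MeasurableSpace J := ⊤
  have : DiscreteMeasurableSpace J := ⟨fun _ => trivial⟩
  obtain ⟨ν₀, hν₀⟩ := Point.exists_uniform hm J
  obtain ⟨c, hc : HasCoeffAt (Θ J) c ν₀⟩ :=
    exists_evalSimple_eq_of_uniform hΘ (by positivity) hν₀
  refine ⟨c, fun I _ _ _ _ ν hν => ?_⟩
  obtain ⟨ρ, hρ⟩ := Point.exists_uniform hm (I × J)
  obtain ⟨d, hd : HasCoeffAt (Θ (I × J)) d ρ⟩ :=
    exists_evalSimple_eq_of_uniform hΘ (by positivity) hρ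
  have hfst : ρ.map measurable_fst = ν := Point.ext_singleton fun x =>
    (map_fst_measureReal_singleton_of_uniform hρ x).trans (hν x).symm
  have hsnd : ρ.map measurable_snd = ν₀ := Point.ext_singleton fun y =>
    (map_snd_measureReal_singleton_of_uniform hρ y).trans (hν₀ y).symm
  obtain rfl : d = c := HasCoeffAt.eq_of_uniform
    (hsnd ▸ hd.map hΘ measurable_snd Prod.snd_surjective) hc (by positivity) hν₀ (by simp [J])
  exact hfst ▸ hd.map hΘ measurable_fst Prod.fst_surjective

theorem HasUniformCoeff.exists_hasCoeffAt_of_natWeights {c : ArgPartition (Fin n) → ℝ}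
    (hc : HasUniformCoeff Θ m c) (hΘ : IsFinitelyCongruentFamily Θ) (hm : m ∈ s.masses)
    {I : Type u} [Fintype I] [Nonempty I] [MeasurableSpace I] [DiscreteMeasurableSpace I]
    (a : I → ℕ) (ha : ∀ x, 0 < a x) :
    ∃ ν : Point s I, (∀ x, ν.base.1.real {x} = m / (∑ y, (a y : ℝ)) * a x) ∧
      HasCoeffAt (Θ I) c ν := by
  classical
  let J := Σ x : I, Fin (a x)
  let _ : MeasurableSpace J := ⊤
  have : DiscreteMeasurableSpace J := ⟨fun _ => trivial⟩
  have hs : Function.Surjective (Sigma.fst : J → I) := fun x => ⟨⟨x, ⟨0, ha x⟩⟩, rfl⟩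
  have : Nonempty J := hs.nonempty
  obtain ⟨ρ, hρ⟩ := Point.exists_uniform hm J
  have hfst : Measurable (Sigma.fst : J → I) := Measurable.of_discrete
  refine ⟨ρ.map hfst, fun x => ?_, (hc J ρ hρ).map hΘ hfst hs⟩
  have hfib : ({p : J | p.1 = x} : Finset J) = Finset.univ.map (Function.Embedding.sigmaMk x) := by
    ext ⟨y, i⟩
    simp only [Finset.mem_filter_univ, Finset.mem_map, Finset.mem_univ, true_and]
    exact ⟨by rintro rfl; exact ⟨i, rfl⟩, fun ⟨_, h⟩ => (congrArg Sigma.fst h).symm⟩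
  rw [map_measureReal_singleton_of_uniform hfst hρ, hfib, Finset.card_map, Finset.card_univ,
    Fintype.card_fin, Fintype.card_sigma, mul_comm]
  simp only [Fintype.card_fin, Nat.cast_sum]

end UniformCoefficients

section Approximation

theorem tendsto_natFloor_mul_add_one_div {x : ℝ} (hx : 0 ≤ x) :
    Filter.Tendsto (fun k : ℕ => ((⌊x * k⌋₊ + 1 : ℕ) : ℝ) / k) Filter.atTop (𝓝 x) := by
  have hfloor := (tendsto_nat_floor_mul_div_atTop hx).comp (tendsto_natCast_atTop_atTop (R := ℝ))
  have h := hfloor.add (tendsto_one_div_atTop_nhds_zero_nat (𝕜 := ℝ))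
  rw [add_zero] at h
  refine h.congr fun k => ?_
  rw [Function.comp_apply, Nat.cast_add, Nat.cast_one, add_div]

theorem tendsto_sum_div_sum_natFloor_mul {I : Type*} [Fintype I] {w : I → ℝ} (hw : ∀ x, 0 ≤ w x)
    (hsum : ∑ x, w x ≠ 0) (x : I) :
    Filter.Tendsto (fun k : ℕ => (∑ y, w y) / (∑ y, ((⌊w y * k⌋₊ + 1 : ℕ) : ℝ)) *
      ((⌊w x * k⌋₊ + 1 : ℕ) : ℝ)) Filter.atTop (𝓝 (w x)) := by
  have hlim := fun y => tendsto_natFloor_mul_add_one_div (hw y)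
  have h := ((tendsto_const_nhds (x := ∑ y, w y)).div
    (tendsto_finsetSum Finset.univ fun y _ => hlim y) hsum).mul (hlim x)
  rw [div_self hsum, one_mul] at h
  refine h.congr' ?_
  filter_upwards [Filter.eventually_gt_atTop 0] with k hk
  have hk' : (k : ℝ) ≠ 0 := by positivity
  simp only [Pi.div_apply, ← Finset.sum_div]
  rw [div_div_eq_mul_div, div_mul_div_comm, mul_right_comm, mul_div_mul_right _ _ hk',
    div_mul_eq_mul_div]

variable {s : Setting} {r : Exponent} {n : ℕ}

theorem tendsto_evalSimple {Ω : Type u} [MeasurableSpace Ω] (Ψ : TensorField s r n Ω) {ι : Type*}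
    {l : Filter ι} {ν : ι → Point s Ω} {ν₀ : Point s Ω}
    (h : Filter.Tendsto (fun k => rootPow r (ν k).base) l (𝓝 (rootPow r ν₀.base)))
    (f : Fin n → SimpleFunc Ω ℝ) :
    Filter.Tendsto (fun k => evalSimple Ψ (ν k) f) l (𝓝 (evalSimple Ψ ν₀ f)) :=
  tendsto_of_continuous_powTopology (Ψ.continuous_form fun i => simpleField s r (f i)) h

variable {I : Type u} [Finite I] [MeasurableSpace I]

theorem tendsto_momentProd_of_finite [MeasurableSingletonClass I] {ι : Type*} {l : Filter ι}
    {ν : ι → FinMeas I} {ν₀ : FinMeas I}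
    (h : ∀ x, Filter.Tendsto (fun k => (ν k).1.real {x}) l (𝓝 (ν₀.1.real {x})))
    (R : ArgPartition (Fin n)) (f : Fin n → I → ℝ) :
    Filter.Tendsto (fun k => momentProd (ν k).1 R f) l (𝓝 (momentProd ν₀.1 R f)) := by
  cases nonempty_fintype I
  simp only [momentProd, integral_eq_sum_measureReal_mul]
  exact tendsto_finsetProd _ fun B _ => tendsto_finsetSum _ fun x _ => (h x).mul_const _

variable [DiscreteMeasurableSpace I]

theorem rootPow_eq_densityPow_count (r : Exponent) (ν : FinMeas I) :
    rootPow r ν = densityPow r ⟨Measure.count, inferInstance⟩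
      (simpleLp r _ (simpleOfFinite fun x => ν.1.real {x} ^ (r : ℝ))) := by
  have hdensity : ν.1 = Measure.count.withDensity fun x => ν.1 {x} := by
    refine Measure.ext_of_singleton fun x => ?_
    rw [withDensity_apply _ (measurableSet_singleton x), lintegral_singleton,
      Measure.count_singleton, mul_one]
  refine rootPow_eq_of_ae_eq r ?_ ((coeFn_simpleLp r _ _).trans ?_)
  · rw [FinMeas.le_def, hdensity]
    exact withDensity_absolutelyContinuous _ _
  · have hrn := Measure.rnDeriv_withDensity (Measure.count : Measure I)
      (Measurable.of_discrete (f := fun x => ν.1 {x}))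
    rw [← hdensity] at hrn
    filter_upwards [hrn] with x hx
    rw [hx, coe_simpleOfFinite, Measure.real]

theorem tendsto_rootPow_of_finite (r : Exponent) {ι : Type*} {l : Filter ι} {ν : ι → FinMeas I}
    {ν₀ : FinMeas I}
    (h : ∀ x, Filter.Tendsto (fun k => (ν k).1.real {x}) l (𝓝 (ν₀.1.real {x}))) :
    Filter.Tendsto (fun k => rootPow r (ν k)) l (𝓝 (rootPow r ν₀)) := by
  simp only [rootPow_eq_densityPow_count]
  let L : (I → ℝ) →ₗ[ℝ] RootMeas r I :=
    densityPow r _ ∘ₗ simpleLp r ⟨Measure.count, inferInstance⟩ ∘ₗ simpleOfFinite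
  have hL : Continuous L := L.continuous_of_finiteDimensional
  exact (hL.tendsto _).comp (tendsto_pi_nhds.2 fun x => (h x).rpow_const (Or.inr r.2.1.le))

theorem HasCoeffAt.of_tendsto {Ψ : TensorField s r n I} {c : ArgPartition (Fin n) → ℝ}
    {ι : Type*} {l : Filter ι} [l.NeBot] {ν : ι → Point s I} {ν₀ : Point s I}
    (hc : ∀ k, HasCoeffAt Ψ c (ν k))
    (h : ∀ x, Filter.Tendsto (fun k => (ν k).base.1.real {x}) l (𝓝 (ν₀.base.1.real {x}))) :
    HasCoeffAt Ψ c ν₀ := fun f =>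
  tendsto_nhds_unique
    ((tendsto_evalSimple Ψ (tendsto_rootPow_of_finite r h) f).congr fun k => hc k f)
    (tendsto_finsetSum _ fun R _ => (tendsto_momentProd_of_finite h R _).const_mul _)

theorem HasUniformCoeff.hasCoeffAt {Θ : TensorFamily.{u} s r n} {m : ℝ}
    {c : ArgPartition (Fin n) → ℝ} (hc : HasUniformCoeff Θ m c)
    (hΘ : IsFinitelyCongruentFamily Θ) (hm : m ∈ s.masses) (ν : Point s I)
    (hν : ν.base.mass = m) : HasCoeffAt (Θ I) c ν := by
  cases nonempty_fintype I
  have hsum : ∑ x, ν.base.1.real {x} = m := by rw [← FinMeas.mass_eq_sum, hν]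
  have hsum0 : ∑ x, ν.base.1.real {x} ≠ 0 := hsum.trans_ne (Setting.pos_of_mem_masses hm).ne'
  have : Nonempty I := (Finset.nonempty_of_sum_ne_zero hsum0).to_type
  choose ρ hρ hcρ using fun k : ℕ => hc.exists_hasCoeffAt_of_natWeights hΘ hm
    (fun x => ⌊ν.base.1.real {x} * k⌋₊ + 1) fun _ => Nat.succ_pos _
  refine HasCoeffAt.of_tendsto (l := Filter.atTop) hcρ fun x => ?_
  have hlim := tendsto_sum_div_sum_natFloor_mul (fun x => measureReal_nonneg) hsum0 x
  rw [hsum] at hlim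
  exact hlim.congr fun k => (hρ k x).symm

end Approximation

section Coefficients

theorem exists_finite_factorization {Ω : Type u} [MeasurableSpace Ω] {ι : Type*} [Finite ι]
    (f : ι → SimpleFunc Ω ℝ) :
    ∃ (I : Type u) (_ : Finite I) (_ : MeasurableSpace I) (_ : DiscreteMeasurableSpace I)
      (κ : Ω → I) (hκ : Measurable κ) (g : ι → SimpleFunc I ℝ),
      Function.Surjective κ ∧ ∀ i, (g i).comp κ hκ = f i := by
  let F : Ω → ι → ℝ := fun x i => f i x
  have hF : Measurable F := measurable_pi_iff.2 fun i => (f i).measurable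
  have hfin : (Set.range F).Finite := (Set.Finite.pi' fun i => (f i).finite_range).subset <| by
    rintro _ ⟨x, rfl⟩ i
    exact mem_range_self x
  have := hfin.to_subtype
  let I := Quotient (Setoid.ker F)
  have hI : Finite I := Finite.of_equiv _ (Setoid.quotientKerEquivRange F).symm
  let _ : MeasurableSpace I := ⊤
  have hdisc : DiscreteMeasurableSpace I := ⟨fun _ => trivial⟩
  let κ : Ω → I := Quotient.mk _
  have hκ : Measurable κ := fun A _ => by
    have hpre : κ ⁻¹' A = F ⁻¹' (F '' (κ ⁻¹' A)) := by
      refine Set.Subset.antisymm (Set.subset_preimage_image _ _) ?_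
      rintro x ⟨y, hy, hxy⟩
      have hκxy : κ y = κ x := Quotient.sound hxy
      rwa [mem_preimage, ← hκxy]
    rw [hpre]
    exact hF (hfin.subset (Set.image_subset_range _ _)).measurableSet
  refine ⟨I, hI, _, hdisc, κ, hκ, fun i => SimpleFunc.ofFinite
    (Quotient.lift (fun x => f i x) fun x y h => congrFun h i), Quotient.mk_surjective,
    fun i => ?_⟩
  ext x
  rfl

variable {s : Setting} {r : Exponent} {n : ℕ} {Θ : TensorFamily.{u} s r n} {m : ℝ}

/-- The family has coefficients `c` at all measures of mass `m`. -/
def HasCoeff (Θ : TensorFamily.{u} s r n) (m : ℝ) (c : ArgPartition (Fin n) → ℝ) : Prop :=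
  ∀ (Ω : Type u) [MeasurableSpace Ω] (ν : Point s Ω), ν.base.mass = m → HasCoeffAt (Θ Ω) c ν

theorem exists_hasCoeff (hΘ : IsFinitelyCongruentFamily Θ) (hm : m ∈ s.masses) :
    ∃ c, HasCoeff Θ m c := by
  obtain ⟨c, hc⟩ := exists_hasUniformCoeff hΘ hm
  refine ⟨c, fun Ω _ ν hν f => ?_⟩
  obtain ⟨I, _, _, _, κ, hκ, g, hs, hg⟩ := exists_finite_factorization f
  have h := hc.hasCoeffAt hΘ hm (ν.map hκ) ((ν.mass_map hκ).trans hν) g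
  rw [evalSimple_map hΘ hκ hs] at h
  simp only [Point.map, momentProd_map hκ, hg] at h
  exact h

end Coefficients

/-! ### Vanishing for large blocks and continuity of the coefficients -/

section Spike

variable {s : Setting} {r : Exponent} {n : ℕ} {Ω : Type u} [MeasurableSpace Ω]

/-- Scaling the entries with index in `p` by `ν(A)^{-a}`, where `1 / |p| < a < r`, gives continuous
vector fields, so that `ν(A)^{-a |p|}` times the form tends to `0`. -/
theorem tendsto_inv_mul_evalSimple (Ψ : TensorField s r n Ω) {ι : Type*} {l : Filter ι}
    {ν : ι → Point s Ω} {ν₀ : Point s Ω}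
    (h : Filter.Tendsto (fun k => rootPow r (ν k).base) l (𝓝 (rootPow r ν₀.base))) {A : Set Ω}
    (hA : MeasurableSet A) (hνA : ν₀.base.1.real A = 0) {p : Finset (Fin n)}
    (hp : 1 / (r : ℝ) < p.card) {f : Fin n → SimpleFunc Ω ℝ}
    (hf : ∀ i ∈ p, f i = SimpleFunc.restrict 1 A) :
    Filter.Tendsto (fun k => ((ν k).base.1.real A)⁻¹ * evalSimple Ψ (ν k) f) l (𝓝 0) := by
  classical
  have hp0 : (0 : ℝ) < p.card := (one_div_pos.2 r.2.1).trans hp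
  obtain ⟨a, hpa, har⟩ := exists_between ((one_div_lt r.2.1 hp0).1 hp)
  have ha0 : 0 < a := (one_div_pos.2 hp0).trans hpa
  have hap : 0 < a * p.card - 1 := sub_pos.2 ((div_lt_iff₀ hp0).1 hpa)
  let X : Fin n → VectorField s r Ω := fun i =>
    if i ∈ p then spikeField s r hA ha0 har else simpleField s r (f i)
  have hX : ∀ (ν : Point s Ω) (i : Fin n), (X i).val ν =
      (if i ∈ p then ν.base.1.real A ^ (-a) else 1) •
        tangentProj s r ν (simpleLp r ν.base (f i)) := fun ν i => by
    simp only [X]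
    split_ifs with hi
    · rw [hf i hi]
      rfl
    · rw [one_smul]
      rfl
  have hform : ∀ ν : Point s Ω, Ψ.form ν (fun i => (X i).val ν) =
      (ν.base.1.real A ^ (-a)) ^ p.card * evalSimple Ψ ν f := fun ν => by
    simp only [hX]
    rw [MultilinearMap.map_smul_univ, Finset.prod_ite_mem, Finset.univ_inter, Finset.prod_const,
      smul_eq_mul, evalSimple_apply]
  have hlim := tendsto_of_continuous_powTopology (Ψ.continuous_form X) h
  have hA0 := (tendsto_measureReal_of_tendsto_rootPow h hA).rpow_const
    (p := a * p.card - 1) (Or.inr hap.le)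
  have hprod := hA0.mul hlim
  rw [hνA, Real.zero_rpow hap.ne', zero_mul] at hprod
  refine hprod.congr fun k => ?_
  rw [hform, ← mul_assoc]
  congr 1
  rcases (measureReal_nonneg : 0 ≤ (ν k).base.1.real A).eq_or_lt with h0 | h0
  · rw [← h0, Real.zero_rpow hap.ne', zero_mul, inv_zero]
  · rw [← Real.rpow_natCast, ← Real.rpow_mul h0.le, ← Real.rpow_add h0, ← Real.rpow_neg_one]
    ring_nf

end Spike

section SpikeMeasures

theorem momentProd_single_of_spike {I : Type u} [Finite I] [MeasurableSpace I]
    [MeasurableSingletonClass I] {μ : Measure I} [IsFiniteMeasure μ] [DecidableEq I]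
    {ι : Type*} [Fintype ι] [DecidableEq ι] [DecidableLE (ArgPartition ι)] {x₀ : I} {ε δ : ℝ}
    (hε : μ.real {x₀} = ε) (hδ : ∀ x ≠ x₀, μ.real {x} = δ) {p : Finset ι} {j : ι → I}
    (hj : ∀ i, j i = x₀ ↔ i ∈ p) (R : ArgPartition ι) :
    momentProd μ R (fun i => Pi.single (j i) 1) = if R ≤ kerPartition j then
      ε ^ (R.parts.filter (· ⊆ p)).card * δ ^ (R.parts.filter (¬ · ⊆ p)).card else 0 := by
  classical
  cases nonempty_fintype I
  simp only [momentProd, integral_eq_sum_measureReal_mul]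
  split_ifs with hR
  · rw [← Finset.prod_const, ← Finset.prod_const, ← Finset.prod_ite]
    refine Finset.prod_congr rfl fun B hB => ?_
    have hjB := le_kerPartition_iff.1 hR B hB
    obtain ⟨i, hi⟩ := R.nonempty_of_mem_parts hB
    have hBp : B ⊆ p ↔ j i = x₀ := ⟨fun h => (hj i).2 (h hi), fun h k hk =>
      (hj k).1 ((hjB k hk i hi).trans h)⟩
    rw [sum_mul_prod_single hi, if_pos hjB]
    simp only [hBp]
    split_ifs with hx
    · rw [hx, hε]
    · exact hδ _ hx
  · rw [le_kerPartition_iff] at hR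
    push Not at hR
    obtain ⟨B, hB, hjB⟩ := hR
    obtain ⟨i, hi⟩ := R.nonempty_of_mem_parts hB
    refine Finset.prod_eq_zero hB ?_
    rw [sum_mul_prod_single hi, if_neg (by push Not; exact hjB)]

theorem HasCoeffAt.inv_mul_evalSimple_of_spike {I : Type u} [Finite I] [MeasurableSpace I]
    [MeasurableSingletonClass I] [DecidableEq I] {s : Setting} {r : Exponent} {n : ℕ}
    {Ψ : TensorField s r n I} {c : ArgPartition (Fin n) → ℝ} {ν : Point s I}
    (hc : HasCoeffAt Ψ c ν) [DecidableLE (ArgPartition (Fin n))] {x₀ : I} {ε δ : ℝ}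
    (hε0 : ε ≠ 0) (hε : ν.base.1.real {x₀} = ε) (hδ : ∀ x ≠ x₀, ν.base.1.real {x} = δ)
    {p : Finset (Fin n)} {j : Fin n → I} (hj : ∀ i, j i = x₀ ↔ i ∈ p)
    (hp : p ∈ (kerPartition j).parts) :
    ε⁻¹ * evalSimple Ψ ν (fun i => simpleOfFinite (Pi.single (j i) 1)) =
      ∑ R with R ≤ kerPartition j, c R * (ε ^ ((R.parts.filter (· ⊆ p)).card - 1) *
        δ ^ (R.parts.filter (¬ · ⊆ p)).card) := by
  rw [hc, Finset.mul_sum, Finset.sum_filter]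
  simp only [coe_simpleOfFinite, momentProd_single_of_spike hε hδ hj]
  refine Finset.sum_congr rfl fun R _ => ?_
  split_ifs with hR
  · rw [← pow_sub_one_mul (card_filter_subset_pos hR hp).ne' ε]
    field_simp
  · rw [mul_zero, mul_zero]

theorem Point.exists_spike {s : Setting} {m : ℝ} (hm : m ∈ s.masses) {J : Type u} [Fintype J]
    [Nonempty J] [MeasurableSpace (Option J)] [MeasurableSingletonClass (Option J)] {ε : ℝ}
    (hε : 0 ≤ ε) (hεm : ε ≤ m) : ∃ ν : Point s (Option J), ν.base.mass = m ∧
      ν.base.1.real {none} = ε ∧ ∀ y, ν.base.1.real {some y} = (m - ε) / Fintype.card J := by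
  have hsum : ∑ x : Option J, x.elim ε (fun _ => (m - ε) / Fintype.card J) = m := by
    rw [Fintype.sum_option]
    simp only [Option.elim, Finset.sum_const, Finset.card_univ, nsmul_eq_mul]
    field_simp
    ring
  obtain ⟨ν, hν⟩ := Point.exists_measureReal_singleton_eq (s := s)
    (fun x : Option J => x.elim ε fun _ => (m - ε) / Fintype.card J) (fun x => by
      cases x with
      | none => exact hε
      | some y => exact div_nonneg (sub_nonneg.2 hεm) (Nat.cast_nonneg _)) (hsum.symm ▸ hm)
  refine ⟨ν, ?_, hν none, fun y => hν (some y)⟩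
  rw [FinMeas.mass_eq_sum, ← hsum]
  exact Finset.sum_congr rfl fun x _ => hν x

theorem Point.exists_tendsto_spike (r : Exponent) {s : Setting} {m : ℝ} (hm : m ∈ s.masses)
    (J : Type u) [Fintype J] [Nonempty J] [MeasurableSpace (Option J)]
    [MeasurableSingletonClass (Option J)] :
    ∃ (ε : ℕ → ℝ) (ν : ℕ → Point s (Option J)) (ν₀ : Point s (Option J)),
      (∀ k, 0 < ε k) ∧ Filter.Tendsto ε Filter.atTop (𝓝 0) ∧ (∀ k, (ν k).base.mass = m) ∧
      (∀ k, (ν k).base.1.real {none} = ε k) ∧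
      (∀ k y, (ν k).base.1.real {some y} = (m - ε k) / Fintype.card J) ∧
      ν₀.base.1.real {none} = 0 ∧
      Filter.Tendsto (fun k => rootPow r (ν k).base) Filter.atTop (𝓝 (rootPow r ν₀.base)) := by
  have hm0 := Setting.pos_of_mem_masses hm
  obtain ⟨ε, -, hε, hεlim⟩ := exists_seq_strictAnti_tendsto' hm0
  choose ν hmass hνnone hνsome using fun k =>
    Point.exists_spike (J := J) hm (hε k).1.le (hε k).2.le
  obtain ⟨ν₀, -, hν₀none, hν₀some⟩ := Point.exists_spike (J := J) hm le_rfl hm0.le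
  refine ⟨ε, ν, ν₀, fun k => (hε k).1, hεlim, hmass, hνnone, hνsome, hν₀none,
    tendsto_rootPow_of_finite r fun x => ?_⟩
  cases x with
  | none => simpa only [hνnone, hν₀none] using hεlim
  | some y =>
    simp only [hνsome, hν₀some]
    exact (tendsto_const_nhds.sub hεlim).div_const _

end SpikeMeasures

section LargeBlocks

variable {s : Setting} {r : Exponent} {n : ℕ} {Θ : TensorFamily.{u} s r n}

/-- As `ε` tends to `0`, only the partitions with block `p` contribute to `ε⁻¹ Θ(1_{j 1}, …)` at the
measure with mass `ε` at the point which `j` assigns to `p`. -/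
theorem HasCoeff.sum_le_eq_zero_of_large_block {m : ℝ} (hm : m ∈ s.masses)
    {c : ArgPartition (Fin n) → ℝ} (hc : HasCoeff Θ m c) {p : Finset (Fin n)}
    (hp : 1 / (r : ℝ) < p.card) [DecidableLE (ArgPartition (Fin n))] {Q : ArgPartition (Fin n)}
    (hQ : p ∈ Q.parts) :
    ∑ R with R ≤ Q, (if p ∈ R.parts then
      c R * (m / n) ^ (R.parts.filter (¬ · ⊆ p)).card else 0) = 0 := by
  classical
  obtain ⟨i₀, -⟩ := Q.nonempty_of_mem_parts hQ
  let J := ULift.{u} (Fin n)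
  have : Nonempty J := ⟨⟨i₀⟩⟩
  have hJ : Fintype.card J = n := by simp [J]
  let _ : MeasurableSpace (Option J) := ⊤
  have : DiscreteMeasurableSpace (Option J) := ⟨fun _ => trivial⟩
  obtain ⟨j, rfl, hj⟩ := exists_kerPartition_eq_and_apply_eq_iff_mem (I := Option J)
    (by simpa [hJ] using (Q.card_parts_le_card.trans_eq (by simp)).trans n.le_succ) hQ none
  obtain ⟨ε, ν, ν₀, hε, hεlim, hmass, hνnone, hνsome, hν₀, hlim⟩ :=
    Point.exists_tendsto_spike r hm J
  rw [hJ] at hνsome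
  have hzero := tendsto_inv_mul_evalSimple (Θ (Option J)) hlim (measurableSet_singleton none)
    hν₀ hp (f := fun i => simpleOfFinite (Pi.single (j i) 1)) fun i hi => by
      ext x
      rw [SimpleFunc.coe_restrict _ (measurableSet_singleton none), coe_simpleOfFinite,
        (hj i).2 hi]
      simp [Set.indicator, Pi.single_apply]
  simp only [hνnone] at hzero
  have hsum : Filter.Tendsto (fun k => ∑ R with R ≤ kerPartition j,
      c R * (ε k ^ ((R.parts.filter (· ⊆ p)).card - 1) *
        ((m - ε k) / n) ^ (R.parts.filter (¬ · ⊆ p)).card)) Filter.atTop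
      (𝓝 (∑ R with R ≤ kerPartition j, c R * (0 ^ ((R.parts.filter (· ⊆ p)).card - 1) *
        ((m - 0) / n) ^ (R.parts.filter (¬ · ⊆ p)).card))) :=
    tendsto_finsetSum _ fun R _ => ((hεlim.pow _).mul
      (((tendsto_const_nhds.sub hεlim).div_const _).pow _)).const_mul _
  have hlim0 := tendsto_nhds_unique hsum <| hzero.congr fun k =>
    (hc _ (ν k) (hmass k)).inv_mul_evalSimple_of_spike (hε k).ne' (hνnone k)
      (fun x hx => by
        obtain ⟨y, rfl⟩ := Option.ne_none_iff_exists'.1 hx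
        exact hνsome k y) hj hQ
  refine (Finset.sum_congr rfl fun R hR => ?_).trans hlim0
  have hRQ := (Finset.mem_filter.1 hR).2
  have hpos := card_filter_subset_pos hRQ hQ
  have hcard : (R.parts.filter (· ⊆ p)).card - 1 = 0 ↔ p ∈ R.parts := by
    rw [← card_filter_subset_eq_one_iff hRQ hQ]
    omega
  rw [sub_zero, zero_pow_eq, if_congr hcard rfl rfl, ite_mul, one_mul, zero_mul, mul_ite, mul_zero]

theorem HasCoeff.eq_zero_of_large_block {m : ℝ} (hm : m ∈ s.masses)
    {c : ArgPartition (Fin n) → ℝ} (hc : HasCoeff Θ m c) {p : Finset (Fin n)}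
    (hp : 1 / (r : ℝ) < p.card) {R : ArgPartition (Fin n)} (hR : p ∈ R.parts) : c R = 0 := by
  classical
  have hzero := congrFun (eq_zero_of_sum_le_eq_zero (fun R : ArgPartition (Fin n) =>
    if p ∈ R.parts then c R * (m / n) ^ (R.parts.filter (¬ · ⊆ p)).card else 0) fun Q hQ =>
      hc.sum_le_eq_zero_of_large_block hm hp (of_not_not fun h => hQ (if_neg h))) R
  rw [if_pos hR, Pi.zero_apply] at hzero
  obtain ⟨i, -⟩ := R.nonempty_of_mem_parts hR
  have hn : (0 : ℝ) < n := Nat.cast_pos.2 i.pos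
  have hm0 := Setting.pos_of_mem_masses hm
  exact (mul_eq_zero.1 hzero).resolve_right (by positivity)

end LargeBlocks

section Continuity

variable {s : Setting} {r : Exponent} {n : ℕ} {Θ : TensorFamily.{u} s r n}

theorem continuousOn_coeff {c : ℝ → ArgPartition (Fin n) → ℝ}
    (hc : ∀ m ∈ s.masses, HasCoeff Θ m (c m)) (R : ArgPartition (Fin n)) :
    ContinuousOn (fun m => c m R) s.masses := by
  classical
  let I := ULift.{u} (Fin (n + 1))
  let _ : MeasurableSpace I := ⊤
  have : DiscreteMeasurableSpace I := ⟨fun _ => trivial⟩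
  choose ν hν using fun m : s.masses => Point.exists_uniform m.2 I
  have hmass : ∀ m : s.masses, (ν m).base.mass = m := fun m => by
    rw [FinMeas.mass_eq_sum]
    simp only [hν, Finset.sum_const, Finset.card_univ, nsmul_eq_mul]
    field_simp
  have heval : ∀ (j : Fin n → I) (m : s.masses),
      evalSimple (Θ I) (ν m) (fun i => simpleOfFinite (Pi.single (j i) 1)) =
        ∑ R with R ≤ kerPartition j, c m R * (m / Fintype.card I : ℝ) ^ R.parts.card := by
    intro j m
    rw [hc m m.2 I (ν m) (hmass m), ← sum_mul_blockSum_single]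
    simp only [coe_simpleOfFinite, momentProd_uniform (hν m), mul_assoc]
    congr!
  have hcont : Continuous fun m : s.masses => c m R * (m / Fintype.card I : ℝ) ^ R.parts.card := by
    refine continuous_of_forall_continuous_sum_le (d := fun R (m : s.masses) =>
      c m R * (m / Fintype.card I : ℝ) ^ R.parts.card) (fun Q => ?_) R
    obtain ⟨j, rfl⟩ := exists_kerPartition_eq (I := I) Q
      (Q.card_parts_le_card.trans (by simp [I]))
    refine (continuous_iff_continuousAt.2 fun m => tendsto_evalSimple (Θ I)
      (tendsto_rootPow_of_finite r fun x => ?_) fun i =>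
        simpleOfFinite (Pi.single (j i) 1)).congr (heval j)
    simp only [hν]
    exact (continuous_subtype_val.tendsto m).div_const _
  rw [continuousOn_iff_continuous_domRestrict]
  have hne : ∀ m : s.masses, (m / Fintype.card I : ℝ) ^ R.parts.card ≠ 0 := fun m => by
    have := Setting.pos_of_mem_masses m.2
    positivity
  exact (hcont.div₀ ((continuous_subtype_val.div_const _).pow _) hne).congr fun m =>
    mul_div_cancel_right₀ _ (hne m)

end Continuity

/-! ### Integrals of products -/

section Products

theorem prod_abs_le_one_add_sum {ι : Type*} [Fintype ι] {p : ℝ} (hp : (Fintype.card ι : ℝ) ≤ p)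
    (x : ι → ℝ) : ∏ i, |x i| ≤ 1 + ∑ i, |x i| ^ p := by
  have hnonneg : ∀ i, 0 ≤ |x i| ^ p := fun i => Real.rpow_nonneg (abs_nonneg _) _
  by_cases h : ∀ i, |x i| ≤ 1
  · exact (Finset.prod_le_one (fun i _ => abs_nonneg _) fun i _ => h i).trans
      (le_add_of_nonneg_right (Finset.sum_nonneg fun i _ => hnonneg i))
  · push Not at h
    obtain ⟨i, hi⟩ := h
    obtain ⟨j, -, hj⟩ := Finset.exists_max_image Finset.univ (fun i => |x i|)
      ⟨i, Finset.mem_univ i⟩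
    have hj1 : 1 ≤ |x j| := hi.le.trans (hj i (Finset.mem_univ i))
    calc ∏ i, |x i| ≤ |x j| ^ (Fintype.card ι : ℝ) := by
          rw [Real.rpow_natCast, ← Finset.card_univ, ← Finset.prod_const]
          exact Finset.prod_le_prod (fun i _ => abs_nonneg _) hj
      _ ≤ |x j| ^ p := Real.rpow_le_rpow_of_exponent_le hj1 hp
      _ ≤ ∑ i, |x i| ^ p := Finset.single_le_sum (fun i _ => hnonneg i) (Finset.mem_univ j)
      _ ≤ 1 + ∑ i, |x i| ^ p := le_add_of_nonneg_left zero_le_one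

variable {Ω : Type u} [MeasurableSpace Ω]

theorem integrable_abs_rpow (r : Exponent) {μ : FinMeas Ω} (φ : Lp ℝ r.inv μ.1) :
    Integrable (fun x => |φ x| ^ (1 / (r : ℝ))) μ.1 := by
  simpa only [r.toReal_inv, Real.norm_eq_abs] using
    (Lp.memLp φ).integrable_norm_rpow r.inv_ne_zero r.inv_ne_top

theorem integral_abs_rpow (r : Exponent) {μ : FinMeas Ω} (φ : Lp ℝ r.inv μ.1) :
    ∫ x, |φ x| ^ (1 / (r : ℝ)) ∂μ.1 = ‖φ‖ ^ (1 / (r : ℝ)) := by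
  have hr := r.2.1
  have hnonneg : 0 ≤ ∫ x, |φ x| ^ (1 / (r : ℝ)) ∂μ.1 :=
    integral_nonneg fun x => Real.rpow_nonneg (abs_nonneg _) _
  rw [Lp.norm_def, (Lp.memLp φ).eLpNorm_eq_integral_rpow_norm r.inv_ne_zero r.inv_ne_top,
    r.toReal_inv, ENNReal.toReal_ofReal (by positivity)]
  simp only [Real.norm_eq_abs]
  rw [← Real.rpow_mul hnonneg, inv_mul_cancel₀ (by positivity), Real.rpow_one]

variable {ι : Type*} [Fintype ι]

theorem integrable_one_add_sum_abs_rpow (r : Exponent) {μ : FinMeas Ω}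
    (φ : ι → Lp ℝ r.inv μ.1) :
    Integrable (fun x => 1 + ∑ i, |φ i x| ^ (1 / (r : ℝ))) μ.1 :=
  (integrable_const 1).add (integrable_finsetSum _ fun i _ => integrable_abs_rpow r (φ i))

theorem integrable_prod_Lp (r : Exponent) (hι : (Fintype.card ι : ℝ) ≤ 1 / (r : ℝ))
    {μ : FinMeas Ω} (φ : ι → Lp ℝ r.inv μ.1) : Integrable (fun x => ∏ i, φ i x) μ.1 := by
  refine (integrable_one_add_sum_abs_rpow r φ).mono' (Finset.measurable_prod _ fun i _ =>
    (Lp.stronglyMeasurable (φ i)).measurable).aestronglyMeasurable (ae_of_all _ fun x => ?_)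
  rw [Real.norm_eq_abs, Finset.abs_prod]
  exact prod_abs_le_one_add_sum hι fun i => φ i x

theorem abs_integral_prod_le_of_norm_le_one (r : Exponent)
    (hι : (Fintype.card ι : ℝ) ≤ 1 / (r : ℝ)) {μ : FinMeas Ω} {φ : ι → Lp ℝ r.inv μ.1}
    (hφ : ∀ i, ‖φ i‖ ≤ 1) :
    |∫ x, ∏ i, φ i x ∂μ.1| ≤ μ.1.real univ + Fintype.card ι := by
  have hr := r.2.1
  calc |∫ x, ∏ i, φ i x ∂μ.1|
      ≤ ∫ x, (1 + ∑ i, |φ i x| ^ (1 / (r : ℝ))) ∂μ.1 := by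
        rw [← Real.norm_eq_abs]
        refine norm_integral_le_of_norm_le (integrable_one_add_sum_abs_rpow r φ)
          (ae_of_all _ fun x => ?_)
        rw [Real.norm_eq_abs, Finset.abs_prod]
        exact prod_abs_le_one_add_sum hι fun i => φ i x
    _ = μ.1.real univ + ∑ i, ‖φ i‖ ^ (1 / (r : ℝ)) := by
        rw [integral_add (integrable_const _)
          (integrable_finsetSum Finset.univ fun i _ => integrable_abs_rpow r (φ i)),
          integral_finsetSum _ fun i _ => integrable_abs_rpow r (φ i)]
        simp only [integral_abs_rpow, integral_const, smul_eq_mul, mul_one]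
    _ ≤ μ.1.real univ + ∑ _i : ι, 1 := by
        gcongr with i
        exact Real.rpow_le_one (norm_nonneg _) (hφ i) (by positivity)
    _ = μ.1.real univ + Fintype.card ι := by
        rw [Finset.sum_const, Finset.card_univ, nsmul_one]

theorem prod_update_coeFn [DecidableEq ι] {r : Exponent} {μ : FinMeas Ω}
    (φ : ι → Lp ℝ r.inv μ.1) (i : ι) (a : Lp ℝ r.inv μ.1) (x : Ω) :
    ∏ k, Function.update φ i a k x = a x * ∏ k ∈ Finset.univ.erase i, φ k x := by
  rw [← Finset.mul_prod_erase Finset.univ _ (Finset.mem_univ i), Function.update_self]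
  congr 1
  refine Finset.prod_congr rfl fun k hk => ?_
  rw [Function.update_of_ne (Finset.ne_of_mem_erase hk)]

/-- The form `(φ_i) ↦ ∫ ∏ φ_i dμ` on `L^{1/r}(μ)`, with at most `1/r` arguments. -/
def prodIntegral (r : Exponent) (hι : (Fintype.card ι : ℝ) ≤ 1 / (r : ℝ)) (μ : FinMeas Ω) :
    MultilinearMap ℝ (fun _ : ι => Lp ℝ r.inv μ.1) ℝ where
  toFun φ := ∫ x, ∏ i, φ i x ∂μ.1
  map_update_add' φ i a b := by
    rw [← integral_add (integrable_prod_Lp r hι _) (integrable_prod_Lp r hι _)]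
    refine integral_congr_ae ?_
    filter_upwards [Lp.coeFn_add a b] with x hx
    simp only [prod_update_coeFn, hx, Pi.add_apply, add_mul]
  map_update_smul' φ i c a := by
    rw [smul_eq_mul, ← integral_const_mul]
    refine integral_congr_ae ?_
    filter_upwards [Lp.coeFn_smul c a] with x hx
    simp only [prod_update_coeFn, hx, Pi.smul_apply, smul_eq_mul, mul_assoc]

theorem continuous_prodIntegral (r : Exponent) (hι : (Fintype.card ι : ℝ) ≤ 1 / (r : ℝ))
    (μ : FinMeas Ω) : Continuous (prodIntegral r hι μ) := by
  refine MultilinearMap.continuous_of_bound _ (μ.1.real univ + Fintype.card ι) fun φ => ?_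
  have hnormalize : φ = fun i => ‖φ i‖ • (‖φ i‖⁻¹ • φ i) := funext fun i => by
    by_cases h : φ i = 0
    · simp only [h, smul_zero]
    · rw [smul_smul, mul_inv_cancel₀ (norm_ne_zero_iff.2 h), one_smul]
  have hnorm_le : ∀ i, ‖‖φ i‖⁻¹ • φ i‖ ≤ 1 := fun i => by
    rw [norm_smul, norm_inv, norm_norm]
    exact inv_mul_le_one
  calc ‖prodIntegral r hι μ φ‖
      = ‖prodIntegral r hι μ fun i => ‖φ i‖⁻¹ • φ i‖ * ∏ i, ‖φ i‖ := by
        conv_lhs => rw [hnormalize]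
        rw [MultilinearMap.map_smul_univ, norm_smul, norm_prod, mul_comm]
        simp only [norm_norm]
    _ ≤ (μ.1.real univ + Fintype.card ι) * ∏ i, ‖φ i‖ :=
        mul_le_mul_of_nonneg_right (abs_integral_prod_le_of_norm_le_one r hι hnorm_le)
          (Finset.prod_nonneg fun i _ => norm_nonneg _)

theorem tendsto_integral_prod {r : Exponent} {μ : FinMeas Ω} {ι : Type*} {B : Finset ι}
    (hB : (B.card : ℝ) ≤ 1 / (r : ℝ)) {κ : Type*} {l : Filter κ}
    {χ : κ → ι → Lp ℝ r.inv μ.1} {φ : ι → Lp ℝ r.inv μ.1}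
    (h : ∀ i, Filter.Tendsto (fun k => χ k i) l (𝓝 (φ i))) :
    Filter.Tendsto (fun k => ∫ x, ∏ i ∈ B, χ k i x ∂μ.1) l (𝓝 (∫ x, ∏ i ∈ B, φ i x ∂μ.1)) := by
  rw [← Fintype.card_coe] at hB
  simp only [← Finset.prod_coe_sort B]
  exact ((continuous_prodIntegral r hB μ).tendsto _).comp (tendsto_pi_nhds.2 fun i : B => h i)

end Products

/-! ### Vector fields with prescribed value at a point -/

section Fields

variable {Ω : Type u} [MeasurableSpace Ω] {s : Setting} {r : Exponent}

theorem rootPow_injective : Function.Injective fun ν : Point s Ω => rootPow r ν.base := by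
  intro ν ν' h
  have h : rootPow r ν.base = rootPow r ν'.base := h
  have hreal : ∀ A, MeasurableSet A → ν.base.1.real A = ν'.base.1.real A := fun A hA =>
    tendsto_nhds_unique tendsto_const_nhds <| tendsto_measureReal_of_tendsto_rootPow
      (l := 𝓝 ()) (ν := fun _ : Unit => ν.base) (ν₀ := ν'.base)
      (by rw [h]; exact tendsto_const_nhds) hA
  obtain ⟨⟨ν, _⟩, _⟩ := ν
  obtain ⟨⟨ν', _⟩, _⟩ := ν'
  obtain rfl : ν = ν' := Measure.ext fun A hA =>
    (ENNReal.toReal_eq_toReal_iff' (measure_ne_top _ _) (measure_ne_top _ _)).1 (hreal A hA)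
  rfl

theorem abs_integral_le_norm (r : Exponent) {μ : FinMeas Ω} [IsProbabilityMeasure μ.1]
    (φ : Lp ℝ r.inv μ.1) : |∫ x, φ x ∂μ.1| ≤ ‖φ‖ :=
  calc |∫ x, φ x ∂μ.1| ≤ ∫ x, ‖φ x‖ ∂μ.1 :=
      (Real.norm_eq_abs _).symm.trans_le (norm_integral_le_integral_norm _)
    _ = (eLpNorm φ 1 μ.1).toReal := by
      rw [eLpNorm_one_eq_lintegral_enorm, integral_norm_eq_lintegral_enorm
        (Lp.aestronglyMeasurable φ)]
    _ ≤ (eLpNorm φ r.inv μ.1).toReal := ENNReal.toReal_mono (Lp.eLpNorm_ne_top φ)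
      (eLpNorm_le_eLpNorm_of_exponent_le r.one_le_inv (Lp.aestronglyMeasurable φ))
    _ = ‖φ‖ := (Lp.norm_def φ).symm

theorem continuous_tangentForm (μ : Point s Ω) : Continuous (tangentForm s r μ.base) := by
  cases s with
  | measures => exact continuous_const
  | probabilities =>
    have : IsProbabilityMeasure μ.base.1 := ⟨μ.admits⟩
    refine AddMonoidHomClass.continuous_of_bound (tangentForm .probabilities r μ.base) 1
      fun φ => ?_
    rw [one_mul]
    exact abs_integral_le_norm r φ

theorem continuous_tangentProj (μ : Point s Ω) : Continuous (tangentProj s r μ) :=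
  Continuous.subtype_mk
    (continuous_id.sub ((continuous_tangentForm μ).smul continuous_const)) _

theorem denseRange_simpleLp (r : Exponent) (μ : FinMeas Ω) : DenseRange (simpleLp r μ) := by
  intro φ
  refine Metric.mem_closure_range_iff.2 fun ε hε => ?_
  obtain ⟨g, hg, -⟩ := (Lp.memLp φ).exists_simpleFunc_eLpNorm_sub_lt r.inv_ne_top
    (ENNReal.ofReal_pos.2 hε).ne'
  have hsub : (φ - simpleLp r μ g : Lp ℝ r.inv μ.1) =ᵐ[μ.1] (φ : Ω → ℝ) - ⇑g :=
    (Lp.coeFn_sub _ _).trans (Filter.EventuallyEq.rfl.sub (coeFn_simpleLp r μ g))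
  refine ⟨g, ?_⟩
  rw [dist_eq_norm, Lp.norm_def, eLpNorm_congr_ae hsub]
  exact (ENNReal.lt_ofReal_iff_toReal_lt hg.ne_top).1 hg

theorem mem_closure_range_tangentProj (μ : Point s Ω) (φ : tangent s r μ.base) :
    φ ∈ closure (Set.range fun f : SimpleFunc Ω ℝ => tangentProj s r μ (simpleLp r μ.base f)) := by
  have h := image_closure_subset_closure_image (continuous_tangentProj μ)
    (mem_image_of_mem _ (denseRange_simpleLp r μ.base φ))
  rwa [tangentProj_coe, ← range_comp] at h

theorem continuous_rootPow_base :
    Continuous[powTopology s r Ω, inferInstance] fun μ : Point s Ω => rootPow r μ.base :=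
  continuous_induced_dom

/-- The product of a continuous function and a vector field. -/
def VectorField.smul {ρ : Point s Ω → ℝ} (hρ : Continuous[powTopology s r Ω, inferInstance] ρ)
    (Y : VectorField s r Ω) : VectorField s r Ω where
  val ν := ρ ν • Y.val ν
  continuous_val := by
    let := powTopology s r Ω
    simp only [Submodule.coe_smul, map_smul]
    exact hρ.smul Y.continuous_val

theorem VectorField.continuous_norm (Y : VectorField s r Ω) :
    Continuous[powTopology s r Ω, inferInstance] fun ν => ‖Y.val ν‖ := by
  let := powTopology s r Ω
  exact Y.continuous_val.norm.congr fun ν => norm_densityPow r ν.base _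

theorem VectorField.exists_bump (Y : VectorField s r Ω) (μ : Point s Ω) {C δ : ℝ} (hC : 0 < C)
    (hδ : 0 < δ) (hY : ‖Y.val μ‖ ≤ C) :
    ∃ ρ : Point s Ω → ℝ, Continuous[powTopology s r Ω, inferInstance] ρ ∧ ρ μ = 1 ∧
      (∀ ν, ‖ρ ν • Y.val ν‖ ≤ C) ∧
      ∀ ν, δ ≤ ‖rootPow r ν.base - rootPow r μ.base‖ → ρ ν = 0 := by
  let := powTopology s r Ω
  have hmax : ∀ ν, 0 < max C ‖Y.val ν‖ := fun ν => lt_max_of_lt_left hC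
  refine ⟨fun ν => max 0 (1 - ‖rootPow r ν.base - rootPow r μ.base‖ / δ) *
    (C / max C ‖Y.val ν‖), ?_, ?_, fun ν => ?_, fun ν hν => ?_⟩
  · exact (continuous_const.max (continuous_const.sub
      ((continuous_rootPow_base.sub continuous_const).norm.div_const δ))).mul
      (continuous_const.div (continuous_const.max Y.continuous_norm) fun ν => (hmax ν).ne')
  · beta_reduce
    rw [sub_self, norm_zero, zero_div, sub_zero, max_eq_right zero_le_one, max_eq_left hY,
      div_self hC.ne', one_mul]
  · have hcut : max 0 (1 - ‖rootPow r ν.base - rootPow r μ.base‖ / δ) ≤ 1 :=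
      max_le zero_le_one (sub_le_self _ (by positivity))
    rw [norm_smul, Real.norm_of_nonneg (by positivity [hmax ν])]
    calc max 0 (1 - ‖rootPow r ν.base - rootPow r μ.base‖ / δ) *
          (C / max C ‖Y.val ν‖) * ‖Y.val ν‖
        ≤ 1 * (C / max C ‖Y.val ν‖) * max C ‖Y.val ν‖ := by
          gcongr
          exact le_max_right _ _
      _ = C := by rw [one_mul, div_mul_cancel₀ _ (hmax ν).ne']
  · beta_reduce
    rw [max_eq_left (sub_nonpos.2 ((one_le_div hδ).2 hν)), zero_mul]

theorem continuous_densityPow_of_series {Z : ℕ → VectorField s r Ω} {b : ℕ → ℝ}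
    (hb : Summable b) (hZ : ∀ k ν, ‖(Z k).val ν‖ ≤ b k)
    {val : ∀ ν : Point s Ω, tangent s r ν.base}
    (hval : ∀ ν, Filter.Tendsto (fun N => ∑ k ∈ Finset.range N, (Z k).val ν) Filter.atTop
      (𝓝 (val ν))) :
    Continuous[powTopology s r Ω, inferInstance]
      fun ν => densityPow r ν.base (val ν : Lp ℝ r.inv ν.base.1) := by
  let := powTopology s r Ω
  have hunif : TendstoUniformly (fun N (ν : Point s Ω) =>
      ∑ k ∈ Finset.range N, densityPow r ν.base ((Z k).val ν : Lp ℝ r.inv ν.base.1))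
      (fun ν => densityPow r ν.base (val ν : Lp ℝ r.inv ν.base.1)) Filter.atTop := by
    refine Metric.tendstoUniformly_iff.2 fun ε hε => ?_
    filter_upwards [(tendsto_sum_nat_add b).eventually (gt_mem_nhds hε)] with N hN ν
    refine lt_of_le_of_lt ?_ hN
    simp only [← map_sum, ← Submodule.coe_sum]
    rw [dist_comm, dist_eq_norm, ← map_sub, norm_densityPow, ← Submodule.coe_sub,
      Submodule.norm_coe, ← dist_eq_norm]
    simp only [add_comm _ N]
    refine dist_le_tsum_of_dist_le_of_tendsto b (fun M => ?_) hb (hval ν) N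
    rw [Finset.sum_range_succ, dist_self_add_right]
    exact hZ M ν
  exact hunif.continuous (Filter.Frequently.of_forall fun N =>
    continuous_finsetSum _ fun k _ => (Z k).continuous_val)

/-- The fields `Y k` are cut off outside of neighbourhoods that shrink to `μ`, so that the series
is a finite sum at the other points. -/
theorem exists_field_of_series (μ : Point s Ω) {φ : tangent s r μ.base}
    {Y : ℕ → VectorField s r Ω} {b : ℕ → ℝ} (hb : Summable b) (hpos : ∀ k, 0 < b k)
    (hY : ∀ k, ‖(Y k).val μ‖ ≤ b k)
    (hφ : Filter.Tendsto (fun N => ∑ k ∈ Finset.range N, (Y k).val μ) Filter.atTop (𝓝 φ)) :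
    ∃ X : VectorField s r Ω, X.val μ = φ ∧ ∀ ν, ν ≠ μ → ∃ (N : ℕ) (ρ : ℕ → ℝ),
      X.val ν = ∑ k ∈ Finset.range N, ρ k • (Y k).val ν := by
  choose ρ hρ hρμ hρb hρ0 using fun k => (Y k).exists_bump μ (hpos k) (hpos k) (hY k)
  have hval : ∀ ν, ∃ x : tangent s r ν.base,
      Filter.Tendsto (fun N => ∑ k ∈ Finset.range N, ρ k ν • (Y k).val ν) Filter.atTop (𝓝 x) ∧
      (ν ≠ μ → ∃ (N : ℕ) (ρ : ℕ → ℝ), x = ∑ k ∈ Finset.range N, ρ k • (Y k).val ν) := by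
    intro ν
    by_cases hν : ν = μ
    · subst hν
      exact ⟨φ, by simpa only [hρμ, one_smul] using hφ, fun h => absurd rfl h⟩
    · have hdist : 0 < ‖rootPow r ν.base - rootPow r μ.base‖ :=
        norm_pos_iff.2 (sub_ne_zero.2 (rootPow_injective.ne hν))
      obtain ⟨N, hN⟩ := Filter.eventually_atTop.1
        (hb.tendsto_atTop_zero.eventually (gt_mem_nhds hdist))
      exact ⟨∑ k ∈ Finset.range N, ρ k ν • (Y k).val ν, tendsto_atTop_of_eventually_const
        (fun M (hM : N ≤ M) => Finset.eventually_constant_sum (fun k hk => by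
          rw [hρ0 k ν (hN k hk).le, zero_smul]) hM), fun _ => ⟨N, fun k => ρ k ν, rfl⟩⟩
  choose val htendsto hsum using hval
  refine ⟨⟨val, continuous_densityPow_of_series (Z := fun k => (Y k).smul (hρ k)) hb hρb
    htendsto⟩, ?_, hsum⟩
  have hμ := htendsto μ
  simp only [hρμ, one_smul] at hμ
  exact tendsto_nhds_unique hμ hφ

theorem coe_tangentProj_simpleLp (ν : Point s Ω) (f : SimpleFunc Ω ℝ) :
    (tangentProj s r ν (simpleLp r ν.base f) : Lp ℝ r.inv ν.base.1) =
      simpleLp r ν.base (f - tangentForm s r ν.base (simpleLp r ν.base f) • 1) := by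
  rw [coe_tangentProj, map_sub, map_smul, simpleLp_one]

theorem exists_field (μ : Point s Ω) (φ : tangent s r μ.base) :
    ∃ X : VectorField s r Ω, X.val μ = φ ∧ ∀ ν, ν ≠ μ → ∃ f : SimpleFunc Ω ℝ,
      (X.val ν : Lp ℝ r.inv ν.base.1) = simpleLp r ν.base f := by
  have hφ : φ ∈ closure ((tangentProj s r μ ∘ₗ simpleLp r μ.base).range.toAddSubgroup :
      Set (tangent s r μ.base)) := mem_closure_range_tangentProj μ φ
  obtain ⟨v, hv, hrange, -, hbound⟩ := controlled_sum_of_mem_closure hφ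
    (b := fun n => (1 / 2 : ℝ) ^ n) fun n => by positivity
  choose f hf using hrange
  have hfield : ∀ k, (simpleField s r (f k)).val μ = v k := hf
  obtain ⟨X, hXμ, hX⟩ := exists_field_of_series μ (Y := fun k => simpleField s r (f k))
    (summable_geometric_two.mul_left (‖v 0‖ + 1)) (fun k => by positivity) (fun k => by
      rw [hfield]
      rcases Nat.eq_zero_or_pos k with rfl | hk
      · rw [pow_zero, mul_one]
        exact (lt_add_one _).le
      · exact (hbound k hk).le.trans
          (le_mul_of_one_le_left (by positivity) (le_add_of_nonneg_left (norm_nonneg _))))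
    (φ := φ) (by
      simp only [hfield]
      exact (Filter.tendsto_add_atTop_iff_nat 1).1 hv)
  refine ⟨X, hXμ, fun ν hν => ?_⟩
  obtain ⟨N, ρ, hsum⟩ := hX ν hν
  have hval : X.val ν = tangentProj s r ν
      (simpleLp r ν.base (∑ k ∈ Finset.range N, ρ k • f k)) := by
    simp only [hsum, map_sum, map_smul]
    rfl
  exact ⟨_, hval ▸ coe_tangentProj_simpleLp ν _⟩

end Fields

/-! ### Perturbation by a simple density -/

section Perturbation

variable {Ω : Type u} [MeasurableSpace Ω] {s : Setting} {r : Exponent}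

theorem norm_simpleAct_sub_le (r : Exponent) {f : SimpleFunc Ω ℝ} {ε : ℝ}
    (hf : ∀ x, |f x - 1| ≤ ε) (x : RootMeas r Ω) : ‖simpleAct r f x - x‖ ≤ ε * ‖x‖ := by
  obtain ⟨μ, φ, rfl⟩ := exists_densityPow r x
  rw [simpleAct_densityPow, ← map_sub, norm_densityPow, norm_densityPow]
  refine Lp.norm_le_mul_norm_of_ae_le_mul ?_
  filter_upwards [Lp.coeFn_sub (simpleMul r f μ φ) φ, coeFn_simpleMul r f μ φ] with x hsub hmul
  rw [hsub, Pi.sub_apply, hmul, ← sub_one_mul, norm_mul, Real.norm_eq_abs]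
  exact mul_le_mul_of_nonneg_right (hf x) (norm_nonneg _)

theorem tendsto_simpleAct {κ : Type*} {l : Filter κ} {f : κ → SimpleFunc Ω ℝ}
    (hf : TendstoUniformly (fun k => ⇑(f k)) 1 l) {x : κ → RootMeas r Ω} {x₀ : RootMeas r Ω}
    (hx : Filter.Tendsto x l (𝓝 x₀)) :
    Filter.Tendsto (fun k => simpleAct r (f k) (x k)) l (𝓝 x₀) := by
  have hε : ∀ ε > 0, ∀ᶠ k in l, ‖simpleAct r (f k) (x k) - x k‖ ≤ ε * ‖x k‖ := fun ε hε => by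
    filter_upwards [Metric.tendstoUniformly_iff.1 hf ε hε] with k hk
    refine norm_simpleAct_sub_le r (fun y => ?_) (x k)
    rw [← Real.dist_eq, dist_comm]
    exact (hk y).le
  have hsub : (fun k => simpleAct r (f k) (x k) - x k) =o[l] fun _ => (1 : ℝ) :=
    (Asymptotics.isLittleO_iff.2 fun ε h => hε ε h).trans_isBigO (hx.isBigO_one ℝ)
  simpa only [sub_add_cancel, zero_add] using ((Asymptotics.isLittleO_one_iff ℝ).1 hsub).add hx

theorem tendstoUniformly_map_rpow {κ : Type*} {l : Filter κ} {g : κ → SimpleFunc Ω ℝ}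
    (hg : TendstoUniformly (fun k => ⇑(g k)) 1 l) (b : ℝ) :
    TendstoUniformly (fun k => ⇑((g k).map (· ^ b))) 1 l :=
  (tendsto_prod_top_iff (c := (1 : ℝ))).1 <| by
    have hpow := (tendsto_prod_top_iff (c := (1 : ℝ)).2 hg).rpow_const (p := b)
      (Or.inl one_ne_zero)
    rwa [Real.one_rpow] at hpow

theorem tendstoUniformly_one_add_smul (h : SimpleFunc Ω ℝ) :
    TendstoUniformly (fun (δ : ℝ) => ⇑(1 + δ • h)) 1 (𝓝 0) := by
  obtain ⟨C, hC⟩ := h.exists_forall_norm_le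
  have hmul : Filter.Tendsto (fun p : ℝ × Ω => p.1 * h p.2) (𝓝 0 ×ˢ ⊤) (𝓝 0) :=
    Filter.tendsto_fst.zero_mul_isBoundedUnder_le
      (Filter.isBoundedUnder_of ⟨C, fun p => hC p.2⟩)
  refine (tendsto_prod_top_iff (c := (1 : ℝ))).1 ?_
  have hadd := hmul.const_add 1
  rwa [add_zero] at hadd

/-- The measure `ν` has the strictly positive simple function `g` as a density with respect to
`μ`. -/
structure HasSimpleDensity (g : SimpleFunc Ω ℝ) (μ ν : FinMeas Ω) : Prop where
  pos : ∀ x, 0 < g x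
  eq_withDensity : ν.1 = μ.1.withDensity fun x => ENNReal.ofReal (g x)

namespace HasSimpleDensity

variable {μ ν : FinMeas Ω} {g : SimpleFunc Ω ℝ}

theorem rnDeriv_ae_eq (hν : HasSimpleDensity g μ ν) :
    (fun x => (ν.1.rnDeriv μ.1 x).toReal) =ᵐ[μ.1] g := by
  rw [hν.eq_withDensity]
  filter_upwards [Measure.rnDeriv_withDensity μ.1 g.measurable.ennreal_ofReal] with x hx
  rw [hx, ENNReal.toReal_ofReal (hν.pos x).le]

theorem le (hν : HasSimpleDensity g μ ν) : ν ≤ μ := by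
  rw [FinMeas.le_def, hν.eq_withDensity]
  exact withDensity_absolutelyContinuous _ _

theorem mass_pos (hν : HasSimpleDensity g μ ν) (hμ : 0 < μ.mass) : 0 < ν.mass := by
  have hle : μ.1 ≪ ν.1 := by
    rw [hν.eq_withDensity]
    exact withDensity_absolutelyContinuous' g.measurable.ennreal_ofReal.aemeasurable
      (ae_of_all _ fun x => (ENNReal.ofReal_pos.2 (hν.pos x)).ne')
  have hμ0 : μ.1 univ ≠ 0 := (measureReal_ne_zero_iff).1 hμ.ne'
  exact measureReal_nonneg.lt_of_ne' ((measureReal_ne_zero_iff).2 (mt (@hle univ) hμ0))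

theorem rootPow_eq (r : Exponent) (hν : HasSimpleDensity g μ ν) :
    rootPow r ν = simpleAct r (g.map (· ^ (r : ℝ))) (rootPow r μ) := by
  rw [simpleAct_rootPow]
  refine rootPow_eq_of_ae_eq r hν.le ((coeFn_simpleLp r μ _).trans ?_)
  filter_upwards [hν.rnDeriv_ae_eq] with x hx
  rw [hx, SimpleFunc.map_apply]

theorem exists_densityPow_eq (hν : HasSimpleDensity g μ ν) (b : ℝ) (ψ : Lp ℝ r.inv ν.1) :
    ∃ χ : Lp ℝ r.inv μ.1,
      densityPow r μ χ = simpleAct r (g.map (· ^ (b - r))) (densityPow r ν ψ) ∧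
      χ =ᵐ[μ.1] fun x => ψ x * g x ^ b := by
  refine ⟨simpleMul r (g.map (· ^ (b - r))) μ (rescale r hν.le ψ), ?_, ?_⟩
  · rw [← simpleAct_densityPow, densityPow_rescale]
  · refine (coeFn_simpleMul r _ μ _).trans ?_
    filter_upwards [coeFn_rescale r hν.le ψ, hν.rnDeriv_ae_eq] with x hψ hg
    rw [hψ, hg, SimpleFunc.map_apply, mul_left_comm, ← Real.rpow_add (hν.pos x), sub_add_cancel]

theorem integral_eq (hν : HasSimpleDensity g μ ν) (f : Ω → ℝ) :
    ∫ x, f x ∂ν.1 = ∫ x, f x * g x ∂μ.1 := by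
  rw [hν.eq_withDensity, integral_withDensity_eq_integral_toReal_smul
    g.measurable.ennreal_ofReal (ae_of_all _ fun x => ENNReal.ofReal_lt_top)]
  refine integral_congr_ae (ae_of_all _ fun x => ?_)
  simp only [ENNReal.toReal_ofReal (hν.pos x).le, smul_eq_mul, mul_comm]

theorem tendsto_rootPow {κ : Type*} {l : Filter κ} {g : κ → SimpleFunc Ω ℝ} {ν : κ → FinMeas Ω}
    (hν : ∀ k, HasSimpleDensity (g k) μ (ν k)) (hg : TendstoUniformly (fun k => ⇑(g k)) 1 l) :
    Filter.Tendsto (fun k => rootPow r (ν k)) l (𝓝 (rootPow r μ)) := by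
  simp only [(hν _).rootPow_eq r]
  exact tendsto_simpleAct (tendstoUniformly_map_rpow hg _) tendsto_const_nhds

/-- With `b = 1 / |B|` the density `g k` is distributed over the factors, so that the moments of
`ν k` become moments of the fixed measure `μ`. -/
theorem tendsto_integral_prod {κ : Type*} {l : Filter κ} {g : κ → SimpleFunc Ω ℝ}
    {ν : κ → FinMeas Ω} (hν : ∀ k, HasSimpleDensity (g k) μ (ν k))
    (hg : TendstoUniformly (fun k => ⇑(g k)) 1 l) {ι : Type*} [Countable ι] {B : Finset ι}
    (hB : (B.card : ℝ) ≤ 1 / (r : ℝ)) (hB0 : B.Nonempty) {ψ : ∀ k, ι → Lp ℝ r.inv (ν k).1}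
    {φ : ι → Lp ℝ r.inv μ.1} (hψ : ∀ i, Filter.Tendsto (fun k => densityPow r (ν k) (ψ k i)) l
      (𝓝 (densityPow r μ (φ i)))) :
    Filter.Tendsto (fun k => ∫ x, ∏ i ∈ B, ψ k i x ∂(ν k).1) l
      (𝓝 (∫ x, ∏ i ∈ B, φ i x ∂μ.1)) := by
  have hcard : (B.card : ℝ) ≠ 0 := Nat.cast_ne_zero.2 hB0.card_pos.ne'
  choose χ hχ hχψ using fun k i => (hν k).exists_densityPow_eq (1 / (B.card : ℝ)) (ψ k i)
  have hχφ : ∀ i, Filter.Tendsto (fun k => χ k i) l (𝓝 (φ i)) := fun i => by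
    have hlim := tendsto_simpleAct (tendstoUniformly_map_rpow hg (1 / (B.card : ℝ) - r)) (hψ i)
    simp only [← hχ] at hlim
    rw [tendsto_iff_norm_sub_tendsto_zero] at hlim ⊢
    simpa only [← map_sub, norm_densityPow] using hlim
  refine (CongruentTensors.tendsto_integral_prod hB hχφ).congr fun k => ?_
  rw [(hν k).integral_eq]
  refine integral_congr_ae ?_
  filter_upwards [ae_all_iff.2 (hχψ k)] with x hx
  simp only [hx]
  rw [Finset.prod_mul_distrib, Finset.prod_const, ← Real.rpow_mul_natCast ((hν k).pos x).le,
    one_div_mul_cancel hcard, Real.rpow_one]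

end HasSimpleDensity

theorem Point.exists_hasSimpleDensity (μ : Point s Ω) {g : SimpleFunc Ω ℝ} (hpos : ∀ x, 0 < g x)
    (hg : simpleLp r μ.base (g - 1) ∈ tangent s r μ.base) :
    ∃ ν : Point s Ω, HasSimpleDensity g μ.base ν.base := by
  have hint : Integrable g μ.base.1 := g.integrable_of_isFiniteMeasure
  refine ⟨⟨⟨_, isFiniteMeasure_withDensity_ofReal hint.hasFiniteIntegral⟩, ?_⟩, hpos, rfl⟩
  cases s with
  | measures => trivial
  | probabilities =>
    have : IsProbabilityMeasure μ.base.1 := ⟨μ.admits⟩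
    have hsub : ∫ x, (g x - 1) ∂μ.base.1 = 0 :=
      (integral_congr_ae (coeFn_simpleLp r μ.base (g - 1))).symm.trans hg
    rw [integral_sub hint (integrable_const 1), integral_const, probReal_univ, one_smul,
      sub_eq_zero] at hsub
    change (μ.base.1.withDensity _) univ = 1
    rw [withDensity_apply _ MeasurableSet.univ, Measure.restrict_univ,
      ← ofReal_integral_eq_lintegral_ofReal hint (ae_of_all _ fun x => (hpos x).le), hsub,
      ENNReal.ofReal_one]

theorem HasSimpleDensity.ne {μ ν : Point s Ω} {g : SimpleFunc Ω ℝ}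
    (hν : HasSimpleDensity g μ.base ν.base) (hg : simpleLp r μ.base (g - 1) ≠ 0) : ν ≠ μ := by
  rintro rfl
  refine hg (Lp.ext ((coeFn_simpleLp r _ (g - 1)).trans ?_))
  filter_upwards [hν.rnDeriv_ae_eq, Measure.rnDeriv_self ν.base.1,
    Lp.coeFn_zero ℝ r.inv ν.base.1] with x hgx hself hzero
  rw [hzero, SimpleFunc.coe_sub, Pi.sub_apply, ← hgx, hself, ENNReal.toReal_one,
    SimpleFunc.coe_one, Pi.one_apply, sub_self, Pi.zero_apply]

theorem Point.exists_seq_hasSimpleDensity (μ : Point s Ω) {h : SimpleFunc Ω ℝ}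
    (hh : simpleLp r μ.base h ∈ tangent s r μ.base) (hh0 : simpleLp r μ.base h ≠ 0) :
    ∃ (g : ℕ → SimpleFunc Ω ℝ) (ν : ℕ → Point s Ω),
      TendstoUniformly (fun k => ⇑(g k)) 1 Filter.atTop ∧
      (∀ k, HasSimpleDensity (g k) μ.base (ν k).base) ∧ ∀ k, ν k ≠ μ := by
  have hunif := tendstoUniformly_one_add_smul h
  have hpos : ∀ᶠ δ in 𝓝 (0 : ℝ), ∀ x, 0 < (1 + δ • h) x := by
    filter_upwards [Metric.tendstoUniformly_iff.1 hunif 1 one_pos] with δ hδ x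
    have hlt := (abs_lt.1 ((Real.dist_eq _ _).symm.trans_lt (hδ x))).2
    rwa [Pi.one_apply, sub_lt_self_iff] at hlt
  obtain ⟨δ, hδ, hδpos⟩ := Filter.exists_seq_forall_of_frequently
    ((hpos.filter_mono nhdsWithin_le_nhds).and
      (self_mem_nhdsWithin : ∀ᶠ δ in 𝓝[≠] (0 : ℝ), δ ≠ 0)).frequently
  have hsub : ∀ k, simpleLp r μ.base (1 + δ k • h - 1) = δ k • simpleLp r μ.base h := fun k => by
    rw [add_sub_cancel_left, map_smul]
  choose ν hν using fun k => μ.exists_hasSimpleDensity (r := r) (hδpos k).1 <| by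
    rw [hsub]
    exact Submodule.smul_mem _ _ hh
  refine ⟨fun k => 1 + δ k • h, ν, fun u hu =>
    (hδ.mono_right nhdsWithin_le_nhds).eventually (hunif u hu), hν, fun k => (hν k).ne (r := r) ?_⟩
  rw [hsub]
  exact smul_ne_zero (hδpos k).2 hh0

end Perturbation

/-! ### The form of a congruent family -/

section Extension

variable {s : Setting} {r : Exponent} {n : ℕ} {Θ : TensorFamily.{u} s r n}
  {Ω : Type u} [MeasurableSpace Ω]

theorem HasCoeff.form_eq_of_simple {ν : Point s Ω} {c : ArgPartition (Fin n) → ℝ}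
    (hc : HasCoeff Θ ν.base.mass c) {φ : Fin n → tangent s r ν.base}
    (hφ : ∀ i, ∃ f : SimpleFunc Ω ℝ, (φ i : Lp ℝ r.inv ν.base.1) = simpleLp r ν.base f) :
    (Θ Ω).form ν φ = ∑ R, c R * momentProd ν.base.1 R fun i => (φ i : Lp ℝ r.inv ν.base.1) := by
  choose f hf using hφ
  have heval := hc Ω ν rfl f
  simp only [evalSimple_apply, ← hf, tangentProj_coe] at heval
  rw [heval]
  refine Finset.sum_congr rfl fun R _ => ?_
  congr 1
  refine Finset.prod_congr rfl fun B _ => integral_congr_ae ?_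
  filter_upwards [ae_all_iff.2 fun i => coeFn_simpleLp r ν.base (f i)] with x hx
  simp only [hf, hx]

theorem momentProd_zero {ι : Type*} [Fintype ι] [DecidableEq ι] [Nonempty ι] (r : Exponent)
    (μ : FinMeas Ω) (R : ArgPartition ι) :
    momentProd μ.1 R (fun _ => ((0 : Lp ℝ r.inv μ.1) : Ω → ℝ)) = 0 := by
  inhabit ι
  refine Finset.prod_eq_zero (R.part_mem.2 (Finset.mem_univ default)) ?_
  refine (integral_congr_ae ?_).trans (integral_zero Ω ℝ)
  filter_upwards [Lp.coeFn_zero ℝ r.inv μ.1] with x hx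
  rw [hx]
  exact Finset.prod_eq_zero (R.mem_part_self.2 (Finset.mem_univ _)) rfl

theorem eq_zero_of_forall_simpleLp_eq_zero {μ : Point s Ω}
    (h : ∀ f : SimpleFunc Ω ℝ, simpleLp r μ.base f ∈ tangent s r μ.base → simpleLp r μ.base f = 0)
    (φ : tangent s r μ.base) : φ = 0 := by
  have hrange : (range fun f : SimpleFunc Ω ℝ => tangentProj s r μ (simpleLp r μ.base f)) ⊆
      {0} := by
    rintro _ ⟨f, rfl⟩
    refine Subtype.ext ?_
    have hmem := (tangentProj s r μ (simpleLp r μ.base f)).2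
    rw [coe_tangentProj_simpleLp] at hmem ⊢
    exact h _ hmem
  have hclosure := closure_mono hrange (mem_closure_range_tangentProj μ φ)
  rwa [closure_singleton] at hclosure

theorem tendsto_sum_coeff_mul_momentProd {c : ℝ → ArgPartition (Fin n) → ℝ}
    (hc : ∀ m ∈ s.masses, HasCoeff Θ m (c m)) {μ : Point s Ω} (hμ : 0 < μ.base.mass)
    {φ : Fin n → tangent s r μ.base} {X : Fin n → VectorField s r Ω} (hX : ∀ i, (X i).val μ = φ i)
    {κ : Type*} {l : Filter κ} {g : κ → SimpleFunc Ω ℝ} {ν : κ → Point s Ω}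
    (hg : TendstoUniformly (fun k => ⇑(g k)) 1 l)
    (hν : ∀ k, HasSimpleDensity (g k) μ.base (ν k).base) (hmass : ∀ k, 0 < (ν k).base.mass) :
    Filter.Tendsto (fun k => ∑ R, c (ν k).base.mass R *
      momentProd (ν k).base.1 R fun i => ((X i).val (ν k) : Lp ℝ r.inv (ν k).base.1)) l
      (𝓝 (∑ R, c μ.base.mass R *
        momentProd μ.base.1 R fun i => (φ i : Lp ℝ r.inv μ.base.1))) := by
  have hroot := HasSimpleDensity.tendsto_rootPow (r := r) hν hg
  have hcoeff : ∀ R, Filter.Tendsto (fun k => c (ν k).base.mass R) l (𝓝 (c μ.base.mass R)) :=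
    fun R => ((continuousOn_coeff hc R) _ (μ.mass_mem_masses hμ)).tendsto.comp
      (tendsto_nhdsWithin_iff.2 ⟨tendsto_measureReal_of_tendsto_rootPow hroot MeasurableSet.univ,
        Filter.Eventually.of_forall fun k => (ν k).mass_mem_masses (hmass k)⟩)
  refine tendsto_finsetSum _ fun R _ => ?_
  by_cases hR : ∀ B ∈ R.parts, (B.card : ℝ) ≤ 1 / (r : ℝ)
  · refine (hcoeff R).mul (tendsto_finsetProd _ fun B hB =>
      HasSimpleDensity.tendsto_integral_prod hν hg (hR B hB) (R.nonempty_of_mem_parts hB)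
        fun i => ?_)
    rw [← hX i]
    exact tendsto_of_continuous_powTopology (X i).continuous_val hroot
  · push Not at hR
    obtain ⟨B, hB, hBr⟩ := hR
    have hzero : ∀ m ∈ s.masses, c m R = 0 := fun m hm =>
      (hc m hm).eq_zero_of_large_block hm hBr hB
    simp only [hzero _ (μ.mass_mem_masses hμ), hzero _ ((ν _).mass_mem_masses (hmass _)), zero_mul]
    exact tendsto_const_nhds

/-- Points other than `μ` are needed because the fields of `exists_field` are simple only away
from `μ`. -/
theorem form_eq_of_hasCoeff (hn : 1 ≤ n) {c : ℝ → ArgPartition (Fin n) → ℝ}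
    (hc : ∀ m ∈ s.masses, HasCoeff Θ m (c m)) (μ : Point s Ω) (hμ : 0 < μ.base.mass)
    (φ : Fin n → tangent s r μ.base) :
    (Θ Ω).form μ φ = ∑ R, c μ.base.mass R *
      momentProd μ.base.1 R fun i => (φ i : Lp ℝ r.inv μ.base.1) := by
  by_cases htriv : ∀ f : SimpleFunc Ω ℝ,
      simpleLp r μ.base f ∈ tangent s r μ.base → simpleLp r μ.base f = 0
  · have : Nonempty (Fin n) := ⟨⟨0, hn⟩⟩
    obtain rfl : φ = fun _ => 0 := funext fun i => eq_zero_of_forall_simpleLp_eq_zero htriv (φ i)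
    rw [((Θ Ω).form μ).map_coord_zero ⟨0, hn⟩ rfl]
    simp only [Submodule.coe_zero, momentProd_zero, mul_zero, Finset.sum_const_zero]
  push Not at htriv
  obtain ⟨h, hh, hh0⟩ := htriv
  obtain ⟨g, ν, hg, hν, hνμ⟩ := μ.exists_seq_hasSimpleDensity hh hh0
  have hmass : ∀ k, 0 < (ν k).base.mass := fun k => (hν k).mass_pos hμ
  choose X hXμ hX using fun i => exists_field μ (φ i)
  have hform := tendsto_of_continuous_powTopology ((Θ Ω).continuous_form X)
    (HasSimpleDensity.tendsto_rootPow hν hg)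
  simp only [hXμ] at hform
  refine tendsto_nhds_unique hform ((tendsto_sum_coeff_mul_momentProd hc hμ hXμ hg hν
    hmass).congr fun k => ?_)
  exact ((hc _ ((ν k).mass_mem_masses (hmass k))).form_eq_of_simple fun i =>
    hX i (ν k) (hνμ k)).symm

end Extension

/-! ### The differential of a model -/

section ModelDifferential

variable {Ω : Type u} [MeasurableSpace Ω] {r : Exponent}

theorem rescale_const_one_ae_eq (r : Exponent) {μ ν : FinMeas Ω} (h : μ ≤ ν) :
    rescale r h (Lp.const r.inv μ.1 (1 : ℝ)) =ᵐ[ν.1]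
      fun x => ((μ.1.rnDeriv ν.1 x).toReal) ^ (r : ℝ) :=
  (coeFn_rescale r h _).trans <| (ae_imp_rescale r ν (Lp.coeFn_const ..)).trans <|
    ae_of_all _ fun x => by simp only [Function.const_apply, one_mul]

theorem norm_simpleAct_rootPow_le_norm_add (r : Exponent) (f : SimpleFunc Ω ℝ) (μ ν : FinMeas Ω) :
    ‖simpleAct r f (rootPow r μ)‖ ≤
      ‖simpleAct r f (rootPow r μ) + simpleAct r f (rootPow r ν)‖ := by
  obtain ⟨κ, hμκ, hνκ⟩ := exists_ge_ge μ ν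
  rw [← map_add, rootPow, rootPow, ← densityPow_rescale r hμκ, ← densityPow_rescale r hνκ,
    ← map_add, simpleAct_densityPow, simpleAct_densityPow, norm_densityPow, norm_densityPow]
  set φ := rescale r hμκ (Lp.const r.inv μ.1 (1 : ℝ))
  set ψ := rescale r hνκ (Lp.const r.inv ν.1 (1 : ℝ))
  refine Lp.norm_le_norm_of_ae_le ?_
  filter_upwards [coeFn_simpleMul r f κ φ, coeFn_simpleMul r f κ (φ + ψ), Lp.coeFn_add φ ψ,
    rescale_const_one_ae_eq r hμκ, rescale_const_one_ae_eq r hνκ] with x hmul hmul' hadd hμ hν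
  have hφ0 : 0 ≤ φ x := hμ.symm ▸ by positivity
  have hψ0 : 0 ≤ ψ x := hν.symm ▸ by positivity
  rw [hmul, hmul', hadd, Pi.add_apply, norm_mul, norm_mul, Real.norm_of_nonneg hφ0,
    Real.norm_of_nonneg (add_nonneg hφ0 hψ0)]
  gcongr
  exact le_add_of_nonneg_right hψ0

theorem eq_zero_of_hasDerivAt_of_norm_le {V : Type*} [NormedAddCommGroup V] [NormedSpace ℝ V]
    {F : ℝ → V} {F' : V} (hF : HasDerivAt F F' 0) (h0 : F 0 = 0)
    (hle : ∀ t, ‖F t‖ ≤ ‖F t + F (-t)‖) : F' = 0 := by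
  have hneg : HasDerivAt (fun t => F (-t)) (-F') 0 := by
    rw [← neg_one_smul ℝ F']
    exact HasDerivAt.scomp (0 : ℝ) (by rwa [neg_zero]) (hasDerivAt_neg 0)
  have hsum : HasDerivAt (fun t => F t + F (-t)) 0 0 := by
    rw [← add_neg_cancel F']
    exact hF.add hneg
  refine hF.unique ?_
  rw [hasDerivAt_iff_isLittleO] at hsum ⊢
  simp only [neg_zero, h0, add_zero, sub_zero, smul_zero] at hsum ⊢
  exact (Asymptotics.isBigO_of_le _ hle).trans_isLittleO hsum

theorem exists_densityPow_eq_of_ae_imp (r : Exponent) {μ κ : FinMeas Ω} (h : μ ≤ κ)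
    (ψ : Lp ℝ r.inv κ.1) (hψ : ∀ᵐ x ∂κ.1, μ.1.rnDeriv κ.1 x = 0 → ψ x = 0) :
    ∃ φ : Lp ℝ r.inv μ.1, densityPow r μ φ = densityPow r κ ψ := by
  let g : Ω → ℝ := fun x => ((μ.1.rnDeriv κ.1 x).toReal) ^ (r : ℝ)
  have hmeas : StronglyMeasurable fun x => ψ x * (g x)⁻¹ :=
    ((Lp.stronglyMeasurable ψ).measurable.mul
      ((Measure.measurable_rnDeriv _ _).ennreal_toReal.pow_const _).inv).stronglyMeasurable
  have hcancel : (fun x => ψ x * (g x)⁻¹ * g x) =ᵐ[κ.1] ψ := by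
    filter_upwards [hψ, Measure.rnDeriv_lt_top μ.1 κ.1] with x hx htop
    by_cases h0 : μ.1.rnDeriv κ.1 x = 0
    · rw [hx h0, zero_mul, zero_mul]
    · exact inv_mul_cancel_right₀
        (Real.rpow_pos_of_pos (ENNReal.toReal_pos h0 htop.ne) _).ne' _
  have hLp : MemLp (fun x => ψ x * (g x)⁻¹) r.inv μ.1 := by
    refine ⟨hmeas.aestronglyMeasurable, ?_⟩
    rw [← eLpNorm_rescale r h hmeas]
    exact (eLpNorm_congr_ae hcancel).trans_lt (Lp.eLpNorm_lt_top ψ)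
  exact ⟨hLp.toLp _, densityPow_eq_of_ae_eq r h
    (hcancel.symm.trans (ae_imp_rescale r κ hLp.coeFn_toLp).symm)⟩

theorem simpleAct_restrict_densityPow_eq_zero_iff {A : Set Ω} (hA : MeasurableSet A)
    {μ : FinMeas Ω} {φ : Lp ℝ r.inv μ.1} :
    simpleAct r (SimpleFunc.restrict 1 A) (densityPow r μ φ) = 0 ↔
      ∀ᵐ x ∂μ.1, x ∈ A → φ x = 0 := by
  rw [simpleAct_densityPow, map_eq_zero_iff _ (densityPow_injective r μ), Lp.eq_zero_iff_ae_eq_zero]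
  refine Filter.eventually_congr ?_
  filter_upwards [coeFn_simpleMul r (SimpleFunc.restrict 1 A) μ φ] with x hx
  by_cases hxA : x ∈ A <;> simp [hx, SimpleFunc.coe_restrict _ hA, hxA]

variable {E : Type w} [NormedAddCommGroup E] [NormedSpace ℝ E]

/-- Let `A` be a null set of `f x₀`. Cut off to `A`, the powers `(f x)^r` vanish at `x₀` and are
nonnegative elsewhere, so that the cut-off `L` annihilates the derivative. -/
theorem exists_densityPow_eq_fderiv {f : E → FinMeas Ω} {D : E →L[ℝ] RootMeas r Ω} {x₀ : E}
    (hD : HasFDerivAt (fun x => rootPow r (f x)) D x₀) (v : E) :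
    ∃ φ : Lp ℝ r.inv (f x₀).1, densityPow r (f x₀) φ = D v := by
  obtain ⟨κ₀, ψ₀, hψ₀⟩ := exists_densityPow r (D v)
  obtain ⟨κ, hκ, hκ₀⟩ := exists_ge_ge (f x₀) κ₀
  rw [← densityPow_rescale r hκ₀] at hψ₀
  let A : Set Ω := {x | (f x₀).1.rnDeriv κ.1 x = 0}
  have hA : MeasurableSet A := Measure.measurable_rnDeriv _ _ (measurableSet_singleton 0)
  let L := simpleAct r (SimpleFunc.restrict 1 A)
  have hL : L (rootPow r (f x₀)) = 0 := by
    refine (simpleAct_restrict_densityPow_eq_zero_iff hA).2 ?_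
    filter_upwards [Measure.rnDeriv_pos hκ] with x hx hxA
    exact absurd hxA hx.ne'
  have hline : HasDerivAt (fun t : ℝ => L (rootPow r (f (x₀ + t • v)))) (L (D v)) 0 := by
    refine L.hasFDerivAt.comp_hasDerivAt (0 : ℝ)
      (HasFDerivAt.comp_hasDerivAt (l := fun x => rootPow r (f x)) (0 : ℝ) ?_ ?_)
    · simpa only [zero_smul, add_zero] using hD
    · have hsmul := ((hasDerivAt_id (0 : ℝ)).smul_const v).const_add x₀
      rw [one_smul] at hsmul
      exact hsmul
  have hzero : L (D v) = 0 := eq_zero_of_hasDerivAt_of_norm_le hline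
    (by simpa only [zero_smul, add_zero] using hL)
    fun t => norm_simpleAct_rootPow_le_norm_add r _ _ _
  rw [← hψ₀] at hzero ⊢
  exact exists_densityPow_eq_of_ae_imp r hκ _
    ((simpleAct_restrict_densityPow_eq_zero_iff hA).1 hzero)

theorem norm_rootPow (r : Exponent) (μ : FinMeas Ω) [IsProbabilityMeasure μ.1] :
    ‖rootPow r μ‖ = 1 := by
  rw [rootPow, norm_densityPow, Lp.norm_const' _ _ _ r.inv_ne_zero r.inv_ne_top, probReal_univ,
    Real.one_rpow, norm_one, mul_one]

theorem exists_dual_integral (r : Exponent) (μ : FinMeas Ω) [IsProbabilityMeasure μ.1] :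
    ∃ ℓ : StrongDual ℝ (RootMeas r Ω), ‖ℓ‖ ≤ 1 ∧
      ∀ φ : Lp ℝ r.inv μ.1, ℓ (densityPow r μ φ) = ∫ x, φ x ∂μ.1 := by
  let e := LinearEquiv.ofInjective (densityPow r μ) (densityPow_injective r μ)
  have hbound : ∀ x : (densityPow r μ).range,
      ‖(tangentForm .probabilities r μ ∘ₗ e.symm.toLinearMap) x‖ ≤ 1 * ‖x‖ := fun x => by
    obtain ⟨φ, rfl⟩ := e.surjective x
    rw [LinearMap.comp_apply, LinearEquiv.coe_coe, e.symm_apply_apply, one_mul]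
    exact (abs_integral_le_norm r φ).trans_eq (norm_densityPow r μ φ).symm
  obtain ⟨ℓ, hext, hnorm⟩ := exists_extension_norm_eq (densityPow r μ).range
    (LinearMap.mkContinuous _ 1 hbound)
  refine ⟨ℓ, hnorm.trans_le (LinearMap.mkContinuous_norm_le _ zero_le_one _), fun φ => ?_⟩
  refine (hext (e φ)).trans ?_
  rw [LinearMap.mkContinuous_apply, LinearMap.comp_apply, LinearEquiv.coe_coe, e.symm_apply_apply]
  rfl

/-- On probability measures, a norm one extension of `φ μ^r ↦ ∫ φ dμ` to `S^r(Ω)` is maximal at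
`μ^r`, hence its derivative vanishes there. -/
theorem mem_tangent_of_densityPow_eq_fderiv {s : Setting} {f : E → Point s Ω}
    {D : E →L[ℝ] RootMeas r Ω} {x₀ : E} (hD : HasFDerivAt (fun x => rootPow r (f x).base) D x₀)
    {v : E} {φ : Lp ℝ r.inv (f x₀).base.1} (hφ : densityPow r (f x₀).base φ = D v) :
    φ ∈ tangent s r (f x₀).base := by
  cases s with
  | measures => exact Submodule.mem_top
  | probabilities =>
    have hprob : ∀ x, IsProbabilityMeasure (f x).base.1 := fun x => ⟨(f x).admits⟩
    obtain ⟨ℓ, hℓ, hint⟩ := exists_dual_integral r (f x₀).base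
    have hone : ℓ (rootPow r (f x₀).base) = 1 :=
      (hint _).trans (tangentForm_const_one (f x₀))
    have hmax : IsLocalMax (fun x => ℓ (rootPow r (f x).base)) x₀ :=
      Filter.Eventually.of_forall fun x => by
        simp only [hone]
        calc ℓ (rootPow r (f x).base) ≤ ‖ℓ‖ * ‖rootPow r (f x).base‖ :=
              (le_abs_self _).trans (ℓ.le_opNorm _)
          _ ≤ 1 := by rwa [norm_rootPow, mul_one]
    have hzero := DFunLike.congr_fun (hmax.hasFDerivAt_eq_zero (ℓ.hasFDerivAt.comp x₀ hD)) v
    change ∫ x, φ x ∂(f x₀).base.1 = 0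
    rw [← hint, hφ]
    exact hzero

variable {M : Type v} [TopologicalSpace M] [ChartedSpace E M]

theorem exists_isRootDifferential {s : Setting} {p : M → Point s Ω} {ξ : M}
    (hp : MDifferentiableAt 𝓘(ℝ, E) 𝓘(ℝ, RootMeas r Ω) (fun ζ => rootPow r (p ζ).base) ξ) :
    ∃ D : TangentSpace 𝓘(ℝ, E) ξ →ₗ[ℝ] tangent s r (p ξ).base, IsRootDifferential r p ξ D := by
  let T : E →L[ℝ] RootMeas r Ω :=
    mfderiv 𝓘(ℝ, E) 𝓘(ℝ, RootMeas r Ω) (fun ζ => rootPow r (p ζ).base) ξ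
  let f : E → Point s Ω := fun x => p ((extChartAt 𝓘(ℝ, E) ξ).symm x)
  let x₀ : E := extChartAt 𝓘(ℝ, E) ξ ξ
  let ι : tangent s r (p ξ).base →ₗ[ℝ] RootMeas r Ω :=
    densityPow r (p ξ).base ∘ₗ (tangent s r (p ξ).base).subtype
  have hι : Function.Injective ι :=
    (densityPow_injective r (p ξ).base).comp (Submodule.injective_subtype _)
  have hfx : f x₀ = p ξ := congrArg p (extChartAt_to_inv (I := 𝓘(ℝ, E)) ξ)
  have hT : HasFDerivAt (fun x => rootPow r (f x).base) T x₀ := by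
    have hwithin := hp.hasMFDerivAt.2
    simp only [modelWithCornersSelf_coe, range_id] at hwithin
    exact hasFDerivWithinAt_univ.1 hwithin
  have hrange : ∀ v, T v ∈ ι.range := by
    suffices ∀ q, f x₀ = q → ∀ v, ∃ φ : tangent s r q.base, densityPow r q.base φ = T v from
      this (p ξ) hfx
    rintro q rfl v
    obtain ⟨φ, hφ⟩ := exists_densityPow_eq_fderiv hT v
    exact ⟨⟨φ, mem_tangent_of_densityPow_eq_fderiv hT hφ⟩, hφ⟩
  exact ⟨(LinearEquiv.ofInjective ι hι).symm.toLinearMap ∘ₗ T.toLinearMap.codRestrict _ hrange,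
    fun v => congrArg Subtype.val
      ((LinearEquiv.ofInjective ι hι).apply_symm_apply ⟨T v, hrange v⟩)⟩

end ModelDifferential

/-! ### Families generated by the canonical tensors -/

section Generated

variable {r : Exponent} {n : ℕ}

theorem partitionTensor_formalDeriv {Ω Ω' : Type u} [MeasurableSpace Ω] [MeasurableSpace Ω']
    {K : Kernel Ω Ω'} [IsMarkovKernel K] (hK : IsCongruentKernel K) (μ : FinMeas Ω)
    (R : ArgPartition (Fin n)) (φ : Fin n → Lp ℝ r.inv μ.1) :
    partitionTensor r (μ.push K) R (fun i => formalDeriv r K μ (φ i)) =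
      partitionTensor r μ R φ := by
  obtain ⟨κ, hκ⟩ := hK
  rw [partitionTensor_eq_momentProd r _ R fun i => IsRetraction.formalDeriv_ae_eq r hκ μ (φ i),
    partitionTensor_eq_momentProd r μ R fun i => Filter.EventuallyEq.rfl]
  congr 1
  exact Finset.prod_congr rfl fun B _ => IsRetraction.integral_comp hκ μ
    (f := fun x => ∏ i ∈ B, φ i x)
    (Finset.aestronglyMeasurable_fun_prod B fun i _ => Lp.aestronglyMeasurable (φ i))

theorem HasMeasureForm.isCongruentFamily {Θ : TensorFamily.{u} .measures r n}
    {a : BlockPartition r n 1 → C(Set.Ioi (0 : ℝ), ℝ)} (h : HasMeasureForm Θ a) :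
    IsCongruentFamily Θ := by
  intro Ω Ω' _ _ K _ hK μ
  ext φ
  rw [pullback, MultilinearMap.compLinearMap_apply, h, h]
  refine Finset.sum_congr rfl fun P _ => ?_
  rw [mass_push]
  congr 1
  exact partitionTensor_formalDeriv hK μ.base P.1 _

theorem HasProbabilityForm.isCongruentFamily {Θ : TensorFamily.{u} .probabilities r n}
    {c : BlockPartition r n 2 → ℝ} (h : HasProbabilityForm Θ c) : IsCongruentFamily Θ := by
  intro Ω Ω' _ _ K _ hK μ
  ext φ
  rw [pullback, MultilinearMap.compLinearMap_apply, h, h]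
  refine Finset.sum_congr rfl fun P _ => ?_
  congr 1
  exact partitionTensor_formalDeriv hK μ.base P.1 _

theorem IsCongruentFamily.isFinitelyCongruentFamily {s : Setting} {Θ : TensorFamily.{u} s r n}
    (h : IsCongruentFamily Θ) : IsFinitelyCongruentFamily Θ :=
  fun I Ω _ _ _ _ K _ hK μ => h I Ω K hK μ

theorem sum_blockPartition {b : ℕ} {F : ArgPartition (Fin n) → ℝ}
    (hF : ∀ R : ArgPartition (Fin n),
      ¬ (∀ B ∈ R.parts, b ≤ B.card ∧ (B.card : ℝ) ≤ 1 / (r : ℝ)) → F R = 0) :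
    ∑ P : BlockPartition r n b, F P.1 = ∑ R, F R :=
  Finset.sum_of_injOn Subtype.val Subtype.val_injective.injOn (fun _ _ => Finset.mem_univ _)
    (fun R _ hR => hF R fun h => hR ⟨⟨R, h⟩, Finset.mem_univ _, rfl⟩) fun _ _ => rfl

section Existence

variable {s : Setting} {Ω : Type u} [MeasurableSpace Ω]

theorem form_eq_sum_blockPartition {Θ : TensorFamily.{u} s r n} (hn : 1 ≤ n)
    {c : ℝ → ArgPartition (Fin n) → ℝ} (hc : ∀ m ∈ s.masses, HasCoeff Θ m (c m)) (μ : Point s Ω)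
    (hμ : 0 < μ.base.mass) (φ : Fin n → tangent s r μ.base) {b : ℕ}
    (hb : ∀ R : ArgPartition (Fin n), ∀ B ∈ R.parts, B.card < b →
      ∫ x, ∏ i ∈ B, (φ i : Lp ℝ r.inv μ.base.1) x ∂μ.base.1 = 0) :
    (Θ Ω).form μ φ = ∑ P : BlockPartition r n b, (r : ℝ) ^ n * c μ.base.mass P.1 *
      partitionTensor r μ.base P.1 fun i => (φ i : Lp ℝ r.inv μ.base.1) := by
  have hr : (r : ℝ) ^ n ≠ 0 := (pow_pos r.2.1 n).ne'
  rw [form_eq_of_hasCoeff hn hc μ hμ φ, ← sum_blockPartition (r := r) (b := b)]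
  · refine Finset.sum_congr rfl fun P _ => ?_
    rw [partitionTensor_eq_momentProd r μ.base P.1 fun i => Filter.EventuallyEq.rfl]
    field_simp
  · intro R hR
    push Not at hR
    obtain ⟨B, hB, hlarge⟩ := hR
    have hm := μ.mass_mem_masses hμ
    by_cases hbB : b ≤ B.card
    · rw [(hc _ hm).eq_zero_of_large_block hm (hlarge hbB) hB, zero_mul]
    · rw [momentProd, Finset.prod_eq_zero hB (hb R B hB (not_le.1 hbB)), mul_zero]

theorem eq_zero_of_mass_eq_zero {μ : FinMeas Ω} (h : μ.mass = 0) (φ : Lp ℝ r.inv μ.1) :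
    φ = 0 := by
  have hμ : μ.1 = 0 := Measure.measure_univ_eq_zero.1 ((measureReal_eq_zero_iff).1 h)
  refine Lp.ext ?_
  rw [ae_eq_bot.2 hμ]
  exact Filter.eventually_bot

theorem exists_hasMeasureForm (hn : 1 ≤ n) {Θ : TensorFamily.{u} .measures r n}
    (hΘ : IsFinitelyCongruentFamily Θ) : ∃ a, HasMeasureForm Θ a := by
  choose! c hc using fun m (hm : m ∈ Setting.measures.masses) => exists_hasCoeff hΘ hm
  refine ⟨fun P => ⟨fun m => (r : ℝ) ^ n * c m P.1, continuous_const.mul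
    (continuousOn_iff_continuous_domRestrict.1 (continuousOn_coeff hc P.1))⟩, fun Ω _ μ φ => ?_⟩
  have hμ : 0 ≤ μ.base.mass := measureReal_nonneg
  rcases hμ.eq_or_lt with h | h
  · rw [((Θ Ω).form μ).map_coord_zero ⟨0, hn⟩ (Subtype.ext (eq_zero_of_mass_eq_zero h.symm _)),
      generatedOnMeasures]
    refine (Finset.sum_eq_zero fun P _ => ?_).symm
    rw [coeffAt, dif_neg h.not_lt, zero_mul]
  · rw [form_eq_sum_blockPartition hn hc μ h φ (b := 1) fun R B hB hcard =>
      absurd (Finset.card_pos.2 (R.nonempty_of_mem_parts hB)) (by lia)]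
    refine Finset.sum_congr rfl fun P _ => ?_
    rw [coeffAt, dif_pos h]
    rfl

theorem exists_hasProbabilityForm (hn : 1 ≤ n) {Θ : TensorFamily.{u} .probabilities r n}
    (hΘ : IsFinitelyCongruentFamily Θ) : ∃ c, HasProbabilityForm Θ c := by
  choose! c hc using fun m (hm : m ∈ Setting.probabilities.masses) => exists_hasCoeff hΘ hm
  refine ⟨fun P => (r : ℝ) ^ n * c 1 P.1, fun Ω _ μ φ => ?_⟩
  have hprob : IsProbabilityMeasure μ.base.1 := ⟨μ.admits⟩
  have hmass : μ.base.mass = 1 := probReal_univ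
  rw [form_eq_sum_blockPartition hn hc μ (hmass ▸ one_pos) φ (b := 2), hmass]
  · rfl
  · intro R B hB hcard
    have hpos := Finset.card_pos.2 (R.nonempty_of_mem_parts hB)
    obtain ⟨i, rfl⟩ := Finset.card_eq_one.1 (show B.card = 1 by lia)
    simp only [Finset.prod_singleton]
    exact (φ i).2

end Existence

section Uniqueness

variable {b : ℕ}

theorem sum_mul_partitionTensor_eq {Ω : Type u} [MeasurableSpace Ω] (d : BlockPartition r n b → ℝ)
    (μ : FinMeas Ω) {φ : Fin n → Lp ℝ r.inv μ.1} {f : Fin n → Ω → ℝ} (h : ∀ i, φ i =ᵐ[μ.1] f i) :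
    ∑ P, d P * partitionTensor r μ P.1 φ =
      1 / (r : ℝ) ^ n * ∑ R, Function.extend Subtype.val d 0 R * momentProd μ.1 R f := by
  rw [← sum_blockPartition (r := r) (b := b), Finset.mul_sum]
  · refine Finset.sum_congr rfl fun P _ => ?_
    rw [Subtype.val_injective.extend_apply, partitionTensor_eq_momentProd r μ P.1 h,
      mul_left_comm]
  · intro R hR
    rw [Function.extend_apply', Pi.zero_apply, zero_mul]
    rintro ⟨P, rfl⟩
    exact hR P.2

theorem sum_extend_mul_momentProd_eq_zero {Ω : Type u} [MeasurableSpace Ω]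
    {d : BlockPartition r n b → ℝ} {μ : FinMeas Ω} {f : Fin n → SimpleFunc Ω ℝ}
    (h : ∑ P, d P * partitionTensor r μ P.1 (fun i => simpleLp r μ (f i)) = 0) :
    ∑ R, Function.extend Subtype.val d 0 R * momentProd μ.1 R (fun i => f i) = 0 := by
  rw [sum_mul_partitionTensor_eq d μ fun i => coeFn_simpleLp r μ (f i)] at h
  exact (mul_eq_zero.1 h).resolve_left (one_div_ne_zero (pow_pos r.2.1 n).ne')

theorem HasMeasureForm.unique (hn : 1 ≤ n) {Θ : TensorFamily.{u} .measures r n}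
    {a a' : BlockPartition r n 1 → C(Set.Ioi (0 : ℝ), ℝ)} (h : HasMeasureForm Θ a)
    (h' : HasMeasureForm Θ a') : a = a' := by
  ext P ⟨m, hm⟩
  let I := ULift.{u} (Fin n)
  have : Nonempty I := ⟨⟨⟨0, hn⟩⟩⟩
  let _ : MeasurableSpace I := ⊤
  have : DiscreteMeasurableSpace I := ⟨fun _ => trivial⟩
  obtain ⟨ν, hν⟩ := Point.exists_uniform (s := .measures) hm I
  have hcard : (0 : ℝ) < Fintype.card I := Nat.cast_pos.2 Fintype.card_pos
  have hmass : ν.base.mass = m := by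
    simp only [FinMeas.mass_eq_sum, hν, Finset.sum_const, Finset.card_univ, nsmul_eq_mul,
      mul_div_cancel₀ _ hcard.ne']
  have hzero := eq_zero_of_sum_momentProd_eq_zero (div_pos hm hcard).ne' hν (by simp [I])
    (Function.extend Subtype.val (fun P => a P ⟨m, hm⟩ - a' P ⟨m, hm⟩) 0) fun f => by
      refine sum_extend_mul_momentProd_eq_zero (f := fun i => simpleOfFinite (f i)) ?_
      have heq := (h I ν fun i =>
        ⟨simpleLp r _ (simpleOfFinite (f i)), Submodule.mem_top⟩).symm.trans (h' I ν _)
      simp only [generatedOnMeasures, hmass, coeffAt, mem_Ioi.1 hm, dif_pos] at heq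
      simp only [sub_mul, Finset.sum_sub_distrib]
      exact sub_eq_zero.2 heq
  have hP := congrFun hzero P.1
  rw [Subtype.val_injective.extend_apply] at hP
  exact sub_eq_zero.1 hP

/-- A vector in `ℝ^3` whose entries have mean zero, but nonzero higher power sums. -/
def skewVector : Fin 3 → ℝ := ![2, -1, -1]

theorem sum_skewVector_pow (k : ℕ) : ∑ y, skewVector y ^ k = 2 ^ k + 2 * (-1) ^ k := by
  simp only [skewVector, Fin.sum_univ_three, Matrix.cons_val]
  ring

theorem sum_skewVector_pow_ne_zero {k : ℕ} (hk : 2 ≤ k) : ∑ y, skewVector y ^ k ≠ 0 := by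
  rw [sum_skewVector_pow]
  have hpow : (2 : ℝ) ^ 2 ≤ 2 ^ k := pow_le_pow_right₀ one_le_two hk
  rcases neg_one_pow_eq_or ℝ k with h | h <;> rw [h] <;> linarith

/-- The function `e_x ⊗ skewVector`, the substitute for `e_x` in the space of functions of mean
zero. -/
def skewSingle {J : Type*} [DecidableEq J] (x : J) : J × Fin 3 → ℝ :=
  fun z => Pi.single (M := fun _ => ℝ) x 1 z.1 * skewVector z.2

variable {J : Type*} [DecidableEq J] [MeasurableSpace (J × Fin 3)]
  [MeasurableSingletonClass (J × Fin 3)] {μ : Measure (J × Fin 3)} [IsFiniteMeasure μ] {w : ℝ}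

theorem integral_prod_skewSingle [Fintype J] {ι : Type*} (hμ : ∀ z, μ.real {z} = w)
    (j : ι → J) (B : Finset ι) :
    ∫ z, ∏ i ∈ B, skewSingle (j i) z ∂μ =
      ∑ x, w * (∑ y, skewVector y ^ B.card) * ∏ i ∈ B, Pi.single (M := fun _ => ℝ) (j i) 1 x := by
  rw [integral_eq_sum_measureReal_mul, Fintype.sum_prod_type]
  refine Finset.sum_congr rfl fun x _ => ?_
  simp only [skewSingle, hμ, Finset.prod_mul_distrib, Finset.prod_const, ← Finset.mul_sum]
  ring

theorem integral_skewSingle [Finite J] (hμ : ∀ z, μ.real {z} = w) (x : J) :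
    ∫ z, skewSingle x z ∂μ = 0 := by
  cases nonempty_fintype J
  have h := integral_prod_skewSingle hμ id {x}
  simp only [Finset.prod_singleton, Finset.card_singleton, sum_skewVector_pow, id] at h
  rw [h]
  norm_num

open Classical in
theorem momentProd_skewSingle [Finite J] {ι : Type*} [Fintype ι] [DecidableEq ι]
    (hμ : ∀ z, μ.real {z} = w) (R : ArgPartition ι) (j : ι → J) :
    momentProd μ R (fun i => skewSingle (j i)) =
      if R ≤ kerPartition j then ∏ B ∈ R.parts, w * ∑ y, skewVector y ^ B.card else 0 := by
  cases nonempty_fintype J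
  have hblock : ∀ B ∈ R.parts, ∫ z, ∏ i ∈ B, skewSingle (j i) z ∂μ =
      if ∀ k ∈ B, ∀ l ∈ B, j k = j l then w * ∑ y, skewVector y ^ B.card else 0 := fun B hB => by
    obtain ⟨i, hi⟩ := R.nonempty_of_mem_parts hB
    rw [integral_prod_skewSingle hμ,
      sum_mul_prod_single hi j fun _ => w * ∑ y, skewVector y ^ B.card]
  rw [momentProd, Finset.prod_congr rfl hblock, Finset.prod_ite_zero]
  simp only [le_kerPartition_iff]
  congr

theorem eq_zero_of_sum_momentProd_skewSingle [Fintype J] {ι : Type*} [Fintype ι] [DecidableEq ι]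
    (hw : w ≠ 0) (hμ : ∀ z, μ.real {z} = w) (hJ : Fintype.card ι ≤ Fintype.card J)
    {c : ArgPartition ι → ℝ}
    (h : ∀ j : ι → J, ∑ R, c R * momentProd μ R (fun i => skewSingle (j i)) = 0)
    {R : ArgPartition ι} (hR : ∀ B ∈ R.parts, 2 ≤ B.card) : c R = 0 := by
  classical
  have hzero := eq_zero_of_sum_le_eq_zero
    (fun R => c R * ∏ B ∈ R.parts, w * ∑ y, skewVector y ^ B.card) fun Q _ => by
      obtain ⟨j, rfl⟩ := exists_kerPartition_eq (I := J) Q (Q.card_parts_le_card.trans hJ)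
      rw [← h j, Finset.sum_filter]
      simp only [momentProd_skewSingle hμ, mul_ite, mul_zero]
  exact (mul_eq_zero.1 (congrFun hzero R)).resolve_right <| Finset.prod_ne_zero_iff.2
    fun B hB => mul_ne_zero hw (sum_skewVector_pow_ne_zero (hR B hB))

theorem HasProbabilityForm.unique (hn : 1 ≤ n) {Θ : TensorFamily.{u} .probabilities r n}
    {c c' : BlockPartition r n 2 → ℝ} (h : HasProbabilityForm Θ c)
    (h' : HasProbabilityForm Θ c') : c = c' := by
  let J := ULift.{u} (Fin n)
  have : Nonempty J := ⟨⟨⟨0, hn⟩⟩⟩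
  let _ : MeasurableSpace (J × Fin 3) := ⊤
  have : DiscreteMeasurableSpace (J × Fin 3) := ⟨fun _ => trivial⟩
  obtain ⟨ν, hν⟩ := Point.exists_uniform (s := .probabilities) (mem_singleton 1) (J × Fin 3)
  have hcard : (Fintype.card (J × Fin 3) : ℝ) ≠ 0 := Nat.cast_ne_zero.2 Fintype.card_ne_zero
  let f : J → SimpleFunc (J × Fin 3) ℝ := fun x => simpleOfFinite (skewSingle x)
  have htan : ∀ x, simpleLp r ν.base (f x) ∈ tangent .probabilities r ν.base := fun x =>
    (integral_congr_ae (coeFn_simpleLp r ν.base (f x))).trans (integral_skewSingle hν x)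
  ext P
  have hP := eq_zero_of_sum_momentProd_skewSingle (one_div_ne_zero hcard) hν (by simp [J])
    (c := Function.extend Subtype.val (c - c') 0) (fun j => by
      refine sum_extend_mul_momentProd_eq_zero (f := fun i => f (j i)) ?_
      have heq := (h _ ν fun i => ⟨_, htan (j i)⟩).symm.trans (h' _ ν _)
      simp only [Pi.sub_apply, sub_mul, Finset.sum_sub_distrib]
      exact sub_eq_zero.2 heq) fun B hB => (P.2 B hB).1
  rw [Subtype.val_injective.extend_apply] at hP
  exact sub_eq_zero.1 hP

end Uniqueness

theorem existsUnique_hasMeasureForm (hn : 1 ≤ n) {Θ : TensorFamily.{u} .measures r n}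
    (hΘ : IsFinitelyCongruentFamily Θ) : ∃! a, HasMeasureForm Θ a :=
  have ⟨a, ha⟩ := exists_hasMeasureForm hn hΘ
  ⟨a, ha, fun _ ha' => ha'.unique hn ha⟩

theorem existsUnique_hasProbabilityForm (hn : 1 ≤ n) {Θ : TensorFamily.{u} .probabilities r n}
    (hΘ : IsFinitelyCongruentFamily Θ) : ∃! c, HasProbabilityForm Θ c :=
  have ⟨c, hc⟩ := exists_hasProbabilityForm hn hΘ
  ⟨c, hc, fun _ hc' => hc'.unique hn hc⟩

end Generated

end CongruentTensors

end

theorem mainTheorem1_general (r : Exponent) (n : ℕ) (hn : 1 ≤ n) :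
    (∀ Θ : TensorFamily.{u} Setting.measures r n,
      List.TFAE
        [IsCongruentFamily Θ,
         IsFinitelyCongruentFamily Θ,
         ∃! a : BlockPartition r n 1 → C(Set.Ioi (0 : ℝ), ℝ), HasMeasureForm Θ a] ∧
      (IsCongruentFamily Θ →
        ∃ a : BlockPartition r n 1 → C(Set.Ioi (0 : ℝ), ℝ),
          HasMeasureForm Θ a ∧
          ∀ (Ω : Type u) [MeasurableSpace Ω]
            (E : Type w) [NormedAddCommGroup E] [NormedSpace ℝ E]
            (M : Type v) [TopologicalSpace M] [ChartedSpace E M]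
            (p : M → Point Setting.measures Ω) (ξ : M),
            MDifferentiableAt 𝓘(ℝ, E) 𝓘(ℝ, RootMeas r Ω) (fun ζ => rootPow r (p ζ).base) ξ →
            ∃ D : TangentSpace 𝓘(ℝ, E) ξ →ₗ[ℝ] tangent Setting.measures r (p ξ).base,
              IsRootDifferential r p ξ D ∧
              ∀ V : Fin n → TangentSpace 𝓘(ℝ, E) ξ,
                modelPullback (Θ Ω) p ξ D V =
                  ∑ P, coeffAt (a P) (p ξ).base.mass * modelPartitionTensor p ξ D P.1 V)) ∧
    (∀ Θ : TensorFamily.{u} Setting.probabilities r n,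
      List.TFAE
        [IsCongruentFamily Θ,
         IsFinitelyCongruentFamily Θ,
         ∃! c : BlockPartition r n 2 → ℝ, HasProbabilityForm Θ c] ∧
      (IsCongruentFamily Θ →
        ∃ c : BlockPartition r n 2 → ℝ,
          HasProbabilityForm Θ c ∧
          ∀ (Ω : Type u) [MeasurableSpace Ω]
            (E : Type w) [NormedAddCommGroup E] [NormedSpace ℝ E]
            (M : Type v) [TopologicalSpace M] [ChartedSpace E M]
            (p : M → Point Setting.probabilities Ω) (ξ : M),
            MDifferentiableAt 𝓘(ℝ, E) 𝓘(ℝ, RootMeas r Ω) (fun ζ => rootPow r (p ζ).base) ξ →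
            ∃ D : TangentSpace 𝓘(ℝ, E) ξ →ₗ[ℝ] tangent Setting.probabilities r (p ξ).base,
              IsRootDifferential r p ξ D ∧
              ∀ V : Fin n → TangentSpace 𝓘(ℝ, E) ξ,
                modelPullback (Θ Ω) p ξ D V =
                  ∑ P, c P * modelPartitionTensor p ξ D P.1 V)) := by
  refine ⟨fun Θ => ⟨?_, fun hΘ => ?_⟩, fun Θ => ⟨?_, fun hΘ => ?_⟩⟩
  · tfae_have 1 → 2 := IsCongruentFamily.isFinitelyCongruentFamily
    tfae_have 2 → 3 := existsUnique_hasMeasureForm hn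
    tfae_have 3 → 1 := fun ⟨_, ha, _⟩ => ha.isCongruentFamily
    tfae_finish
  · obtain ⟨a, ha⟩ := exists_hasMeasureForm hn hΘ.isFinitelyCongruentFamily
    refine ⟨a, ha, fun Ω _ E _ _ M _ _ p ξ hp => ?_⟩
    obtain ⟨D, hD⟩ := exists_isRootDifferential hp
    exact ⟨D, hD, fun V => ha Ω (p ξ) fun i => D (V i)⟩
  · tfae_have 1 → 2 := IsCongruentFamily.isFinitelyCongruentFamily
    tfae_have 2 → 3 := existsUnique_hasProbabilityForm hn
    tfae_have 3 → 1 := fun ⟨_, hc, _⟩ => hc.isCongruentFamily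
    tfae_finish
  · obtain ⟨c, hc⟩ := exists_hasProbabilityForm hn hΘ.isFinitelyCongruentFamily
    refine ⟨c, hc, fun Ω _ E _ _ M _ _ p ξ hp => ?_⟩
    obtain ⟨D, hD⟩ := exists_isRootDifferential hp
    exact ⟨D, hD, fun V => hc Ω (p ξ) fun i => D (V i)⟩

theorem mainTheorem1 (r : Exponent) (n : ℕ) (hn : 1 ≤ n) :
    (∀ Θ : TensorFamily.{u} Setting.measures r n,
      List.TFAE
        [IsCongruentFamily Θ,
         IsFinitelyCongruentFamily Θ,
         ∃! a : BlockPartition r n 1 → C(Set.Ioi (0 : ℝ), ℝ), HasMeasureForm Θ a] ∧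
      (IsCongruentFamily Θ →
        ∃ a : BlockPartition r n 1 → C(Set.Ioi (0 : ℝ), ℝ),
          HasMeasureForm Θ a ∧
          ∀ (Ω : Type u) [MeasurableSpace Ω]
            (E : Type w) [NormedAddCommGroup E] [NormedSpace ℝ E]
            (M : Type v) [TopologicalSpace M] [ChartedSpace E M] [IsManifold 𝓘(ℝ, E) 1 M]
            (p : M → Point Setting.measures Ω), IsIntegrableModel (E := E) r p →
            ∀ ξ : M, ∃ D : TangentSpace 𝓘(ℝ, E) ξ →ₗ[ℝ] tangent Setting.measures r (p ξ).base,
              IsRootDifferential r p ξ D ∧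
              ∀ V : Fin n → TangentSpace 𝓘(ℝ, E) ξ,
                modelPullback (Θ Ω) p ξ D V =
                  ∑ P, coeffAt (a P) (p ξ).base.mass * modelPartitionTensor p ξ D P.1 V)) ∧
    (∀ Θ : TensorFamily.{u} Setting.probabilities r n,
      List.TFAE
        [IsCongruentFamily Θ,
         IsFinitelyCongruentFamily Θ,
         ∃! c : BlockPartition r n 2 → ℝ, HasProbabilityForm Θ c] ∧
      (IsCongruentFamily Θ →
        ∃ c : BlockPartition r n 2 → ℝ,
          HasProbabilityForm Θ c ∧
          ∀ (Ω : Type u) [MeasurableSpace Ω]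
            (E : Type w) [NormedAddCommGroup E] [NormedSpace ℝ E]
            (M : Type v) [TopologicalSpace M] [ChartedSpace E M] [IsManifold 𝓘(ℝ, E) 1 M]
            (p : M → Point Setting.probabilities Ω), IsIntegrableModel (E := E) r p →
            ∀ ξ : M,
              ∃ D : TangentSpace 𝓘(ℝ, E) ξ →ₗ[ℝ] tangent Setting.probabilities r (p ξ).base,
              IsRootDifferential r p ξ D ∧
              ∀ V : Fin n → TangentSpace 𝓘(ℝ, E) ξ,
                modelPullback (Θ Ω) p ξ D V =
                  ∑ P, c P * modelPartitionTensor p ξ D P.1 V)) := by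
  refine ⟨fun Θ => ⟨((mainTheorem1_general.{u, v, w} r n hn).1 Θ).1, fun hΘ => ?_⟩,
    fun Θ => ⟨((mainTheorem1_general.{u, v, w} r n hn).2 Θ).1, fun hΘ => ?_⟩⟩
  · obtain ⟨a, ha, hmodel⟩ := ((mainTheorem1_general.{u, v, w} r n hn).1 Θ).2 hΘ
    exact ⟨a, ha, fun Ω _ E _ _ M _ _ _ p hp ξ =>
      hmodel Ω E M p ξ ((hp.2 ξ).mdifferentiableAt one_ne_zero)⟩
  · obtain ⟨c, hc, hmodel⟩ := ((mainTheorem1_general.{u, v, w} r n hn).2 Θ).2 hΘ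
    exact ⟨c, hc, fun Ω _ E _ _ M _ _ _ p hp ξ =>
      hmodel Ω E M p ξ ((hp.2 ξ).mdifferentiableAt one_ne_zero)⟩
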